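/- Let $\Bbbk$ be a field and let $d\ge 1$ be an integer. Let $Q_A$ and $Q_B$ be quivers with finitely many vertices, let $a$ be a sink of $Q_A$ (no arrow starts at $a$) and $b$ a source of $Q_B$ (no arrow ends at $b$), and let $\mathcal R_A\subseteq \Bbbk Q_A$, $\mathcal R_B\subseteq \Bbbk Q_B$ be two-sided ideals such that $A=\Bbbk Q_A/\mathcal R_A$ and $B=\Bbbk Q_B/\mathcal R_B$ are finite dimensional and $e_a\notin\mathcal R_A$, $e_b\notin\mathcal R_B$ (e.g. $Q_A,Q_B$ finite and $\mathcal R_A,\mathcal R_B$ admissible ideals). The product $qp$ in a path algebra is "first $p$, then $q$". Let $Q_\Lambda$ be the quiver obtained from the disjoint union of $Q_A$ and $Q_B$ by identifying $a$ with $b$, let $e_A$ (resp. $e_B$) be the sum of the trivial paths at the vertices of $Q_A$ (resp. $Q_B$) in $\Bbbk Q_\Lambda$, and let $$\Lambda = A\,\Delta_S\, B=\Bbbk Q_\Lambda/\langle \mathcal R_A+\mathcal R_B+(1-e_A)\Bbbk Q_\Lambda(1-e_B)\rangle$$ be the sink-source gluing. Here $S$, the simple bridge, is the one-dimensional right $\Lambda$-module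 at the vertex $a=b$. For a ring $R$, $\operatorname{mod} R$ denotes the category of finitely generated right $R$-modules. Via restriction of scalars along the canonical surjections $\Lambda\to\Lambda/\langle 1-e_A\rangle\cong A$ and $\Lambda\to\Lambda/\langle 1-e_B\rangle\cong B$, regard $\operatorname{mod}A$ and $\operatorname{mod}B$ as full subcategories of $\operatorname{mod}\Lambda$. For a finite dimensional algebra $R$, a full subcategory $\mathcal M\subseteq\operatorname{mod}R$ is $d$-cluster tilting if it is functorially finite, generating and cogenerating, and $$\mathcal M=\{C\in \operatorname{mod}R\mid \operatorname{Ext}_R^i(C,\mathcal M)=0,\ 1\le i\le d-1\}=\{C\in \operatorname{mod}R\mid \operatorname{Ext}_R^i(\mathcal M,C)=0,\ 1\le i\le d-1\};$$ it is $d\mathbb Z$-cluster tilting if moreover $\operatorname{Ext}^i_R(\mathcal M,\mathcal M)\ne0$ implies $i\in d\mathbb Z$. Let $d\text{-}CT(R)$ be the set of $d$-cluster tilting subcategories of $\operatorname{mod}R$ of the form $\operatorname{add}M$ for some $M\in \operatorname{mod} R$, and let $d\text{-}CT_S(\Lambda)$ be the set of those $\mathcal M\in d\text{-}CT(\Lambda)$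 with $S\in\mathcal M$. Put $\mathcal M_A\,\Delta\,\mathcal M_B=\operatorname{add}(\mathcal M_A\cup\mathcal M_B)\subseteq\operatorname{mod}\Lambda$. Then the maps $$(\mathcal M_A,\mathcal M_B)\longmapsto\mathcal M_A\,\Delta\,\mathcal M_B,\qquad \mathcal M\longmapsto(\mathcal M\cap\operatorname{mod}A,\ \mathcal M\cap\operatorname{mod}B)$$ are mutually inverse bijections between $d\text{-}CT(A)\times d\text{-}CT(B)$ and $d\text{-}CT_S(\Lambda)$. Moreover, they restrict to mutually inverse bijections between $d\mathbb Z\text{-}CT(A)\times d\mathbb Z\text{-}CT(B)$ and $d\mathbb Z\text{-}CT_S(\Lambda)$, where these sets are defined in the same way with "$d\mathbb Z$-cluster tilting" in place of "$d$-cluster tilting". -/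

import Mathlib

open CategoryTheory CategoryTheory.Limits

universe u

set_option linter.unusedSectionVars false

noncomputable section

namespace SinkSource

/-! ### Path algebras

The composition convention is the one for right modules: the product `q * p` of two paths is the
path "first `p`, then `q`".  Thus `e j * A * e i` is spanned by the paths from `i` to `j`. -/

section PathAlgebra

/-- All paths of a quiver (source, target, path). -/
abbrev QPath (V : Type u) [Quiver.{u} V] : Type u := Σ i : V, Σ j : V, Quiver.Path i j

/-- The underlying vector space of the path algebra: the paths form a basis. -/
def PathAlgebra (k V : Type u) [Field k] [Quiver.{u} V] : Type u := QPath V →₀ k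

variable {k V : Type u} [Field k] [Quiver.{u} V]

instance : AddCommGroup (PathAlgebra k V) := inferInstanceAs (AddCommGroup (QPath V →₀ k))

instance : Module k (PathAlgebra k V) := inferInstanceAs (Module k (QPath V →₀ k))

/-- The basis of the path algebra given by the paths. -/
def PathAlgebra.basis : Module.Basis (QPath V) k (PathAlgebra k V) :=
  Module.Basis.ofRepr (LinearEquiv.refl k (QPath V →₀ k))

/-- A path as an element of the path algebra. -/
def PathAlgebra.path {i j : V} (p : Quiver.Path i j) : PathAlgebra k V :=
  PathAlgebra.basis ⟨i, j, p⟩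

/-- The idempotent of a vertex (the trivial path). -/
def PathAlgebra.vertex (i : V) : PathAlgebra k V :=
  PathAlgebra.path (Quiver.Path.nil : Quiver.Path i i)

/-- An arrow as an element of the path algebra. -/
def PathAlgebra.arrow {i j : V} (f : i ⟶ j) : PathAlgebra k V :=
  PathAlgebra.path f.toPath

open PathAlgebra

lemma PathAlgebra.hom_ext {M : Type*} [AddCommMonoid M] [Module k M]
    {f g : PathAlgebra k V →ₗ[k] M}
    (h : ∀ (i j : V) (p : Quiver.Path i j), f (path p) = g (path p)) : f = g :=
  PathAlgebra.basis.ext fun ⟨i, j, p⟩ => h i j p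

lemma PathAlgebra.induction_linear {P : PathAlgebra k V → Prop} (x : PathAlgebra k V)
    (zero : P 0) (add : ∀ x y, P x → P y → P (x + y)) (smul : ∀ (c : k) (x), P x → P (c • x))
    (path : ∀ {i j : V} (p : Quiver.Path i j), P (path p)) : P x := by
  have hx : x ∈ Submodule.span k (Set.range (PathAlgebra.basis (k := k) (V := V))) := by
    rw [PathAlgebra.basis.span_eq]; trivial
  induction hx using Submodule.span_induction with
  | mem x h => obtain ⟨⟨i, j, p⟩, rfl⟩ := h; exact path p
  | zero => exact zero
  | add x y _ _ hx hy => exact add x y hx hy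
  | smul c x _ hx => exact smul c x hx

open Classical in
/-- Product of two paths: concatenation `first p, then q` if possible, and zero otherwise. -/
def PathAlgebra.mulPath (q p : QPath V) : PathAlgebra k V :=
  if h : p.2.1 = q.1 then path (p.2.2.comp (q.2.2.cast h.symm rfl)) else 0

/-- The multiplication of the path algebra, as a bilinear map. -/
def PathAlgebra.mulHom : PathAlgebra k V →ₗ[k] PathAlgebra k V →ₗ[k] PathAlgebra k V :=
  PathAlgebra.basis.constr k fun q => PathAlgebra.basis.constr k fun p => mulPath q p

instance : Mul (PathAlgebra k V) := ⟨fun x y => mulHom x y⟩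

instance [Fintype V] : One (PathAlgebra k V) := ⟨∑ i, vertex i⟩

lemma PathAlgebra.mul_def (x y : PathAlgebra k V) : x * y = mulHom x y := rfl

lemma PathAlgebra.one_def [Fintype V] : (1 : PathAlgebra k V) = ∑ i, vertex i := rfl

lemma PathAlgebra.mulHom_basis (q p : QPath V) :
    mulHom (basis q) (basis p) = (mulPath q p : PathAlgebra k V) := by
  simp [mulHom]

lemma PathAlgebra.path_mul_path {i j l : V} (q : Quiver.Path j l) (p : Quiver.Path i j) :
    (path q * path p : PathAlgebra k V) = path (p.comp q) := by
  rw [mul_def, path, path, mulHom_basis]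
  simp [mulPath]

lemma PathAlgebra.path_mul_path_of_ne {i j j' l : V} (q : Quiver.Path j' l) (p : Quiver.Path i j)
    (h : j ≠ j') : (path q * path p : PathAlgebra k V) = 0 := by
  rw [mul_def, path, path, mulHom_basis]
  simp [mulPath, h]

lemma mul_assoc_path {a b c d e f : V} (r : Quiver.Path e f) (q : Quiver.Path c d)
    (p : Quiver.Path a b) :
    (path r * path q * path p : PathAlgebra k V) = path r * (path q * path p) := by
  by_cases h1 : d = e
  · subst h1
    rw [path_mul_path]
    by_cases h2 : b = c
    · subst h2
      rw [path_mul_path, path_mul_path, path_mul_path, Quiver.Path.comp_assoc]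
    · rw [path_mul_path_of_ne _ _ h2, path_mul_path_of_ne _ _ h2]
      simp [mul_def]
  · rw [path_mul_path_of_ne _ _ h1]
    by_cases h2 : b = c
    · subst h2
      rw [path_mul_path, path_mul_path_of_ne _ _ h1]
      simp [mul_def]
    · rw [path_mul_path_of_ne _ _ h2]
      simp [mul_def]

lemma one_mul_path [Fintype V] {i j : V} (p : Quiver.Path i j) :
    (1 * path p : PathAlgebra k V) = path p := by
  classical
  rw [one_def, mul_def, map_sum, LinearMap.sum_apply, Finset.sum_eq_single j]
  · rw [← mul_def, vertex, path_mul_path, Quiver.Path.comp_nil]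
  · intro b _ hb
    rw [← mul_def, vertex, path_mul_path_of_ne _ _ (Ne.symm hb)]
  · simp

lemma path_mul_one [Fintype V] {i j : V} (p : Quiver.Path i j) :
    (path p * 1 : PathAlgebra k V) = path p := by
  classical
  rw [one_def, mul_def, map_sum, Finset.sum_eq_single i]
  · rw [← mul_def, vertex, path_mul_path, Quiver.Path.nil_comp]
  · intro b _ hb
    rw [← mul_def, vertex, path_mul_path_of_ne _ _ hb]
  · simp

instance [Fintype V] : Ring (PathAlgebra k V) :=
  { (inferInstance : AddCommGroup (PathAlgebra k V)),
    (inferInstance : Mul (PathAlgebra k V)),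
    (inferInstance : One (PathAlgebra k V)) with
    left_distrib := fun x y z => by simp [mul_def]
    right_distrib := fun x y z => by simp [mul_def]
    zero_mul := fun x => by simp [mul_def]
    mul_zero := fun x => by simp [mul_def]
    mul_assoc := fun x y z => by
      induction x using PathAlgebra.induction_linear with
      | zero => simp [mul_def]
      | add x x' hx hx' => simp only [mul_def, map_add, LinearMap.add_apply] at *; rw [hx, hx']
      | smul c x hx => simp only [mul_def, map_smul, LinearMap.smul_apply] at *; rw [hx]
      | path r =>
      induction y using PathAlgebra.induction_linear with
      | zero => simp [mul_def]
      | add y y' hy hy' => simp only [mul_def, map_add, LinearMap.add_apply] at *; rw [hy, hy']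
      | smul c y hy => simp only [mul_def, map_smul, LinearMap.smul_apply] at *; rw [hy]
      | path q =>
      induction z using PathAlgebra.induction_linear with
      | zero => simp [mul_def]
      | add z z' hz hz' => simp only [mul_def, map_add] at *; rw [hz, hz']
      | smul c z hz => simp only [mul_def, map_smul] at *; rw [hz]
      | path p => exact mul_assoc_path r q p
    one_mul := fun x => by
      have h : mulHom (k := k) (V := V) 1 = LinearMap.id :=
        hom_ext fun i j p => one_mul_path p
      exact congrArg (fun f => f x) h
    mul_one := fun x => by
      have h : (mulHom (k := k) (V := V)).flip 1 = LinearMap.id :=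
        hom_ext fun i j p => path_mul_one p
      exact congrArg (fun f => f x) h }

instance [Fintype V] : Algebra k (PathAlgebra k V) :=
  Algebra.ofModule (fun c x y => by simp [mul_def]) (fun c x y => by simp [mul_def])

section Lift

variable {R : Type u} [Ring R] [Algebra k R]

/-- The value of a path under the assignment `E` of elements to the vertices and `F` to the
arrows. -/
def PathAlgebra.pathVal (E : V → R) (F : ∀ ⦃i j : V⦄, (i ⟶ j) → R) {i : V} :
    ∀ {j : V}, Quiver.Path i j → R
  | _, Quiver.Path.nil => E i
  | _, Quiver.Path.cons p f => F f * PathAlgebra.pathVal E F p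

/-- An assignment of elements of an algebra to the vertices and arrows of a quiver which satisfies
the defining relations of the path algebra. -/
structure PathAlgebra.IsRep [Fintype V] (E : V → R) (F : ∀ ⦃i j : V⦄, (i ⟶ j) → R) : Prop where
  idem : ∀ i, E i * E i = E i
  orth : ∀ i j, i ≠ j → E i * E j = 0
  sum_eq : ∑ i, E i = 1
  tgt : ∀ ⦃i j : V⦄ (f : i ⟶ j), E j * F f = F f
  src : ∀ ⦃i j : V⦄ (f : i ⟶ j), F f * E i = F f

variable [Fintype V] {E : V → R} {F : ∀ ⦃i j : V⦄, (i ⟶ j) → R}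

lemma PathAlgebra.IsRep.tgt_pathVal (h : IsRep E F) {i j : V} (p : Quiver.Path i j) :
    E j * pathVal E F p = pathVal E F p := by
  cases p with
  | nil => exact h.idem i
  | cons p f => rw [pathVal, ← mul_assoc, h.tgt]

lemma PathAlgebra.IsRep.pathVal_src (h : IsRep E F) {i j : V} (p : Quiver.Path i j) :
    pathVal E F p * E i = pathVal E F p := by
  induction p with
  | nil => exact h.idem i
  | cons p f ih => rw [pathVal, mul_assoc, ih]

lemma PathAlgebra.IsRep.pathVal_comp (h : IsRep E F) {i j l : V} (p : Quiver.Path i j)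
    (q : Quiver.Path j l) : pathVal E F (p.comp q) = pathVal E F q * pathVal E F p := by
  induction q with
  | nil => exact (h.tgt_pathVal p).symm
  | cons q f ih => rw [Quiver.Path.comp_cons, pathVal, ih, pathVal, mul_assoc]

/-- The linear extension of `pathVal`. -/
def PathAlgebra.liftLin (E : V → R) (F : ∀ ⦃i j : V⦄, (i ⟶ j) → R) : PathAlgebra k V →ₗ[k] R :=
  PathAlgebra.basis.constr k fun p => pathVal E F p.2.2

lemma PathAlgebra.liftLin_path {i j : V} (p : Quiver.Path i j) :
    liftLin (k := k) E F (path p) = pathVal E F p := by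
  simp [liftLin, path]

/-- The universal property of the path algebra. -/
def PathAlgebra.lift (E : V → R) (F : ∀ ⦃i j : V⦄, (i ⟶ j) → R) (h : IsRep E F) :
    PathAlgebra k V →ₐ[k] R :=
  AlgHom.ofLinearMap (liftLin E F)
    (by simp only [one_def, map_sum, vertex, liftLin_path, pathVal, h.sum_eq])
    (fun x y => by
      induction x using PathAlgebra.induction_linear with
      | zero => simp
      | add x x' hx hx' => simp only [add_mul, map_add, hx, hx']
      | smul c x hx => simp only [smul_mul_assoc, map_smul, hx]
      | path q =>
      induction y using PathAlgebra.induction_linear with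
      | zero => simp
      | add y y' hy hy' => simp only [mul_add, map_add, hy, hy']
      | smul c y hy => simp only [mul_smul_comm, map_smul, hy]
      | @path i j p =>
      rename_i j' l
      by_cases hj : j = j'
      · subst hj
        rw [path_mul_path, liftLin_path, liftLin_path, liftLin_path, h.pathVal_comp]
      · rw [path_mul_path_of_ne _ _ hj, map_zero, liftLin_path, liftLin_path,
          ← h.pathVal_src q, ← h.tgt_pathVal p, mul_assoc, ← mul_assoc (E j') (E j),
          h.orth _ _ (Ne.symm hj), zero_mul, mul_zero])

lemma PathAlgebra.lift_path (h : IsRep E F) {i j : V} (p : Quiver.Path i j) :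
    lift (k := k) E F h (path p) = pathVal E F p :=
  liftLin_path p

end Lift

/-- A sink: no arrow starts at it. -/
def IsSink (a : V) : Prop := ∀ j : V, IsEmpty (a ⟶ j)

/-- A source: no arrow ends at it. -/
def IsSource (b : V) : Prop := ∀ j : V, IsEmpty (j ⟶ b)

/-- The algebra of the quiver with vertex set `V` with relations `R`. -/
abbrev BoundAlgebra [Fintype V] (R : TwoSidedIdeal (PathAlgebra k V)) : Type u :=
  PathAlgebra k V ⧸ R.asIdeal

section Aug

variable [Fintype V]

open Classical in
/-- The one-dimensional representation at `v`: the trivial path at `v` is sent to `1`, every other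
path is sent to `0`. -/
def PathAlgebra.aug (v : V) : PathAlgebra k V →ₐ[k] k :=
  PathAlgebra.lift (fun i => if i = v then 1 else 0) (fun _ _ _ => 0)
    { idem := fun i => by simp
      orth := fun i j h => by
        by_cases hi : i = v
        · subst hi; simp [Ne.symm h]
        · simp [hi]
      sum_eq := by simp
      tgt := fun i j f => by simp
      src := fun i j f => by simp }

lemma PathAlgebra.aug_vertex_self (v : V) : aug (k := k) v (vertex v) = 1 := by
  rw [aug, vertex, lift_path, pathVal, if_pos rfl]

lemma PathAlgebra.aug_vertex_of_ne {v i : V} (h : i ≠ v) : aug (k := k) v (vertex i) = 0 := by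
  rw [aug, vertex, lift_path, pathVal, if_neg h]

lemma PathAlgebra.aug_cons (v : V) {i j l : V} (p : Quiver.Path i j) (f : j ⟶ l) :
    aug (k := k) v (path (p.cons f)) = 0 := by
  rw [aug, lift_path, pathVal, zero_mul]

lemma PathAlgebra.mul_vertex_of_isSink {a : V} (ha : IsSink a) (x : PathAlgebra k V) :
    x * vertex a = aug a x • vertex a := by
  induction x using PathAlgebra.induction_linear with
  | zero => simp
  | add x y hx hy => rw [add_mul, hx, hy, map_add, add_smul]
  | smul c x hx => rw [smul_mul_assoc, hx, map_smul, smul_smul, smul_eq_mul]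
  | @path i j p =>
    by_cases h : a = i
    · subst h
      have hp : ∀ {j : V} (p : Quiver.Path a j), ∃ h : a = j, p = Quiver.Path.nil.cast rfl h := by
        intro j p
        induction p with
        | nil => exact ⟨rfl, rfl⟩
        | cons p f ih => obtain ⟨rfl, -⟩ := ih; exact ((ha _).false f).elim
      obtain ⟨rfl, rfl⟩ := hp p
      have h1 := aug_vertex_self (k := k) a
      rw [vertex] at h1
      simp only [Quiver.Path.cast_rfl_rfl, vertex, path_mul_path, Quiver.Path.comp_nil, h1,
        one_smul]
    · rw [vertex, path_mul_path_of_ne _ _ h]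
      cases p with
      | nil =>
        have h1 := aug_vertex_of_ne (k := k) (Ne.symm h)
        rw [vertex] at h1
        rw [h1, zero_smul]
      | cons p f => rw [aug_cons, zero_smul]

lemma PathAlgebra.vertex_mul_of_isSource {b : V} (hb : IsSource b) (x : PathAlgebra k V) :
    vertex b * x = aug b x • vertex b := by
  induction x using PathAlgebra.induction_linear with
  | zero => simp
  | add x y hx hy => rw [mul_add, hx, hy, map_add, add_smul]
  | smul c x hx => rw [mul_smul_comm, hx, map_smul, smul_smul, smul_eq_mul]
  | @path i j p =>
    cases p with
    | nil =>
      by_cases h : i = b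
      · subst h
        have h1 := aug_vertex_self (k := k) i
        rw [vertex] at h1
        rw [h1, vertex, path_mul_path, Quiver.Path.comp_nil, one_smul]
      · have h1 := aug_vertex_of_ne (k := k) h
        rw [vertex] at h1
        rw [h1, vertex, path_mul_path_of_ne _ _ h, zero_smul]
    | cons p f =>
      have h : j ≠ b := by rintro rfl; exact (hb _).false f
      rw [aug_cons, zero_smul, vertex, path_mul_path_of_ne _ _ h]

lemma PathAlgebra.aug_eq_zero_of_isSink {a : V} (ha : IsSink a)
    {R : TwoSidedIdeal (PathAlgebra k V)} (hR : vertex a ∉ R) {x : PathAlgebra k V} (hx : x ∈ R) :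
    aug a x = 0 := by
  by_contra h
  have h1 := R.mul_mem_left ((aug a x)⁻¹ • 1) _ (R.mul_mem_right _ (vertex a) hx)
  rw [mul_vertex_of_isSink ha, smul_mul_assoc, one_mul, smul_smul, inv_mul_cancel₀ h,
    one_smul] at h1
  exact hR h1

lemma PathAlgebra.aug_eq_zero_of_isSource {b : V} (hb : IsSource b)
    {R : TwoSidedIdeal (PathAlgebra k V)} (hR : vertex b ∉ R) {x : PathAlgebra k V} (hx : x ∈ R) :
    aug b x = 0 := by
  by_contra h
  have h1 := R.mul_mem_left ((aug b x)⁻¹ • 1) _ (R.mul_mem_left (vertex b) _ hx)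
  rw [vertex_mul_of_isSource hb, smul_mul_assoc, one_mul, smul_smul, inv_mul_cancel₀ h,
    one_smul] at h1
  exact hR h1

end Aug

/-- The (non-unital) linear map of path algebras induced by a morphism of quivers. -/
def PathAlgebra.mapLin {W : Type u} [Quiver.{u} W] (φ : V ⥤q W) :
    PathAlgebra k V →ₗ[k] PathAlgebra k W :=
  PathAlgebra.basis.constr k fun p => path (φ.mapPath p.2.2)

lemma PathAlgebra.mapLin_path {W : Type u} [Quiver.{u} W] (φ : V ⥤q W) {i j : V}
    (p : Quiver.Path i j) : mapLin (k := k) φ (path p) = path (φ.mapPath p) := by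
  rw [mapLin, path, Module.Basis.constr_basis]

end PathAlgebra

/-! ### The sink-source gluing -/

section Gluing

open PathAlgebra

variable {VA VB : Type u} [Quiver.{u} VA] [Quiver.{u} VB]

/-- The relation identifying `a` with `b` in the disjoint union of the two vertex sets. -/
def GlueRel (a : VA) (b : VB) (x y : VA ⊕ VB) : Prop := x = Sum.inl a ∧ y = Sum.inr b

/-- The vertex set of the glued quiver: the disjoint union of the two vertex sets with `a` and `b`
identified. -/
def GlueVertex (a : VA) (b : VB) : Type u := Quot (GlueRel a b)

/-- The vertex of the glued quiver given by a vertex of the first quiver. -/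
def GlueVertex.inA (a : VA) (b : VB) (i : VA) : GlueVertex a b := Quot.mk _ (Sum.inl i)

/-- The vertex of the glued quiver given by a vertex of the second quiver. -/
def GlueVertex.inB (a : VA) (b : VB) (j : VB) : GlueVertex a b := Quot.mk _ (Sum.inr j)

lemma GlueVertex.inA_eq_inB (a : VA) (b : VB) : inA a b a = inB a b b := Quot.sound ⟨rfl, rfl⟩

instance [Fintype VA] [Fintype VB] (a : VA) (b : VB) : Fintype (GlueVertex a b) :=
  haveI : Finite (GlueVertex a b) := inferInstanceAs (Finite (Quot (GlueRel a b)))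
  Fintype.ofFinite _

/-- The arrows of the glued quiver: the arrows of the two given quivers. -/
inductive GlueHom (a : VA) (b : VB) : GlueVertex a b → GlueVertex a b → Type u
  | ofA {i j : VA} (f : i ⟶ j) : GlueHom a b (GlueVertex.inA a b i) (GlueVertex.inA a b j)
  | ofB {i j : VB} (f : i ⟶ j) : GlueHom a b (GlueVertex.inB a b i) (GlueVertex.inB a b j)

/-- The glued quiver. -/
instance (a : VA) (b : VB) : Quiver.{u} (GlueVertex a b) := ⟨GlueHom a b⟩

/-- The inclusion of the first quiver in the glued quiver. -/
def inclA (a : VA) (b : VB) : VA ⥤q GlueVertex a b where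
  obj := GlueVertex.inA a b
  map f := GlueHom.ofA f

/-- The inclusion of the second quiver in the glued quiver. -/
def inclB (a : VA) (b : VB) : VB ⥤q GlueVertex a b where
  obj := GlueVertex.inB a b
  map f := GlueHom.ofB f

variable {k : Type u} [Field k] [Fintype VA] [Fintype VB]

/-- The sum `e_A` of the idempotents of the vertices of the first quiver. -/
def idemA (k : Type u) [Field k] (a : VA) (b : VB) : PathAlgebra k (GlueVertex a b) :=
  ∑ i : VA, vertex (GlueVertex.inA a b i)

/-- The sum `e_B` of the idempotents of the vertices of the second quiver. -/
def idemB (k : Type u) [Field k] (a : VA) (b : VB) : PathAlgebra k (GlueVertex a b) :=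
  ∑ j : VB, vertex (GlueVertex.inB a b j)

/-- The relations of the gluing: the two-sided ideal generated by the relations of both algebras
and by `(1 - e_A) kQ (1 - e_B)`. -/
def glueRelations (a : VA) (b : VB) (RA : TwoSidedIdeal (PathAlgebra k VA))
    (RB : TwoSidedIdeal (PathAlgebra k VB)) : TwoSidedIdeal (PathAlgebra k (GlueVertex a b)) :=
  TwoSidedIdeal.span
    (mapLin (inclA a b) '' {x | x ∈ RA} ∪ mapLin (inclB a b) '' {x | x ∈ RB} ∪
      Set.range fun x => (1 - idemA k a b) * x * (1 - idemB k a b))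

/-- The sink-source gluing of the algebras `kQ_A / R_A` and `kQ_B / R_B` along `a` and `b`. -/
abbrev Gluing (a : VA) (b : VB) (RA : TwoSidedIdeal (PathAlgebra k VA))
    (RB : TwoSidedIdeal (PathAlgebra k VB)) : Type u :=
  BoundAlgebra (glueRelations a b RA RB)

open Classical in
/-- A vertex of the glued quiver as a vertex of the first quiver, if it is one. -/
def GlueVertex.toA (a : VA) (b : VB) : GlueVertex a b → Option VA :=
  Quot.lift (Sum.elim some fun j => if j = b then some a else none) (by
    rintro _ _ ⟨rfl, rfl⟩; simp)

open Classical in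
/-- A vertex of the glued quiver as a vertex of the second quiver, if it is one. -/
def GlueVertex.toB (a : VA) (b : VB) : GlueVertex a b → Option VB :=
  Quot.lift (Sum.elim (fun i => if i = a then some b else none) some) (by
    rintro _ _ ⟨rfl, rfl⟩; simp)

lemma GlueVertex.toA_inA (a : VA) (b : VB) (i : VA) : toA a b (inA a b i) = some i := rfl

lemma GlueVertex.toB_inB (a : VA) (b : VB) (j : VB) : toB a b (inB a b j) = some j := rfl

lemma GlueVertex.toA_inB_self (a : VA) (b : VB) : toA a b (inB a b b) = some a := if_pos rfl

lemma GlueVertex.toB_inA_self (a : VA) (b : VB) : toB a b (inA a b a) = some b := if_pos rfl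

lemma GlueVertex.toA_inB_of_ne (a : VA) (b : VB) {j : VB} (h : j ≠ b) :
    toA a b (inB a b j) = none := if_neg h

lemma GlueVertex.toB_inA_of_ne (a : VA) (b : VB) {i : VA} (h : i ≠ a) :
    toB a b (inA a b i) = none := if_neg h

lemma GlueVertex.inA_of_toA {a : VA} {b : VB} {v : GlueVertex a b} {i : VA}
    (h : toA a b v = some i) : inA a b i = v := by
  induction v using Quot.ind with | mk v =>
  rcases v with j | j
  · exact congrArg _ (Option.some_injective _ h).symm
  · by_cases hj : j = b
    · subst hj
      have := (toA_inB_self a j).symm.trans h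
      rw [← Option.some_injective _ this]
      exact inA_eq_inB a j
    · have := (toA_inB_of_ne a b hj).symm.trans h
      simp at this

lemma GlueVertex.inB_of_toB {a : VA} {b : VB} {v : GlueVertex a b} {i : VB}
    (h : toB a b v = some i) : inB a b i = v := by
  induction v using Quot.ind with | mk v =>
  rcases v with j | j
  · by_cases hj : j = a
    · subst hj
      have := (toB_inA_self j b).symm.trans h
      rw [← Option.some_injective _ this]
      exact (inA_eq_inB j b).symm
    · have := (toB_inA_of_ne a b hj).symm.trans h
      simp at this
  · exact congrArg _ (Option.some_injective _ h).symm

/-- The vertex idempotent, extended by zero. -/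
def optVertex {V : Type u} [Quiver.{u} V] : Option V → PathAlgebra k V
  | none => 0
  | some i => vertex i

lemma vertex_mul_self {V : Type u} [Quiver.{u} V] [Fintype V] (i : V) :
    (vertex i * vertex i : PathAlgebra k V) = vertex i := by
  rw [vertex, path_mul_path, Quiver.Path.comp_nil]

lemma vertex_mul_of_ne {V : Type u} [Quiver.{u} V] [Fintype V] {i j : V} (h : i ≠ j) :
    (vertex i * vertex j : PathAlgebra k V) = 0 := by
  rw [vertex, vertex, path_mul_path_of_ne _ _ (Ne.symm h)]

lemma isRep_of_retraction {V W : Type u} [Quiver.{u} V] [Fintype V] [Quiver.{u} W] [Fintype W]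
    (ι : V → W) (ρ : W → Option V) (h1 : ∀ i, ρ (ι i) = some i)
    (h2 : ∀ {v i}, ρ v = some i → ι i = v)
    (F : ∀ ⦃i j : W⦄, (i ⟶ j) → PathAlgebra k V)
    (htgt : ∀ ⦃i j : W⦄ (f : i ⟶ j), optVertex (ρ j) * F f = F f)
    (hsrc : ∀ ⦃i j : W⦄ (f : i ⟶ j), F f * optVertex (ρ i) = F f) :
    IsRep (fun v => optVertex (k := k) (ρ v)) F where
  idem v := by
    cases h : ρ v with
    | none => simp [optVertex]
    | some i => exact vertex_mul_self i
  orth v w hvw := by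
    cases h : ρ v with
    | none => simp [optVertex]
    | some i =>
      cases h' : ρ w with
      | none => simp [optVertex]
      | some j =>
        refine vertex_mul_of_ne ?_
        rintro rfl
        exact hvw ((h2 h).symm.trans (h2 h'))
  sum_eq := by
    rw [one_def]
    refine (Fintype.sum_of_injective ι ?_ _ _ ?_ ?_).symm
    · intro i j hij
      have := congrArg ρ hij
      rw [h1, h1] at this
      exact Option.some_injective _ this
    · intro v hv
      cases h : ρ v with
      | none => rfl
      | some i => exact (hv ⟨i, h2 h⟩).elim
    · intro i
      rw [h1]; rfl
  tgt := htgt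
  src := hsrc

/-- The image of an arrow of the glued quiver in the path algebra of the first quiver. -/
def arrowToA (a : VA) (b : VB) ⦃v w : GlueVertex a b⦄ : (v ⟶ w) → PathAlgebra k VA
  | GlueHom.ofA f => arrow f
  | GlueHom.ofB _ => 0

/-- The image of an arrow of the glued quiver in the path algebra of the second quiver. -/
def arrowToB (a : VA) (b : VB) ⦃v w : GlueVertex a b⦄ : (v ⟶ w) → PathAlgebra k VB
  | GlueHom.ofA _ => 0
  | GlueHom.ofB f => arrow f

/-- The projection of the path algebra of the glued quiver onto that of the first quiver: the
vertices and arrows that do not belong to the first quiver are sent to zero. -/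
def pathToA (a : VA) (b : VB) : PathAlgebra k (GlueVertex a b) →ₐ[k] PathAlgebra k VA :=
  PathAlgebra.lift (fun v => optVertex (GlueVertex.toA a b v)) (arrowToA a b)
    (isRep_of_retraction (GlueVertex.inA a b) _ (GlueVertex.toA_inA a b) GlueVertex.inA_of_toA _
      (by
        rintro _ _ (f | f)
        · rw [GlueVertex.toA_inA, arrowToA, optVertex, vertex, arrow, path_mul_path,
            Quiver.Path.comp_nil]
        · rw [arrowToA, mul_zero])
      (by
        rintro _ _ (f | f)
        · rw [GlueVertex.toA_inA, arrowToA, optVertex, vertex, arrow, path_mul_path,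
            Quiver.Path.nil_comp]
        · rw [arrowToA, zero_mul]))

/-- The projection of the path algebra of the glued quiver onto that of the second quiver: the
vertices and arrows that do not belong to the second quiver are sent to zero. -/
def pathToB (a : VA) (b : VB) : PathAlgebra k (GlueVertex a b) →ₐ[k] PathAlgebra k VB :=
  PathAlgebra.lift (fun v => optVertex (GlueVertex.toB a b v)) (arrowToB a b)
    (isRep_of_retraction (GlueVertex.inB a b) _ (GlueVertex.toB_inB a b) GlueVertex.inB_of_toB _
      (by
        rintro _ _ (f | f)
        · rw [arrowToB, mul_zero]
        · rw [GlueVertex.toB_inB, arrowToB, optVertex, vertex, arrow, path_mul_path,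
            Quiver.Path.comp_nil])
      (by
        rintro _ _ (f | f)
        · rw [arrowToB, zero_mul]
        · rw [GlueVertex.toB_inB, arrowToB, optVertex, vertex, arrow, path_mul_path,
            Quiver.Path.nil_comp]))

lemma pathToA_mapLin (a : VA) (b : VB) (x : PathAlgebra k VA) :
    pathToA a b (mapLin (inclA a b) x) = x := by
  induction x using PathAlgebra.induction_linear with
  | zero => simp
  | add x y hx hy => rw [map_add, map_add, hx, hy]
  | smul c x hx => rw [map_smul, map_smul, hx]
  | path p =>
    rw [mapLin_path, pathToA, lift_path]
    induction p with
    | nil => rfl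
    | cons p f ih =>
      rw [Prefunctor.mapPath_cons, pathVal, ih]
      change arrow f * path p = _
      rw [arrow, path_mul_path]; rfl

lemma pathToB_mapLin (a : VA) (b : VB) (x : PathAlgebra k VB) :
    pathToB a b (mapLin (inclB a b) x) = x := by
  induction x using PathAlgebra.induction_linear with
  | zero => simp
  | add x y hx hy => rw [map_add, map_add, hx, hy]
  | smul c x hx => rw [map_smul, map_smul, hx]
  | path p =>
    rw [mapLin_path, pathToB, lift_path]
    induction p with
    | nil => rfl
    | cons p f ih =>
      rw [Prefunctor.mapPath_cons, pathVal, ih]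
      change arrow f * path p = _
      rw [arrow, path_mul_path]; rfl

lemma pathToA_mapLin_inclB (a : VA) (b : VB) (x : PathAlgebra k VB) :
    pathToA a b (mapLin (inclB a b) x) = aug b x • vertex a := by
  induction x using PathAlgebra.induction_linear with
  | zero => simp
  | add x y hx hy => rw [map_add, map_add, hx, hy, map_add, add_smul]
  | smul c x hx => rw [map_smul, map_smul, hx, map_smul, smul_eq_mul, mul_smul]
  | @path i _ p =>
    rw [mapLin_path, pathToA, lift_path]
    cases p with
    | nil =>
      change optVertex (GlueVertex.toA a b (GlueVertex.inB a b i)) = aug b (vertex i) • _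
      by_cases h : i = b
      · subst h
        rw [aug_vertex_self, GlueVertex.toA_inB_self, one_smul]; rfl
      · rw [aug_vertex_of_ne h, GlueVertex.toA_inB_of_ne _ _ h, zero_smul]; rfl
    | cons p f =>
      rw [Prefunctor.mapPath_cons, pathVal, aug_cons, zero_smul]
      exact zero_mul _

lemma pathToB_mapLin_inclA (a : VA) (b : VB) (x : PathAlgebra k VA) :
    pathToB a b (mapLin (inclA a b) x) = aug a x • vertex b := by
  induction x using PathAlgebra.induction_linear with
  | zero => simp
  | add x y hx hy => rw [map_add, map_add, hx, hy, map_add, add_smul]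
  | smul c x hx => rw [map_smul, map_smul, hx, map_smul, smul_eq_mul, mul_smul]
  | @path i _ p =>
    rw [mapLin_path, pathToB, lift_path]
    cases p with
    | nil =>
      change optVertex (GlueVertex.toB a b (GlueVertex.inA a b i)) = aug a (vertex i) • _
      by_cases h : i = a
      · subst h
        rw [aug_vertex_self, GlueVertex.toB_inA_self, one_smul]; rfl
      · rw [aug_vertex_of_ne h, GlueVertex.toB_inA_of_ne _ _ h, zero_smul]; rfl
    | cons p f =>
      rw [Prefunctor.mapPath_cons, pathVal, aug_cons, zero_smul]
      exact zero_mul _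

lemma mapLin_inclA_one (a : VA) (b : VB) :
    mapLin (inclA a b) (1 : PathAlgebra k VA) = idemA k a b := by
  rw [one_def, map_sum]
  exact Finset.sum_congr rfl fun i _ => mapLin_path _ _

lemma mapLin_inclB_one (a : VA) (b : VB) :
    mapLin (inclB a b) (1 : PathAlgebra k VB) = idemB k a b := by
  rw [one_def, map_sum]
  exact Finset.sum_congr rfl fun i _ => mapLin_path _ _

lemma aug_mapLin_inclA (a : VA) (b : VB) (x : PathAlgebra k VA) :
    aug (GlueVertex.inA a b a) (mapLin (inclA a b) x) = aug a x := by
  induction x using PathAlgebra.induction_linear with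
  | zero => simp
  | add x y hx hy => rw [map_add, map_add, hx, hy, map_add]
  | smul c x hx => rw [map_smul, map_smul, hx, map_smul]
  | @path i _ p =>
    rw [mapLin_path]
    cases p with
    | nil =>
      change aug _ (vertex (GlueVertex.inA a b i)) = aug a (vertex i)
      by_cases h : i = a
      · subst h; rw [aug_vertex_self, aug_vertex_self]
      · rw [aug_vertex_of_ne h, aug_vertex_of_ne]
        intro h'
        have := congrArg (GlueVertex.toA a b) h'
        exact h (Option.some_injective _ this)
    | cons p f => rw [Prefunctor.mapPath_cons, aug_cons, aug_cons]

lemma aug_mapLin_inclB (a : VA) (b : VB) (x : PathAlgebra k VB) :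
    aug (GlueVertex.inA a b a) (mapLin (inclB a b) x) = aug b x := by
  rw [GlueVertex.inA_eq_inB]
  induction x using PathAlgebra.induction_linear with
  | zero => simp
  | add x y hx hy => rw [map_add, map_add, hx, hy, map_add]
  | smul c x hx => rw [map_smul, map_smul, hx, map_smul]
  | @path i _ p =>
    rw [mapLin_path]
    cases p with
    | nil =>
      change aug _ (vertex (GlueVertex.inB a b i)) = aug b (vertex i)
      by_cases h : i = b
      · subst h; rw [aug_vertex_self, aug_vertex_self]
      · rw [aug_vertex_of_ne h, aug_vertex_of_ne]
        intro h'
        have := congrArg (GlueVertex.toB a b) h'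
        exact h (Option.some_injective _ this)
    | cons p f => rw [Prefunctor.mapPath_cons, aug_cons, aug_cons]

variable (a : VA) (b : VB) (RA : TwoSidedIdeal (PathAlgebra k VA))
  (RB : TwoSidedIdeal (PathAlgebra k VB))

lemma eq_zero_of_mem_glueRelations {R : Type u} [Ring R]
    (φ : PathAlgebra k (GlueVertex a b) →+* R)
    (hA : ∀ x ∈ RA, φ (mapLin (inclA a b) x) = 0) (hB : ∀ x ∈ RB, φ (mapLin (inclB a b) x) = 0)
    (h1 : φ (idemA k a b) = 1 ∨ φ (idemB k a b) = 1)
    (x : PathAlgebra k (GlueVertex a b)) (hx : x ∈ (glueRelations a b RA RB).asIdeal) :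
    φ x = 0 := by
  have : glueRelations a b RA RB ≤ TwoSidedIdeal.ker φ := by
    refine TwoSidedIdeal.span_le.2 ?_
    rintro _ ((⟨x, hx, rfl⟩ | ⟨x, hx, rfl⟩) | ⟨x, rfl⟩)
    · exact (TwoSidedIdeal.mem_ker φ).2 (hA x hx)
    · exact (TwoSidedIdeal.mem_ker φ).2 (hB x hx)
    · refine (TwoSidedIdeal.mem_ker φ).2 ?_
      rcases h1 with h | h <;> simp [h]
  exact (TwoSidedIdeal.mem_ker φ).1 (this (TwoSidedIdeal.mem_asIdeal.1 hx))

/-- The projection of the gluing onto the first algebra. -/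
def projA (hb : IsSource b) (hRB : vertex b ∉ RB) : Gluing a b RA RB →+* BoundAlgebra RA :=
  Ideal.Quotient.lift _ ((Ideal.Quotient.mk RA.asIdeal).comp (pathToA (k := k) a b).toRingHom)
    (eq_zero_of_mem_glueRelations a b RA RB _
      (fun x hx => by
        simpa [pathToA_mapLin, Ideal.Quotient.eq_zero_iff_mem] using hx)
      (fun x hx => by
        simp [pathToA_mapLin_inclB, aug_eq_zero_of_isSource hb hRB hx])
      (Or.inl (by simp [← mapLin_inclA_one, pathToA_mapLin])))

/-- The projection of the gluing onto the second algebra. -/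
def projB (ha : IsSink a) (hRA : vertex a ∉ RA) : Gluing a b RA RB →+* BoundAlgebra RB :=
  Ideal.Quotient.lift _ ((Ideal.Quotient.mk RB.asIdeal).comp (pathToB (k := k) a b).toRingHom)
    (eq_zero_of_mem_glueRelations a b RA RB _
      (fun x hx => by
        simp [pathToB_mapLin_inclA, aug_eq_zero_of_isSink ha hRA hx])
      (fun x hx => by
        simpa [pathToB_mapLin, Ideal.Quotient.eq_zero_iff_mem] using hx)
      (Or.inr (by simp [← mapLin_inclB_one, pathToB_mapLin])))

/-- The one-dimensional representation of the gluing at the common vertex. -/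
def projBridge (ha : IsSink a) (hRA : vertex a ∉ RA) (hb : IsSource b) (hRB : vertex b ∉ RB) :
    Gluing a b RA RB →+* k :=
  Ideal.Quotient.lift _ (aug (k := k) (GlueVertex.inA a b a)).toRingHom
    (eq_zero_of_mem_glueRelations a b RA RB _
      (fun x hx => by simp [aug_mapLin_inclA, aug_eq_zero_of_isSink ha hRA hx])
      (fun x hx => by simp [aug_mapLin_inclB, aug_eq_zero_of_isSource hb hRB hx])
      (Or.inl (by simp [← mapLin_inclA_one, aug_mapLin_inclA])))

end Gluing

/-! ### Subcategories of module categories, and cluster tilting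

Right modules over `R` are modules over `Rᵐᵒᵖ`.  A (full) subcategory of the category `mod R` of
finitely generated right modules is given by its class of objects, a property of right modules
that implies finite generation. -/

section ClusterTilting

/-- The category of right modules. -/
abbrev RightMod (R : Type u) [Ring R] := ModuleCat.{u} Rᵐᵒᵖ

/-- The restriction of right modules along a ring homomorphism. -/
abbrev restrictRight {R S : Type u} [Ring R] [Ring S] (f : R →+* S) : RightMod S ⥤ RightMod R :=
  ModuleCat.restrictScalars.{u} (RingHom.op f)

variable {R : Type u} [Ring R]

/-- `add P`: the direct summands of finite direct sums of objects of `P`. -/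
def addClosure (P : ObjectProperty (RightMod R)) : ObjectProperty (RightMod R) := fun X =>
  ∃ (n : ℕ) (Y : Fin n → RightMod R), (∀ i, P (Y i)) ∧ Nonempty (Retract X (⨁ Y))

/-- `P` is of the form `add G` for an object `G`. -/
def HasAdditiveGenerator (P : ObjectProperty (RightMod R)) : Prop :=
  ∃ G : RightMod R, P = addClosure (ObjectProperty.singleton G)

/-- Every object of `mod R` has a right `P`-approximation. -/
def ContravariantlyFinite (P : ObjectProperty (RightMod R)) : Prop :=
  ∀ C : RightMod R, Module.Finite Rᵐᵒᵖ C → ∃ (M : RightMod R) (f : M ⟶ C), P M ∧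
    ∀ (M' : RightMod R) (g : M' ⟶ C), P M' → ∃ h : M' ⟶ M, h ≫ f = g

/-- Every object of `mod R` has a left `P`-approximation. -/
def CovariantlyFinite (P : ObjectProperty (RightMod R)) : Prop :=
  ∀ C : RightMod R, Module.Finite Rᵐᵒᵖ C → ∃ (M : RightMod R) (f : C ⟶ M), P M ∧
    ∀ (M' : RightMod R) (g : C ⟶ M'), P M' → ∃ h : M ⟶ M', f ≫ h = g

/-- Every object of `mod R` is a quotient of an object of `P`. -/
def Generating (P : ObjectProperty (RightMod R)) : Prop :=
  ∀ C : RightMod R, Module.Finite Rᵐᵒᵖ C → ∃ (M : RightMod R) (f : M ⟶ C), P M ∧ Epi f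

/-- Every object of `mod R` is a subobject of an object of `P`. -/
def Cogenerating (P : ObjectProperty (RightMod R)) : Prop :=
  ∀ C : RightMod R, Module.Finite Rᵐᵒᵖ C → ∃ (M : RightMod R) (f : C ⟶ M), P M ∧ Mono f

/-- `d`-cluster tilting subcategories of `mod R`. -/
structure IsClusterTilting (d : ℕ) (P : ObjectProperty (RightMod R)) : Prop where
  contravariantlyFinite : ContravariantlyFinite P
  covariantlyFinite : CovariantlyFinite P
  generating : Generating P
  cogenerating : Cogenerating P
  eq_leftPerp : ∀ C : RightMod R, P C ↔ Module.Finite Rᵐᵒᵖ C ∧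
    ∀ M : RightMod R, P M → ∀ i : ℕ, 0 < i → i < d → Subsingleton (Abelian.Ext.{u} C M i)
  eq_rightPerp : ∀ C : RightMod R, P C ↔ Module.Finite Rᵐᵒᵖ C ∧
    ∀ M : RightMod R, P M → ∀ i : ℕ, 0 < i → i < d → Subsingleton (Abelian.Ext.{u} M C i)

/-- `dℤ`-cluster tilting subcategories of `mod R`. -/
structure IsZClusterTilting (d : ℕ) (P : ObjectProperty (RightMod R)) : Prop
    extends IsClusterTilting d P where
  dvd_of_nontrivial : ∀ M N : RightMod R, P M → P N → ∀ i : ℕ,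
    Nontrivial (Abelian.Ext.{u} M N i) → d ∣ i

/-- The set of `d`-cluster tilting subcategories of `mod R` with an additive generator. -/
def CT (d : ℕ) (R : Type u) [Ring R] : Set (ObjectProperty (RightMod R)) :=
  {P | IsClusterTilting d P ∧ HasAdditiveGenerator P}

/-- The set of `dℤ`-cluster tilting subcategories of `mod R` with an additive generator. -/
def ZCT (d : ℕ) (R : Type u) [Ring R] : Set (ObjectProperty (RightMod R)) :=
  {P | IsZClusterTilting d P ∧ HasAdditiveGenerator P}

end ClusterTilting

section GluingModules

open PathAlgebra

variable {k VA VB : Type u} [Field k] [Quiver.{u} VA] [Quiver.{u} VB] [Fintype VA] [Fintype VB]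
  {a : VA} {b : VB} {RA : TwoSidedIdeal (PathAlgebra k VA)} {RB : TwoSidedIdeal (PathAlgebra k VB)}

/-- The simple bridge: the one-dimensional module over the gluing at the common vertex. -/
def bridge (ha : IsSink a) (hRA : vertex a ∉ RA) (hb : IsSource b) (hRB : vertex b ∉ RB) :
    RightMod (Gluing a b RA RB) :=
  (restrictRight (projBridge a b RA RB ha hRA hb hRB)).obj (ModuleCat.of kᵐᵒᵖ k)

/-- The gluing of two subcategories: `add` of the union of their images in the module category of
the gluing. -/
def glueSub (ha : IsSink a) (hRA : vertex a ∉ RA) (hb : IsSource b) (hRB : vertex b ∉ RB)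
    (P : ObjectProperty (RightMod (BoundAlgebra RA)) ×
      ObjectProperty (RightMod (BoundAlgebra RB))) :
    ObjectProperty (RightMod (Gluing a b RA RB)) :=
  addClosure (P.1.map (restrictRight (projA a b RA RB hb hRB)) ⊔
    P.2.map (restrictRight (projB a b RA RB ha hRA)))

/-- The intersections of a subcategory with the two module categories, which are regarded as
subcategories of the module category of the gluing by restriction of scalars. -/
def interSub (ha : IsSink a) (hRA : vertex a ∉ RA) (hb : IsSource b) (hRB : vertex b ∉ RB)
    (M : ObjectProperty (RightMod (Gluing a b RA RB))) :
    ObjectProperty (RightMod (BoundAlgebra RA)) × ObjectProperty (RightMod (BoundAlgebra RB)) :=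
  (M.inverseImage (restrictRight (projA a b RA RB hb hRB)),
    M.inverseImage (restrictRight (projB a b RA RB ha hRA)))

end GluingModules

end SinkSource

end

/-! Right modules over the gluing are treated as left modules over its opposite ring `L`, in which 1
= fA + fB + e with fA, fB, e the opposites of 1 - e_B, 1 - e_A, e_a. All products between these
idempotents vanish except along fB M → e M → fA M, the composite is zero, and e L e consists of
scalars multiples of e. The A-modules are those killed by fB, the B-modules those killed by fA, and
a module killed by both is a sum of copies of the bridge S.

Four facts follow. Every module is the direct sum of an A-module and a B-module
(`IsGluingRing.exists_isCompl`). Ext over A and over B agrees with Ext over the gluing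
(`nontrivial_ext_A_iff`, `nontrivial_ext_B_iff`). There are no positive-degree extensions Ext(X, Y)
with X an A-module and Y a B-module (`subsingleton_ext_AB`): S behaves like an injective A-module
and a projective B-module. In the other direction, a nonzero Ext^i(Y, X) forces i = p + q with
Ext^p(Y, S) and Ext^q(S, X) nonzero (`exists_nontrivial_ext`). Moreover every map between an
A-module and a B-module factors through add S (`exists_factor_of_killed`).

The rest is formal, from the axioms `IsBridgeGluing`. S lies in every cluster tilting subcategory of
mod A and of mod B. The sets {0} ∪ [d, ∞) and dℤ are closed under addition, so degrees p + q of
mixed extensions stay admissible, and one argument serves both the d- and the dℤ-version.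
Orthogonality can be tested on the A- and B-summands separately. Conversely, if S ∈ M, then mixed
extensions are controlled by S, and B-summands of approximations of A-modules can be replaced by
objects of add S, so M ∩ mod A is again cluster tilting; likewise for B. -/

noncomputable section

namespace SinkSource

open Abelian

/-! ### Additive closures. -/

section AddClosure

variable {R : Type u} [Ring R] {P Q : ObjectProperty (RightMod R)}

/-- Membership in `add P` amounts to writing the identity as a finite sum of endomorphisms through
objects of `P`. Allowing any finite index type lets sums be nested or concatenated without
reindexing, and makes transport along additive functors immediate. -/
lemma addClosure_of_sum_eq_id {ι : Type*} [Fintype ι] {X : RightMod R} (Y : ι → RightMod R)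
    (hY : ∀ i, P (Y i)) (f : ∀ i, X ⟶ Y i) (g : ∀ i, Y i ⟶ X) (h : ∑ i, f i ≫ g i = 𝟙 X) :
    addClosure P X := by
  classical
  let e := (Fintype.equivFin ι).symm
  refine ⟨Fintype.card ι, fun i => Y (e i), fun i => hY _,
    ⟨⟨biproduct.lift fun i => f (e i), biproduct.desc fun i => g (e i), ?_⟩⟩⟩
  rw [biproduct.lift_desc, ← h]
  exact e.sum_comp fun i => f i ≫ g i

lemma addClosure_iff {X : RightMod R} :
    addClosure P X ↔ ∃ (n : ℕ) (Y : Fin n → RightMod R) (f : ∀ i, X ⟶ Y i) (g : ∀ i, Y i ⟶ X),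
      (∀ i, P (Y i)) ∧ ∑ i, f i ≫ g i = 𝟙 X := by
  classical
  constructor
  · rintro ⟨n, Y, hY, ⟨r⟩⟩
    refine ⟨n, Y, fun i => r.i ≫ biproduct.π Y i, fun i => biproduct.ι Y i ≫ r.r, hY, ?_⟩
    calc ∑ i, (r.i ≫ biproduct.π Y i) ≫ biproduct.ι Y i ≫ r.r
        = r.i ≫ (∑ i, biproduct.π Y i ≫ biproduct.ι Y i) ≫ r.r := by
          simp only [Preadditive.sum_comp, Preadditive.comp_sum, Category.assoc]
      _ = 𝟙 X := by rw [biproduct.total, Category.id_comp, r.retract]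
  · rintro ⟨n, Y, f, g, hY, h⟩
    exact addClosure_of_sum_eq_id Y hY f g h

lemma le_addClosure : P ≤ addClosure P := fun X hX =>
  addClosure_of_sum_eq_id (ι := Unit) (fun _ => X) (fun _ => hX) (fun _ => 𝟙 X) (fun _ => 𝟙 X)
    (by simp)

lemma addClosure_le_of_le_addClosure (h : P ≤ addClosure Q) : addClosure P ≤ addClosure Q := by
  intro X hX
  obtain ⟨n, Y, f, g, hY, hfg⟩ := addClosure_iff.1 hX
  choose m Z a b hZ hab using fun i => addClosure_iff.1 (h _ (hY i))
  refine addClosure_of_sum_eq_id (ι := Σ i, Fin (m i)) (fun s => Z s.1 s.2) (fun s => hZ _ _)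
    (fun s => f s.1 ≫ a s.1 s.2) (fun s => b s.1 s.2 ≫ g s.1) ?_
  rw [Fintype.sum_sigma, ← hfg]
  refine Finset.sum_congr rfl fun i _ => ?_
  have := congrArg (fun t => f i ≫ t ≫ g i) (hab i)
  simpa [Preadditive.sum_comp, Preadditive.comp_sum] using this

lemma addClosure_mono (h : P ≤ Q) : addClosure P ≤ addClosure Q :=
  addClosure_le_of_le_addClosure (h.trans le_addClosure)

lemma addClosure_of_retract {X Y : RightMod R} (r : Retract X Y) (hY : addClosure P Y) :
    addClosure P X :=
  addClosure_le_of_le_addClosure le_rfl X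
    (addClosure_of_sum_eq_id (ι := Unit) (fun _ => Y) (fun _ => hY) (fun _ => r.i) (fun _ => r.r)
      (by simp))

lemma addClosure_of_iso {X Y : RightMod R} (e : X ≅ Y) (hY : addClosure P Y) : addClosure P X :=
  addClosure_of_retract (Retract.ofIso e) hY

lemma addClosure_of_add_eq_id {X Y Z : RightMod R} (hY : addClosure P Y) (hZ : addClosure P Z)
    (f : X ⟶ Y) (g : Y ⟶ X) (f' : X ⟶ Z) (g' : Z ⟶ X) (h : f ≫ g + f' ≫ g' = 𝟙 X) :
    addClosure P X := by
  refine addClosure_le_of_le_addClosure le_rfl X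
    (addClosure_of_sum_eq_id (ι := Bool) (fun i => bif i then Y else Z) ?_
      (Bool.rec f' f) (Bool.rec g' g) (by simpa using h))
  rintro (_ | _)
  · exact hZ
  · exact hY

lemma addClosure_biprod {Y Z : RightMod R} (hY : addClosure P Y) (hZ : addClosure P Z) :
    addClosure P (Y ⊞ Z) :=
  addClosure_of_add_eq_id hY hZ biprod.fst biprod.inl biprod.snd biprod.inr biprod.total

lemma addClosure_map {R' : Type u} [Ring R'] (F : RightMod R ⥤ RightMod R') [F.Additive]
    {X : RightMod R} (hX : addClosure P X) : addClosure (P.map F) (F.obj X) := by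
  obtain ⟨n, Y, f, g, hY, hfg⟩ := addClosure_iff.1 hX
  refine addClosure_of_sum_eq_id (fun i => F.obj (Y i)) (fun i => P.prop_map_obj F (hY i))
    (fun i => F.map (f i)) (fun i => F.map (g i)) ?_
  have := congrArg (F.map (X := X) (Y := X)) hfg
  simpa [Functor.map_sum] using this

lemma finite_of_addClosure (hP : ∀ X, P X → Module.Finite Rᵐᵒᵖ X) {X : RightMod R}
    (hX : addClosure P X) : Module.Finite Rᵐᵒᵖ X := by
  obtain ⟨n, Y, f, g, hY, hfg⟩ := addClosure_iff.1 hX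
  have := fun i => hP _ (hY i)
  refine Module.Finite.of_surjective
    (∑ i, (g i).hom ∘ₗ LinearMap.proj i : (∀ i, Y i) →ₗ[Rᵐᵒᵖ] X) fun x => ?_
  refine ⟨fun i => (f i).hom x, ?_⟩
  have := congrArg (fun t => t.hom x) hfg
  simpa [ModuleCat.hom_sum, LinearMap.sum_apply] using this

end AddClosure

/-! ### Nonvanishing of Ext under summands and exact functors. -/

section Ext

variable {C : Type*} [Category C] [Abelian C] [HasExt.{u} C]

/-- A class x on X is the sum of its pullbacks along `f i ≫ g i`, each of which passes through Ext
of `Y i`. If all of these groups vanished, x would be zero. -/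
lemma exists_nontrivial_ext_of_sum_eq_id_left {ι : Type*} [Fintype ι] {X Z : C} {Y : ι → C}
    (f : ∀ i, X ⟶ Y i) (g : ∀ i, Y i ⟶ X) (h : ∑ i, f i ≫ g i = 𝟙 X) {n : ℕ}
    (hn : Nontrivial (Ext.{u} X Z n)) : ∃ i, Nontrivial (Ext.{u} (Y i) Z n) := by
  by_contra! hc
  obtain ⟨x, hx⟩ := exists_ne (0 : Ext.{u} X Z n)
  apply hx
  rw [← Ext.mk₀_id_comp x, ← h, Ext.mk₀_sum, Ext.sum_comp]
  refine Finset.sum_eq_zero fun i _ => ?_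
  rw [← Ext.mk₀_comp_mk₀, Ext.comp_assoc_of_second_deg_zero,
    Subsingleton.elim ((Ext.mk₀ (g i)).comp x (zero_add n)) 0, Ext.comp_zero]

lemma exists_nontrivial_ext_of_sum_eq_id_right {ι : Type*} [Fintype ι] {X Z : C} {Y : ι → C}
    (f : ∀ i, X ⟶ Y i) (g : ∀ i, Y i ⟶ X) (h : ∑ i, f i ≫ g i = 𝟙 X) {n : ℕ}
    (hn : Nontrivial (Ext.{u} Z X n)) : ∃ i, Nontrivial (Ext.{u} Z (Y i) n) := by
  by_contra! hc
  obtain ⟨x, hx⟩ := exists_ne (0 : Ext.{u} Z X n)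
  apply hx
  rw [← Ext.comp_mk₀_id x, ← h, Ext.mk₀_sum, Ext.comp_sum]
  refine Finset.sum_eq_zero fun i _ => ?_
  rw [← Ext.mk₀_comp_mk₀, ← Ext.comp_assoc_of_third_deg_zero,
    Subsingleton.elim (x.comp (Ext.mk₀ (f i)) (add_zero n)) 0, Ext.zero_comp]

lemma nontrivial_ext_of_retract_left {X Y Z : C} (r : Retract X Y) {n : ℕ}
    (hn : Nontrivial (Ext.{u} X Z n)) : Nontrivial (Ext.{u} Y Z n) :=
  (exists_nontrivial_ext_of_sum_eq_id_left (ι := Unit) (Y := fun _ => Y) (fun _ => r.i)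
    (fun _ => r.r) (by simp) hn).choose_spec

lemma nontrivial_ext_of_retract_right {X Y Z : C} (r : Retract X Y) {n : ℕ}
    (hn : Nontrivial (Ext.{u} Z X n)) : Nontrivial (Ext.{u} Z Y n) :=
  (exists_nontrivial_ext_of_sum_eq_id_right (ι := Unit) (Y := fun _ => Y) (fun _ => r.i)
    (fun _ => r.r) (by simp) hn).choose_spec

lemma nontrivial_ext_biprod_left {X Y Z : C} {n : ℕ} (hn : Nontrivial (Ext.{u} (X ⊞ Y) Z n)) :
    Nontrivial (Ext.{u} X Z n) ∨ Nontrivial (Ext.{u} Y Z n) := by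
  by_contra! hc
  obtain ⟨h1, h2⟩ := hc
  exact not_subsingleton _ (Ext.biprodAddEquiv (X₁ := X) (X₂ := Y) (Y := Z) (n := n)).subsingleton

lemma nontrivial_ext_biprod_right {X Y Z : C} {n : ℕ} (hn : Nontrivial (Ext.{u} Z (X ⊞ Y) n)) :
    Nontrivial (Ext.{u} Z X n) ∨ Nontrivial (Ext.{u} Z Y n) := by
  by_contra! hc
  obtain ⟨h1, h2⟩ := hc
  exact not_subsingleton _ (Ext.addEquivBiprod (Y₁ := X) (Y₂ := Y) (X := Z) (n := n)).subsingleton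

variable {D : Type*} [Category D] [Abelian D] [HasExt.{u} D]
  (F : C ⥤ D) [F.Additive] [PreservesFiniteLimits F] [PreservesFiniteColimits F]

attribute [local simp] Ext.mapExactFunctor_comp Ext.mapExactFunctor_mk₀ Ext.mapExactFunctor_extClass

/-- An exact fully faithful functor induces bijections on `Ext` if every object has a projective
cover whose image is acyclic for the objects in the image of the functor. -/
lemma mapExt_bijective_of_acyclic [F.Full] [F.Faithful]
    (hF : ∀ X : C, ∃ (P : C) (p : P ⟶ X), Projective P ∧ Epi p ∧
      ∀ (Y : C) (n : ℕ), Subsingleton (Ext.{u} (F.obj P) (F.obj Y) (n + 1)))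
    (X Y : C) (n : ℕ) : Function.Bijective (F.mapExtAddHom X Y n : Ext.{u} X Y n →+ _) := by
  induction n generalizing X with
  | zero => simpa [Ext.mapExactFunctor₀] using
      ⟨Functor.Faithful.map_injective, Functor.Full.map_surjective⟩
  | succ n hn =>
    obtain ⟨P, p, hP, hp, hac⟩ := hF X
    let S := ShortComplex.mk _ _ (kernel.condition p)
    have hS : S.ShortExact := { exact := ShortComplex.exact_kernel p }
    have h1 : Subsingleton (Ext.{u} S.X₂ Y (n + 1)) := Ext.subsingleton_of_projective P Y n
    have h2 : Subsingleton (Ext.{u} (S.map F).X₂ (F.obj Y) (n + 1)) := hac Y n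
    -- Dimension shifting along ker p → P → X: on both sides Ext^(n+1) of the middle term vanishes,
    -- so Ext^(n+1) of X is the cokernel of Ext^n(P) → Ext^n(ker p), and the induction hypothesis
    -- applies to these two terms.
    exact AddMonoidHom.bijective_of_surjective_of_bijective_of_right_exact _ _ _ _
      (F.mapExtAddHom S.X₂ Y n) (F.mapExtAddHom S.X₁ Y n) (F.mapExtAddHom S.X₃ Y (n + 1))
      (by cat_disch) (by cat_disch)
      ((ShortComplex.ab_exact_iff_function_exact _).1
        (Ext.contravariant_sequence_exact₁' hS Y n (n + 1) (add_comm 1 n)))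
      ((ShortComplex.ab_exact_iff_function_exact _).1
        (Ext.contravariant_sequence_exact₁' (hS.map F) (F.obj Y) n (n + 1) (add_comm 1 n)))
      (hn _).surjective (hn _)
      (fun x₃ ↦ Ext.contravariant_sequence_exact₃ hS _ x₃ (Subsingleton.elim _ _) (add_comm 1 n))
      (fun y₃ ↦ Ext.contravariant_sequence_exact₃ (hS.map F) _ y₃ (Subsingleton.elim _ _)
        (add_comm 1 n))

end Ext

/-! ### Functorial finiteness of add G over a finite dimensional algebra. -/

section Approximation

variable {R : Type u} [Ring R]

/-- The additive closure of every finitely generated module is functorially finite. -/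
def AddFunctoriallyFinite (R : Type u) [Ring R] : Prop :=
  ∀ G : RightMod R, Module.Finite Rᵐᵒᵖ G →
    ContravariantlyFinite (addClosure (ObjectProperty.singleton G)) ∧
      CovariantlyFinite (addClosure (ObjectProperty.singleton G))

open ModuleCat in
lemma finite_hom {k L : Type u} [Field k] [Ring L] [Algebra k L] [Module.Finite k L]
    (G C : ModuleCat.{u} L) [Module.Finite L G] [Module.Finite L C] :
    Module.Finite k (G ⟶ C) := by
  have : Module.Finite k G := Module.Finite.trans L G
  have : Module.Finite k C := Module.Finite.trans L C
  have : Module.Finite k (G →ₗ[L] C) :=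
    Module.Finite.of_injective (LinearMap.restrictScalarsₗ k L G C k)
      (LinearMap.restrictScalars_injective k)
  exact Module.Finite.equiv (ModuleCat.homLinearEquiv (S := k)).symm

/-- Hom(G, C) is finite dimensional, and a finite spanning family assembles to a map G^n → C through
which every map G → C factors, with scalar coefficients. Maps from summands of powers of G are
reduced to this one component at a time. Left approximations are dual. -/
lemma addFunctoriallyFinite_of_finite {k : Type u} [Field k] [Algebra k R] [Module.Finite k R] :
    AddFunctoriallyFinite R := by
  have : Module.Finite k Rᵐᵒᵖ := Module.Finite.equiv (MulOpposite.opLinearEquiv k)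
  intro G hG
  constructor
  · intro C hC
    have := finite_hom (k := k) G C
    obtain ⟨n, f, hf⟩ := Module.Finite.exists_fin (R := k) (M := G ⟶ C)
    refine ⟨⨁ fun _ : Fin n => G, biproduct.desc f,
      ⟨n, _, fun _ => (ObjectProperty.singleton_iff _ _).2 rfl, ⟨Retract.refl _⟩⟩, ?_⟩
    intro M g hM
    obtain ⟨m, Y, a, b, hY, hab⟩ := addClosure_iff.1 hM
    have key : ∀ i, ∃ h : Y i ⟶ ⨁ fun _ : Fin n => G, h ≫ biproduct.desc f = b i ≫ g := by
      intro i
      obtain rfl : G = Y i := (ObjectProperty.singleton_iff _ _).1 (hY i)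
      have hg : b i ≫ g ∈ Submodule.span k (Set.range f) := hf ▸ Submodule.mem_top
      obtain ⟨c, hc⟩ := (Submodule.mem_span_range_iff_exists_fun k).1 hg
      refine ⟨∑ j, c j • biproduct.ι (fun _ : Fin n => Y i) j, ?_⟩
      simp [Preadditive.sum_comp, hc]
    choose h hh using key
    refine ⟨∑ i, a i ≫ h i, ?_⟩
    rw [Preadditive.sum_comp]
    simp only [Category.assoc, hh]
    simpa [Preadditive.sum_comp] using congrArg (· ≫ g) hab
  · intro C hC
    have := finite_hom (k := k) C G
    obtain ⟨n, f, hf⟩ := Module.Finite.exists_fin (R := k) (M := C ⟶ G)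
    refine ⟨⨁ fun _ : Fin n => G, biproduct.lift f,
      ⟨n, _, fun _ => (ObjectProperty.singleton_iff _ _).2 rfl, ⟨Retract.refl _⟩⟩, ?_⟩
    intro M g hM
    obtain ⟨m, Y, a, b, hY, hab⟩ := addClosure_iff.1 hM
    have key : ∀ i, ∃ h : (⨁ fun _ : Fin n => G) ⟶ Y i, biproduct.lift f ≫ h = g ≫ a i := by
      intro i
      obtain rfl : G = Y i := (ObjectProperty.singleton_iff _ _).1 (hY i)
      have hg : g ≫ a i ∈ Submodule.span k (Set.range f) := hf ▸ Submodule.mem_top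
      obtain ⟨c, hc⟩ := (Submodule.mem_span_range_iff_exists_fun k).1 hg
      refine ⟨∑ j, c j • biproduct.π (fun _ : Fin n => Y i) j, ?_⟩
      simp [Preadditive.comp_sum, hc]
    choose h hh using key
    refine ⟨∑ i, h i ≫ b i, ?_⟩
    rw [Preadditive.comp_sum]
    simp only [← Category.assoc, hh]
    simpa [Preadditive.comp_sum] using congrArg (g ≫ ·) hab

end Approximation

/-! ### Degrees of extensions inside a cluster tilting subcategory. -/

section Orthogonal

variable {R : Type u} [Ring R] {P : ObjectProperty (RightMod R)} {D : Set ℕ} {d : ℕ}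

/-- The degrees of the nonzero extensions between objects of `P` belong to `D`. -/
def ExtDegreesIn (D : Set ℕ) (P : ObjectProperty (RightMod R)) : Prop :=
  ∀ M N : RightMod R, P M → P N → ∀ i : ℕ, Nontrivial (Ext.{u} M N i) → i ∈ D

lemma ExtDegreesIn.addClosure (h : ExtDegreesIn D P) : ExtDegreesIn D (addClosure P) := by
  intro M N hM hN i hi
  obtain ⟨m, Y, f, g, hY, hfg⟩ := addClosure_iff.1 hM
  obtain ⟨n, Z, f', g', hZ, hfg'⟩ := addClosure_iff.1 hN
  obtain ⟨j, hj⟩ := exists_nontrivial_ext_of_sum_eq_id_left f g hfg hi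
  obtain ⟨l, hl⟩ := exists_nontrivial_ext_of_sum_eq_id_right f' g' hfg' hj
  exact h _ _ (hY j) (hZ l) i hl

/-- Rigidity is phrased as a condition on a set of degrees closed under addition. The dℤ-condition
has the same shape with the multiples of d, so later lemmas take an arbitrary set `D`. -/
lemma IsClusterTilting.extDegreesIn (h : IsClusterTilting d P) :
    ExtDegreesIn {i | i = 0 ∨ d ≤ i} P := by
  intro M N hM hN i hi
  by_contra hc
  simp only [Set.mem_ofPred_eq, not_or, not_le] at hc
  exact not_subsingleton_iff_nontrivial.2 hi
    (((h.eq_leftPerp M).1 hM).2 N hN i (Nat.pos_of_ne_zero hc.1) hc.2)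

lemma IsClusterTilting.finite (h : IsClusterTilting d P) {M : RightMod R} (hM : P M) :
    Module.Finite Rᵐᵒᵖ M :=
  ((h.eq_leftPerp M).1 hM).1

/-- Both conditions defining the left orthogonal, finite generation and vanishing of Ext, pass to
sums and summands. -/
lemma IsClusterTilting.addClosure_le (h : IsClusterTilting d P) : addClosure P ≤ P := by
  intro M hM
  refine (h.eq_leftPerp M).2 ⟨finite_of_addClosure (fun X hX => h.finite hX) hM, ?_⟩
  intro N hN i hi hid
  by_contra hc
  rw [not_subsingleton_iff_nontrivial] at hc
  have := h.extDegreesIn.addClosure M N hM (le_addClosure N hN) i hc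
  simp only [Set.mem_ofPred_eq] at this
  omega

lemma IsClusterTilting.of_iso (h : IsClusterTilting d P) {M N : RightMod R} (e : M ≅ N)
    (hN : P N) : P M :=
  h.addClosure_le _ (addClosure_of_iso e (le_addClosure _ hN))

lemma HasAdditiveGenerator.contravariantlyFinite_and_covariantlyFinite
    (h : HasAdditiveGenerator P) (hP : ∀ M, P M → Module.Finite Rᵐᵒᵖ M)
    (hR : AddFunctoriallyFinite R) : ContravariantlyFinite P ∧ CovariantlyFinite P := by
  obtain ⟨G, rfl⟩ := h
  exact hR G (hP G (le_addClosure G ((ObjectProperty.singleton_iff _ _).2 rfl)))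

end Orthogonal

/-! ### Axioms of a gluing along a bridge, and gluing of cluster tilting subcategories. -/

/-- The homological properties of the two module categories inside the module category of a
sink-source gluing with bridge `S`. -/
structure IsBridgeGluing {R A B : Type u} [Ring R] [Ring A] [Ring B]
    (FA : RightMod A ⥤ RightMod R) (FB : RightMod B ⥤ RightMod R) (S : RightMod R) : Prop where
  finite_A : ∀ X, Module.Finite Rᵐᵒᵖ (FA.obj X) ↔ Module.Finite Aᵐᵒᵖ X
  finite_B : ∀ Y, Module.Finite Rᵐᵒᵖ (FB.obj Y) ↔ Module.Finite Bᵐᵒᵖ Y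
  ext_A : ∀ X X' i, Nontrivial (Ext.{u} (FA.obj X) (FA.obj X') i) ↔ Nontrivial (Ext.{u} X X' i)
  ext_B : ∀ Y Y' i, Nontrivial (Ext.{u} (FB.obj Y) (FB.obj Y') i) ↔ Nontrivial (Ext.{u} Y Y' i)
  ext_AB : ∀ X Y i, 0 < i → Subsingleton (Ext.{u} (FA.obj X) (FB.obj Y) i)
  ext_BA : ∀ X Y i, Module.Finite Rᵐᵒᵖ (FB.obj Y) →
    Nontrivial (Ext.{u} (FB.obj Y) (FA.obj X) i) →
    ∃ p q, p + q = i ∧ Nontrivial (Ext.{u} (FB.obj Y) S p) ∧ Nontrivial (Ext.{u} S (FA.obj X) q)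
  decomp : ∀ C, ∃ X Y, Nonempty (C ≅ FA.obj X ⊞ FB.obj Y)
  bridge_A : ∃ X, Nonempty (FA.obj X ≅ S)
  bridge_B : ∃ Y, Nonempty (FB.obj Y ≅ S)
  finite_bridge : Module.Finite Rᵐᵒᵖ S
  factor_AB : ∀ X Y (f : FA.obj X ⟶ FB.obj Y), Module.Finite Rᵐᵒᵖ (FA.obj X) →
    ∃ (T : RightMod R) (g : FA.obj X ⟶ T) (h : T ⟶ FB.obj Y),
      addClosure (ObjectProperty.singleton S) T ∧ g ≫ h = f
  factor_BA : ∀ Y X (f : FB.obj Y ⟶ FA.obj X), Module.Finite Rᵐᵒᵖ (FB.obj Y) →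
    ∃ (T : RightMod R) (g : FB.obj Y ⟶ T) (h : T ⟶ FA.obj X),
      addClosure (ObjectProperty.singleton S) T ∧ g ≫ h = f

namespace IsBridgeGluing

variable {R A B : Type u} [Ring R] [Ring A] [Ring B]
  {FA : RightMod A ⥤ RightMod R} {FB : RightMod B ⥤ RightMod R} {S : RightMod R}
  (H : IsBridgeGluing FA FB S)
  {PA : ObjectProperty (RightMod A)} {PB : ObjectProperty (RightMod B)}
  {M : ObjectProperty (RightMod R)} {d : ℕ} {D : Set ℕ}

include H

/-- From A to B only degree 0 occurs. From B to A the degree is p + q, where p is a degree of an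
extension of the bridge inside `PB` and q one inside `PA`; this is why `D` must be closed under
addition and why both subcategories must contain the bridge. -/
lemma extDegreesIn_glue (h0 : 0 ∈ D) (hadd : ∀ p ∈ D, ∀ q ∈ D, p + q ∈ D)
    (hA : ExtDegreesIn D PA) (hB : ExtDegreesIn D PB)
    {SA : RightMod A} (hSA : PA SA) (eA : FA.obj SA ≅ S)
    {SB : RightMod B} (hSB : PB SB) (eB : FB.obj SB ≅ S)
    (hBfin : ∀ Y, PB Y → Module.Finite Bᵐᵒᵖ Y) :
    ExtDegreesIn D (addClosure (PA.map FA ⊔ PB.map FB)) := by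
  refine ExtDegreesIn.addClosure ?_
  rintro M N (⟨X, hX, ⟨e⟩⟩ | ⟨Y, hY, ⟨e⟩⟩) (⟨X', hX', ⟨e'⟩⟩ | ⟨Y', hY', ⟨e'⟩⟩) i hi <;>
    replace hi := nontrivial_ext_of_retract_right (Retract.ofIso e'.symm)
      (nontrivial_ext_of_retract_left (Retract.ofIso e.symm) hi)
  · exact hA _ _ hX hX' i ((H.ext_A _ _ _).1 hi)
  · rcases Nat.eq_zero_or_pos i with rfl | hpos
    · exact h0
    · exact (not_subsingleton_iff_nontrivial.2 hi (H.ext_AB X Y' i hpos)).elim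
  · obtain ⟨p, q, rfl, hp, hq⟩ := H.ext_BA X' Y i ((H.finite_B Y).2 (hBfin Y hY)) hi
    refine hadd p (hB _ _ hY hSB p ((H.ext_B _ _ _).1 ?_)) q
      (hA _ _ hSA hX' q ((H.ext_A _ _ _).1 ?_))
    · exact nontrivial_ext_of_retract_right (Retract.ofIso eB.symm) hp
    · exact nontrivial_ext_of_retract_left (Retract.ofIso eA.symm) hq
  · exact hB _ _ hY hY' i ((H.ext_B _ _ _).1 hi)

/-- The bridge belongs to every cluster tilting subcategory of the first module category. -/
lemma bridge_mem_A (hA : IsClusterTilting d PA) {SA : RightMod A} (eA : FA.obj SA ≅ S) :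
    PA SA := by
  obtain ⟨SB, ⟨eB⟩⟩ := H.bridge_B
  have hfin : Module.Finite Rᵐᵒᵖ (FA.obj SA) :=
    have := H.finite_bridge
    Module.Finite.equiv eA.symm.toLinearEquiv
  -- The bridge is also a B-module, so Ext^i(X, SA) becomes an extension group from an A-module to a
  -- B-module, which vanishes for i > 0.
  refine (hA.eq_rightPerp SA).2 ⟨(H.finite_A SA).1 hfin, fun X hX i hi _ => ?_⟩
  by_contra hc
  rw [not_subsingleton_iff_nontrivial, ← H.ext_A] at hc
  exact not_subsingleton_iff_nontrivial.2
    (nontrivial_ext_of_retract_right (Retract.ofIso (eA ≪≫ eB.symm)) hc) (H.ext_AB X SB i hi)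

/-- The bridge belongs to every cluster tilting subcategory of the second module category. -/
lemma bridge_mem_B (hB : IsClusterTilting d PB) {SB : RightMod B} (eB : FB.obj SB ≅ S) :
    PB SB := by
  obtain ⟨SA, ⟨eA⟩⟩ := H.bridge_A
  have hfin : Module.Finite Rᵐᵒᵖ (FB.obj SB) :=
    have := H.finite_bridge
    Module.Finite.equiv eB.symm.toLinearEquiv
  -- Dually, the bridge in the first argument is regarded as an A-module.
  refine (hB.eq_leftPerp SB).2 ⟨(H.finite_B SB).1 hfin, fun X hX i hi _ => ?_⟩
  by_contra hc
  rw [not_subsingleton_iff_nontrivial, ← H.ext_B] at hc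
  exact not_subsingleton_iff_nontrivial.2
    (nontrivial_ext_of_retract_left (Retract.ofIso (eB ≪≫ eA.symm)) hc) (H.ext_AB SA X i hi)

lemma extDegreesIn_glue_of_isClusterTilting (hA : IsClusterTilting d PA)
    (hB : IsClusterTilting d PB) (h0 : 0 ∈ D) (hadd : ∀ p ∈ D, ∀ q ∈ D, p + q ∈ D)
    (hA' : ExtDegreesIn D PA) (hB' : ExtDegreesIn D PB) :
    ExtDegreesIn D (addClosure (PA.map FA ⊔ PB.map FB)) := by
  obtain ⟨SA, ⟨eA⟩⟩ := H.bridge_A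
  obtain ⟨SB, ⟨eB⟩⟩ := H.bridge_B
  exact H.extDegreesIn_glue h0 hadd hA' hB' (H.bridge_mem_A hA eA) eA (H.bridge_mem_B hB eB) eB
    fun Y hY => hB.finite hY

lemma subsingleton_ext_glue (hA : IsClusterTilting d PA) (hB : IsClusterTilting d PB)
    {M N : RightMod R} (hM : addClosure (PA.map FA ⊔ PB.map FB) M)
    (hN : addClosure (PA.map FA ⊔ PB.map FB) N) (i : ℕ) (hi : 0 < i) (hid : i < d) :
    Subsingleton (Ext.{u} M N i) := by
  by_contra hc
  rw [not_subsingleton_iff_nontrivial] at hc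
  have := H.extDegreesIn_glue_of_isClusterTilting hA hB (D := {i | i = 0 ∨ d ≤ i}) (Or.inl rfl)
    (fun p hp q hq => by simp only [Set.mem_ofPred_eq] at *; omega)
    hA.extDegreesIn hB.extDegreesIn M N hM hN i hc
  simp only [Set.mem_ofPred_eq] at this
  omega

lemma mem_A_of_leftPerp (hA : IsClusterTilting d PA) {X : RightMod A}
    (hX : Module.Finite Rᵐᵒᵖ (FA.obj X))
    (h : ∀ X', PA X' → ∀ i, 0 < i → i < d → Subsingleton (Ext.{u} (FA.obj X) (FA.obj X') i)) :
    PA X := by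
  refine (hA.eq_leftPerp X).2 ⟨(H.finite_A X).1 hX, fun X' hX' i hi hid => ?_⟩
  by_contra hc
  rw [not_subsingleton_iff_nontrivial, ← H.ext_A] at hc
  exact not_subsingleton_iff_nontrivial.2 hc (h X' hX' i hi hid)

lemma mem_A_of_rightPerp (hA : IsClusterTilting d PA) {X : RightMod A}
    (hX : Module.Finite Rᵐᵒᵖ (FA.obj X))
    (h : ∀ X', PA X' → ∀ i, 0 < i → i < d → Subsingleton (Ext.{u} (FA.obj X') (FA.obj X) i)) :
    PA X := by
  refine (hA.eq_rightPerp X).2 ⟨(H.finite_A X).1 hX, fun X' hX' i hi hid => ?_⟩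
  by_contra hc
  rw [not_subsingleton_iff_nontrivial, ← H.ext_A] at hc
  exact not_subsingleton_iff_nontrivial.2 hc (h X' hX' i hi hid)

lemma mem_B_of_leftPerp (hB : IsClusterTilting d PB) {X : RightMod B}
    (hX : Module.Finite Rᵐᵒᵖ (FB.obj X))
    (h : ∀ X', PB X' → ∀ i, 0 < i → i < d → Subsingleton (Ext.{u} (FB.obj X) (FB.obj X') i)) :
    PB X := by
  refine (hB.eq_leftPerp X).2 ⟨(H.finite_B X).1 hX, fun X' hX' i hi hid => ?_⟩
  by_contra hc
  rw [not_subsingleton_iff_nontrivial, ← H.ext_B] at hc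
  exact not_subsingleton_iff_nontrivial.2 hc (h X' hX' i hi hid)

lemma mem_B_of_rightPerp (hB : IsClusterTilting d PB) {X : RightMod B}
    (hX : Module.Finite Rᵐᵒᵖ (FB.obj X))
    (h : ∀ X', PB X' → ∀ i, 0 < i → i < d → Subsingleton (Ext.{u} (FB.obj X') (FB.obj X) i)) :
    PB X := by
  refine (hB.eq_rightPerp X).2 ⟨(H.finite_B X).1 hX, fun X' hX' i hi hid => ?_⟩
  by_contra hc
  rw [not_subsingleton_iff_nontrivial, ← H.ext_B] at hc
  exact not_subsingleton_iff_nontrivial.2 hc (h X' hX' i hi hid)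

omit H in
lemma finite_of_retract {X Y : RightMod R} (r : Retract X Y) [Module.Finite Rᵐᵒᵖ Y] :
    Module.Finite Rᵐᵒᵖ X :=
  Module.Finite.of_surjective r.r.hom fun x =>
    ⟨r.i.hom x, DFunLike.congr_fun (congrArg ModuleCat.Hom.hom r.retract) x⟩

omit H in
/-- The first summand of a decomposition, as a retract. -/
def retractFst {C X Y : RightMod R} (e : C ≅ X ⊞ Y) : Retract X C where
  i := biprod.inl ≫ e.inv
  r := e.hom ≫ biprod.fst

omit H in
/-- The second summand of a decomposition, as a retract. -/
def retractSnd {C X Y : RightMod R} (e : C ≅ X ⊞ Y) : Retract Y C where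
  i := biprod.inr ≫ e.inv
  r := e.hom ≫ biprod.snd

omit H in
lemma mem_glue {C : RightMod R} {X : RightMod A} {Y : RightMod B} (e : C ≅ FA.obj X ⊞ FB.obj Y)
    (hX : PA X) (hY : PB Y) : addClosure (PA.map FA ⊔ PB.map FB) C :=
  addClosure_of_iso e (addClosure_biprod
    (le_addClosure _ (Or.inl (PA.prop_map_obj FA hX)))
    (le_addClosure _ (Or.inr (PB.prop_map_obj FB hY))))

omit H in
lemma hasAdditiveGenerator_glue [FA.Additive] [FB.Additive] (hA : HasAdditiveGenerator PA)
    (hB : HasAdditiveGenerator PB) :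
    HasAdditiveGenerator (addClosure (PA.map FA ⊔ PB.map FB)) := by
  obtain ⟨GA, rfl⟩ := hA
  obtain ⟨GB, rfl⟩ := hB
  have hself : ∀ {R : Type u} [Ring R] (G : RightMod R), ObjectProperty.singleton G G :=
    fun G => (ObjectProperty.singleton_iff _ _).2 rfl
  refine ⟨FA.obj GA ⊞ FB.obj GB, le_antisymm (addClosure_le_of_le_addClosure ?_)
    (addClosure_le_of_le_addClosure ?_)⟩
  · rintro X (⟨Y, hY, ⟨e⟩⟩ | ⟨Y, hY, ⟨e⟩⟩)
    · refine addClosure_of_iso e.symm (addClosure_le_of_le_addClosure ?_ _ (addClosure_map FA hY))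
      rintro _ ⟨Z, hZ, ⟨e'⟩⟩
      obtain rfl := (ObjectProperty.singleton_iff _ _).1 hZ
      exact addClosure_of_iso e'.symm (addClosure_of_retract (retractFst (Iso.refl _))
        (le_addClosure _ (hself _)))
    · refine addClosure_of_iso e.symm (addClosure_le_of_le_addClosure ?_ _ (addClosure_map FB hY))
      rintro _ ⟨Z, hZ, ⟨e'⟩⟩
      obtain rfl := (ObjectProperty.singleton_iff _ _).1 hZ
      exact addClosure_of_iso e'.symm (addClosure_of_retract (retractSnd (Iso.refl _))
        (le_addClosure _ (hself _)))
  · intro X hX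
    obtain rfl := (ObjectProperty.singleton_iff _ _).1 hX
    exact mem_glue (Iso.refl _) (le_addClosure _ (hself _)) (le_addClosure _ (hself _))

lemma finite_glue (hA : IsClusterTilting d PA) (hB : IsClusterTilting d PB) {C : RightMod R}
    (hC : addClosure (PA.map FA ⊔ PB.map FB) C) : Module.Finite Rᵐᵒᵖ C := by
  refine finite_of_addClosure ?_ hC
  rintro X (⟨Y, hY, ⟨e⟩⟩ | ⟨Y, hY, ⟨e⟩⟩)
  · have := (H.finite_A Y).2 (hA.finite hY)
    exact Module.Finite.equiv e.toLinearEquiv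
  · have := (H.finite_B Y).2 (hB.finite hY)
    exact Module.Finite.equiv e.toLinearEquiv

/-- Each module splits into an A-part and a B-part. Covers and embeddings are taken on the two parts
separately, and a module orthogonal to the glued subcategory has parts orthogonal to `PA` and `PB`.
Approximations come from the additive generator. -/
lemma isClusterTilting_glue [FA.Additive] [FB.Additive]
    [FA.PreservesMonomorphisms] [FB.PreservesMonomorphisms]
    [FA.PreservesEpimorphisms] [FB.PreservesEpimorphisms] (hR : AddFunctoriallyFinite R)
    (hA : IsClusterTilting d PA) (hB : IsClusterTilting d PB)
    (hA' : HasAdditiveGenerator PA) (hB' : HasAdditiveGenerator PB) :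
    IsClusterTilting d (addClosure (PA.map FA ⊔ PB.map FB)) := by
  have hfin := fun C hC => H.finite_glue hA hB (C := C) hC
  obtain ⟨h1, h2⟩ := (hasAdditiveGenerator_glue hA'
    hB').contravariantlyFinite_and_covariantlyFinite hfin hR
  have hmemA : ∀ X, PA X → addClosure (PA.map FA ⊔ PB.map FB) (FA.obj X) :=
    fun X hX => le_addClosure _ (Or.inl (PA.prop_map_obj FA hX))
  have hmemB : ∀ X, PB X → addClosure (PA.map FA ⊔ PB.map FB) (FB.obj X) :=
    fun X hX => le_addClosure _ (Or.inr (PB.prop_map_obj FB hX))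
  refine ⟨h1, h2, ?_, ?_, ?_, ?_⟩
  · intro C hC
    obtain ⟨X, Y, ⟨e⟩⟩ := H.decomp C
    obtain ⟨MX, f, hMX, hf⟩ := hA.generating X
      ((H.finite_A X).1 (finite_of_retract (retractFst e)))
    obtain ⟨MY, g, hMY, hg⟩ := hB.generating Y
      ((H.finite_B Y).1 (finite_of_retract (retractSnd e)))
    exact ⟨_, biprod.map (FA.map f) (FB.map g) ≫ e.inv, mem_glue (Iso.refl _) hMX hMY,
      inferInstance⟩
  · intro C hC
    obtain ⟨X, Y, ⟨e⟩⟩ := H.decomp C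
    obtain ⟨MX, f, hMX, hf⟩ := hA.cogenerating X
      ((H.finite_A X).1 (finite_of_retract (retractFst e)))
    obtain ⟨MY, g, hMY, hg⟩ := hB.cogenerating Y
      ((H.finite_B Y).1 (finite_of_retract (retractSnd e)))
    exact ⟨_, e.hom ≫ biprod.map (FA.map f) (FB.map g), mem_glue (Iso.refl _) hMX hMY,
      inferInstance⟩
  · refine fun C => ⟨fun hC => ⟨hfin C hC, fun N hN => H.subsingleton_ext_glue hA hB hC hN⟩, ?_⟩
    rintro ⟨hC, h⟩
    obtain ⟨X, Y, ⟨e⟩⟩ := H.decomp C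
    refine mem_glue e (H.mem_A_of_leftPerp hA (finite_of_retract (retractFst e)) ?_)
      (H.mem_B_of_leftPerp hB (finite_of_retract (retractSnd e)) ?_)
    · intro X' hX' i hi hid
      by_contra hc
      exact not_subsingleton_iff_nontrivial.2 (nontrivial_ext_of_retract_left (retractFst e)
        (not_subsingleton_iff_nontrivial.1 hc)) (h _ (hmemA _ hX') i hi hid)
    · intro X' hX' i hi hid
      by_contra hc
      exact not_subsingleton_iff_nontrivial.2 (nontrivial_ext_of_retract_left (retractSnd e)
        (not_subsingleton_iff_nontrivial.1 hc)) (h _ (hmemB _ hX') i hi hid)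
  · refine fun C => ⟨fun hC => ⟨hfin C hC, fun N hN => H.subsingleton_ext_glue hA hB hN hC⟩, ?_⟩
    rintro ⟨hC, h⟩
    obtain ⟨X, Y, ⟨e⟩⟩ := H.decomp C
    refine mem_glue e (H.mem_A_of_rightPerp hA (finite_of_retract (retractFst e)) ?_)
      (H.mem_B_of_rightPerp hB (finite_of_retract (retractSnd e)) ?_)
    · intro X' hX' i hi hid
      by_contra hc
      exact not_subsingleton_iff_nontrivial.2 (nontrivial_ext_of_retract_right (retractFst e)
        (not_subsingleton_iff_nontrivial.1 hc)) (h _ (hmemA _ hX') i hi hid)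
    · intro X' hX' i hi hid
      by_contra hc
      exact not_subsingleton_iff_nontrivial.2 (nontrivial_ext_of_retract_right (retractSnd e)
        (not_subsingleton_iff_nontrivial.1 hc)) (h _ (hmemB _ hX') i hi hid)

/-- Gluing adds no new A-modules: one lying in the glued subcategory is orthogonal to `PA`, hence in
`PA` by maximality. -/
lemma inverseImage_glue_A (hA : IsClusterTilting d PA) (hB : IsClusterTilting d PB) :
    (addClosure (PA.map FA ⊔ PB.map FB)).inverseImage FA = PA := by
  refine le_antisymm (fun X hX => ?_)
    fun X hX => le_addClosure _ (Or.inl (PA.prop_map_obj FA hX))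
  exact H.mem_A_of_leftPerp hA (H.finite_glue hA hB hX) fun X' hX' =>
    H.subsingleton_ext_glue hA hB hX (le_addClosure _ (Or.inl (PA.prop_map_obj FA hX')))

lemma inverseImage_glue_B (hA : IsClusterTilting d PA) (hB : IsClusterTilting d PB) :
    (addClosure (PA.map FA ⊔ PB.map FB)).inverseImage FB = PB := by
  refine le_antisymm (fun X hX => ?_)
    fun X hX => le_addClosure _ (Or.inr (PB.prop_map_obj FB hX))
  exact H.mem_B_of_leftPerp hB (H.finite_glue hA hB hX) fun X' hX' =>
    H.subsingleton_ext_glue hA hB hX (le_addClosure _ (Or.inr (PB.prop_map_obj FB hX')))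

lemma glue_inverseImage (hM : IsClusterTilting d M) :
    addClosure ((M.inverseImage FA).map FA ⊔ (M.inverseImage FB).map FB) = M := by
  refine le_antisymm (le_trans (addClosure_mono ?_) hM.addClosure_le) fun C hC => ?_
  · rintro X (⟨Y, hY, ⟨e⟩⟩ | ⟨Y, hY, ⟨e⟩⟩) <;> exact hM.of_iso e.symm hY
  · obtain ⟨X, Y, ⟨e⟩⟩ := H.decomp C
    exact mem_glue e
      (hM.addClosure_le _ (addClosure_of_retract (retractFst e) (le_addClosure _ hC)))
      (hM.addClosure_le _ (addClosure_of_retract (retractSnd e) (le_addClosure _ hC)))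

end IsBridgeGluing

/-! ### Replacing the complementary summand by the bridge. -/

section FullyFaithful

variable {R A : Type u} [Ring R] [Ring A] {F : RightMod A ⥤ RightMod R} [F.Additive]
  {P Q : ObjectProperty (RightMod A)} {S : RightMod R} {SA : RightMod A}

lemma addClosure_of_map [F.Full] [F.Faithful] {X : RightMod A}
    (hX : addClosure (P.map F) (F.obj X)) : addClosure P X := by
  obtain ⟨n, Y, f, g, hY, hfg⟩ := addClosure_iff.1 hX
  choose Z hZ e using hY
  replace e := fun i => (e i).some
  refine addClosure_of_sum_eq_id Z hZ (fun i => F.preimage (f i ≫ (e i).inv))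
    (fun i => F.preimage ((e i).hom ≫ g i)) (F.map_injective ?_)
  simpa [Functor.map_sum] using hfg

/-- `T` itself need not be presented as an object of the image of `F`. Being a retract of one is
enough when `T` serves as an intermediate object of a factorization. -/
lemma exists_retract_map_of_addClosure {T : RightMod R} (hT : addClosure (P.map F) T) :
    ∃ W : RightMod A, addClosure P W ∧ Nonempty (Retract T (F.obj W)) := by
  classical
  obtain ⟨n, Y, f, g, hY, hfg⟩ := addClosure_iff.1 hT
  choose Z hZ e using hY
  replace e := fun i => (e i).some
  refine ⟨⨁ Z, ⟨n, Z, hZ, ⟨Retract.refl _⟩⟩,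
    ⟨⟨∑ i, f i ≫ (e i).inv ≫ F.map (biproduct.ι Z i),
      ∑ i, F.map (biproduct.π Z i) ≫ (e i).hom ≫ g i, ?_⟩⟩⟩
  rw [← hfg, Preadditive.sum_comp]
  refine Finset.sum_congr rfl fun i _ => ?_
  rw [Preadditive.comp_sum, Finset.sum_eq_single i]
  · simp [← Functor.map_comp_assoc]
  · intro j _ hj
    simp [← Functor.map_comp_assoc, biproduct.ι_π_ne _ (Ne.symm hj)]
  · simp

omit [F.Additive] in
lemma addClosure_singleton_le_of_iso (e : F.obj SA ≅ S) (hSA : P SA) :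
    addClosure (ObjectProperty.singleton S) ≤ addClosure (P.map F) :=
  addClosure_mono fun X hX => by
    obtain rfl := (ObjectProperty.singleton_iff _ _).1 hX
    exact ⟨SA, hSA, ⟨e⟩⟩

variable {X X' Z : RightMod A} {G N Y : RightMod R}

/-- The identity of `F.obj Z` is a sum of maps through G = F X ⊕ Y. The components through Y factor
through add S by `hfac`, so the identity is also a sum of maps through F X and objects of add S, and
full faithfulness brings this back to the source category. -/
lemma addClosure_singleton_of_obj_mem [F.Full] [F.Faithful] (eG : G ≅ F.obj X ⊞ Y)
    (eS : F.obj SA ≅ S)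
    (hfac : ∀ f : F.obj Z ⟶ Y, ∃ (T : RightMod R) (g : F.obj Z ⟶ T) (h : T ⟶ Y),
      addClosure (ObjectProperty.singleton S) T ∧ g ≫ h = f)
    (hZ : addClosure (ObjectProperty.singleton G) (F.obj Z)) :
    addClosure (ObjectProperty.singleton (X ⊞ SA)) Z := by
  have hself : addClosure (ObjectProperty.singleton (X ⊞ SA)) (X ⊞ SA) :=
    le_addClosure _ ((ObjectProperty.singleton_iff _ _).2 rfl)
  have hX : addClosure (ObjectProperty.singleton (X ⊞ SA)) X :=
    addClosure_of_retract ⟨biprod.inl, biprod.fst, by simp⟩ hself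
  have hS : addClosure (ObjectProperty.singleton (X ⊞ SA)) SA :=
    addClosure_of_retract ⟨biprod.inr, biprod.snd, by simp⟩ hself
  refine addClosure_le_of_le_addClosure le_rfl Z (addClosure_of_map (F := F) ?_)
  obtain ⟨n, W, f, g, hW, hfg⟩ := addClosure_iff.1 hZ
  have hW' : ∀ i, W i = G := fun i => ((ObjectProperty.singleton_iff _ _).1 (hW i)).symm
  obtain rfl : W = fun _ => G := funext hW'
  choose T a b hT hab using fun i => hfac (f i ≫ eG.hom ≫ biprod.snd)
  refine addClosure_le_of_le_addClosure le_rfl _ (addClosure_of_sum_eq_id (ι := Fin n ⊕ Fin n)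
    (Sum.elim (fun _ => F.obj X) T) ?_
    (Sum.rec (fun i => f i ≫ eG.hom ≫ biprod.fst) a)
    (Sum.rec (fun i => biprod.inl ≫ eG.inv ≫ g i) fun i => b i ≫ biprod.inr ≫ eG.inv ≫ g i) ?_)
  · rintro (i | i)
    · exact le_addClosure _ (ObjectProperty.prop_map_obj _ F hX)
    · exact addClosure_singleton_le_of_iso eS hS _ (hT i)
  · rw [Fintype.sum_sum_type, ← hfg, ← Finset.sum_add_distrib]
    refine Finset.sum_congr rfl fun i _ => ?_
    have h1 : a i ≫ b i ≫ biprod.inr ≫ eG.inv ≫ g i =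
        f i ≫ eG.hom ≫ biprod.snd ≫ biprod.inr ≫ eG.inv ≫ g i := by
      rw [← Category.assoc, hab]; simp
    have h2 : (biprod.fst ≫ biprod.inl + biprod.snd ≫ biprod.inr : F.obj X ⊞ Y ⟶ _) = 𝟙 _ :=
      biprod.total
    have h3 := congrArg (fun t => f i ≫ eG.hom ≫ t ≫ eG.inv ≫ g i) h2
    simp only [Preadditive.add_comp, Preadditive.comp_add, Category.assoc, Category.id_comp,
      Iso.hom_inv_id_assoc] at h3
    simpa [h1] using h3

/-- The component Y → F X factors through some T in add S, which is a retract of F W with W in `P`.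
Hence the given epimorphism factors through the image of a map X' ⊕ W → X. -/
lemma exists_epi_of_epi [F.Full] [F.Faithful] (hP : addClosure P ≤ P) (eN : N ≅ F.obj X' ⊞ Y)
    (hX' : P X') (eS : F.obj SA ≅ S) (hSA : P SA) (f : N ⟶ F.obj X) [Epi f]
    (hfac : ∀ f : Y ⟶ F.obj X, ∃ (T : RightMod R) (g : Y ⟶ T) (h : T ⟶ F.obj X),
      addClosure (ObjectProperty.singleton S) T ∧ g ≫ h = f) :
    ∃ (V : RightMod A) (v : V ⟶ X), P V ∧ Epi v := by
  obtain ⟨T, g, h, hT, hgh⟩ := hfac (biprod.inr ≫ eN.inv ≫ f)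
  obtain ⟨W, hW, ⟨r⟩⟩ := exists_retract_map_of_addClosure
    (addClosure_singleton_le_of_iso eS hSA T hT)
  let v : X' ⊞ W ⟶ X :=
    biprod.desc (F.preimage (biprod.inl ≫ eN.inv ≫ f)) (F.preimage (r.r ≫ h))
  -- Only this factorization matters: it makes `F.map v` an epimorphism, and a faithful functor
  -- reflects that.
  have hv : (eN.hom ≫ biprod.desc (F.map biprod.inl) (g ≫ r.i ≫ F.map biprod.inr)) ≫ F.map v
      = f := by
    rw [Category.assoc, ← Iso.eq_inv_comp]
    apply biprod.hom_ext'
    · simp [v, ← F.map_comp]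
    · simp [v, ← F.map_comp, hgh]
  have : Epi (F.map v) := epi_of_epi_fac hv
  exact ⟨X' ⊞ W, v, hP _ (addClosure_biprod (le_addClosure _ hX') hW), F.epi_of_epi_map this⟩

lemma exists_mono_of_mono [F.Full] [F.Faithful] (hP : addClosure P ≤ P) (eN : N ≅ F.obj X' ⊞ Y)
    (hX' : P X') (eS : F.obj SA ≅ S) (hSA : P SA) (f : F.obj X ⟶ N) [Mono f]
    (hfac : ∀ f : F.obj X ⟶ Y, ∃ (T : RightMod R) (g : F.obj X ⟶ T) (h : T ⟶ Y),
      addClosure (ObjectProperty.singleton S) T ∧ g ≫ h = f) :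
    ∃ (V : RightMod A) (v : X ⟶ V), P V ∧ Mono v := by
  obtain ⟨T, g, h, hT, hgh⟩ := hfac (f ≫ eN.hom ≫ biprod.snd)
  obtain ⟨W, hW, ⟨r⟩⟩ := exists_retract_map_of_addClosure
    (addClosure_singleton_le_of_iso eS hSA T hT)
  let v : X ⟶ X' ⊞ W :=
    biprod.lift (F.preimage (f ≫ eN.hom ≫ biprod.fst)) (F.preimage (g ≫ r.i))
  have hv : F.map v ≫ biprod.lift (F.map biprod.fst) (F.map biprod.snd ≫ r.r ≫ h) ≫ eN.inv
      = f := by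
    rw [← Category.assoc, Iso.comp_inv_eq]
    apply biprod.hom_ext
    · simp [v, ← F.map_comp]
    · simp [v, ← F.map_comp_assoc, hgh]
  have : Mono (F.map v) := mono_of_mono_fac hv
  exact ⟨X' ⊞ W, v, hP _ (addClosure_biprod (le_addClosure _ hX') hW), F.mono_of_mono_map this⟩

end FullyFaithful

/-! ### Intersections with the two module categories, and the correspondence. -/

namespace IsBridgeGluing

variable {R A B : Type u} [Ring R] [Ring A] [Ring B]
  {FA : RightMod A ⥤ RightMod R} {FB : RightMod B ⥤ RightMod R} {S : RightMod R}
  (H : IsBridgeGluing FA FB S)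
  {M : ObjectProperty (RightMod R)} {d : ℕ} {D : Set ℕ}

include H

omit H in
lemma addClosure_inverseImage_le {F : RightMod A ⥤ RightMod R} [F.Additive]
    (hM : IsClusterTilting d M) : addClosure (M.inverseImage F) ≤ M.inverseImage F := by
  intro X hX
  refine hM.addClosure_le _ (addClosure_mono ?_ _ (addClosure_map F hX))
  rintro _ ⟨Y, hY, ⟨e⟩⟩
  exact hM.of_iso e.symm hY

omit H in
lemma mem_fst {X Y C : RightMod R} (hM : IsClusterTilting d M) (hC : M C) (e : C ≅ X ⊞ Y) :
    M X :=
  hM.addClosure_le _ (addClosure_of_retract (retractFst e) (le_addClosure _ hC))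

omit H in
lemma mem_snd {X Y C : RightMod R} (hM : IsClusterTilting d M) (hC : M C) (e : C ≅ X ⊞ Y) :
    M Y :=
  hM.addClosure_le _ (addClosure_of_retract (retractSnd e) (le_addClosure _ hC))

/-- The generator is the A-part of a generator of `M` together with the bridge; the bridge takes
over the role of the B-part, since maps from A-modules to it factor through add S. -/
lemma hasAdditiveGenerator_inverseImage_A [FA.Additive] [FA.Full] [FA.Faithful]
    (hM : IsClusterTilting d M) (hM' : HasAdditiveGenerator M) (hS : M S) :
    HasAdditiveGenerator (M.inverseImage FA) := by
  obtain ⟨SA, ⟨eA⟩⟩ := H.bridge_A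
  obtain ⟨G, hG⟩ := hM'
  have hGM : M G := hG ▸ le_addClosure _ ((ObjectProperty.singleton_iff _ _).2 rfl)
  obtain ⟨X, Y, ⟨e⟩⟩ := H.decomp G
  refine ⟨X ⊞ SA, le_antisymm (fun Z hZ => ?_) ?_⟩
  · exact addClosure_singleton_of_obj_mem e eA (fun f => H.factor_AB Z Y f (hM.finite hZ)) (hG ▸ hZ)
  · refine le_trans (addClosure_le_of_le_addClosure fun Z hZ => ?_)
      (addClosure_inverseImage_le hM)
    obtain rfl := (ObjectProperty.singleton_iff _ _).1 hZ
    exact addClosure_biprod (le_addClosure _ (mem_fst (M := M) hM hGM e))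
      (le_addClosure _ (hM.of_iso eA hS))

lemma hasAdditiveGenerator_inverseImage_B [FB.Additive] [FB.Full] [FB.Faithful]
    (hM : IsClusterTilting d M) (hM' : HasAdditiveGenerator M) (hS : M S) :
    HasAdditiveGenerator (M.inverseImage FB) := by
  obtain ⟨SB, ⟨eB⟩⟩ := H.bridge_B
  obtain ⟨G, hG⟩ := hM'
  have hGM : M G := hG ▸ le_addClosure _ ((ObjectProperty.singleton_iff _ _).2 rfl)
  obtain ⟨X, Y, ⟨e⟩⟩ := H.decomp G
  refine ⟨Y ⊞ SB, le_antisymm (fun Z hZ => ?_) ?_⟩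
  · exact addClosure_singleton_of_obj_mem (e ≪≫ biprod.braiding _ _) eB
      (fun f => H.factor_BA Z X f (hM.finite hZ)) (hG ▸ hZ)
  · refine le_trans (addClosure_le_of_le_addClosure fun Z hZ => ?_)
      (addClosure_inverseImage_le hM)
    obtain rfl := (ObjectProperty.singleton_iff _ _).1 hZ
    exact addClosure_biprod (le_addClosure _ (mem_snd (M := M) hM hGM e))
      (le_addClosure _ (hM.of_iso eB hS))

lemma extDegreesIn_inverseImage_A (h : ExtDegreesIn D M) : ExtDegreesIn D (M.inverseImage FA) :=
  fun X X' hX hX' i hi => h _ _ hX hX' i ((H.ext_A X X' i).2 hi)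

lemma extDegreesIn_inverseImage_B (h : ExtDegreesIn D M) : ExtDegreesIn D (M.inverseImage FB) :=
  fun X X' hX hX' i hi => h _ _ hX hX' i ((H.ext_B X X' i).2 hi)

omit H in
lemma subsingleton_of_extDegreesIn {P : ObjectProperty (RightMod R)}
    (h : ExtDegreesIn {i | i = 0 ∨ d ≤ i} P) {X Y : RightMod R} (hX : P X) (hY : P Y) (i : ℕ)
    (hi : 0 < i) (hid : i < d) : Subsingleton (Ext.{u} X Y i) := by
  by_contra hc
  have := h X Y hX hY i (not_subsingleton_iff_nontrivial.1 hc)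
  simp only [Set.mem_ofPred_eq] at this
  omega

lemma isClusterTilting_inverseImage_A [FA.Additive] [FA.Full] [FA.Faithful]
    (hA : AddFunctoriallyFinite A)
    (hM : IsClusterTilting d M) (hM' : HasAdditiveGenerator M) (hS : M S) :
    IsClusterTilting d (M.inverseImage FA) := by
  obtain ⟨SA, ⟨eA⟩⟩ := H.bridge_A
  have hSA : M (FA.obj SA) := hM.of_iso eA hS
  have hfin : ∀ X, M.inverseImage FA X → Module.Finite Aᵐᵒᵖ X :=
    fun X hX => (H.finite_A X).1 (hM.finite hX)
  obtain ⟨h1, h2⟩ := (H.hasAdditiveGenerator_inverseImage_A hM hM'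
    hS).contravariantlyFinite_and_covariantlyFinite hfin hA
  have hdeg := H.extDegreesIn_inverseImage_A hM.extDegreesIn
  refine ⟨h1, h2, ?_, ?_, ?_, ?_⟩
  · intro X hX
    obtain ⟨N, f, hN, hf⟩ := hM.generating _ ((H.finite_A X).2 hX)
    obtain ⟨X', Y, ⟨e⟩⟩ := H.decomp N
    exact exists_epi_of_epi (addClosure_inverseImage_le hM) e (mem_fst (M := M) hM hN e) eA hSA f
      fun f => H.factor_BA Y X f (hM.finite (mem_snd (M := M) hM hN e))
  · intro X hX
    obtain ⟨N, f, hN, hf⟩ := hM.cogenerating _ ((H.finite_A X).2 hX)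
    obtain ⟨X', Y, ⟨e⟩⟩ := H.decomp N
    exact exists_mono_of_mono (addClosure_inverseImage_le hM) e (mem_fst (M := M) hM hN e) eA hSA f
      fun f => H.factor_AB X Y f ((H.finite_A X).2 hX)
  · refine fun X => ⟨fun hX => ⟨hfin X hX, fun X' hX' =>
      subsingleton_of_extDegreesIn hdeg hX hX'⟩, fun ⟨hX, h⟩ => ?_⟩
    refine (hM.eq_leftPerp _).2 ⟨(H.finite_A X).2 hX, fun N hN i hi hid => ?_⟩
    by_contra hc
    rw [not_subsingleton_iff_nontrivial] at hc
    obtain ⟨X', Y, ⟨e⟩⟩ := H.decomp N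
    rcases nontrivial_ext_biprod_right
      (nontrivial_ext_of_retract_right (Retract.ofIso e) hc) with hc | hc
    · exact not_subsingleton_iff_nontrivial.2 ((H.ext_A _ _ _).1 hc)
        (h X' (mem_fst (M := M) hM hN e) i hi hid)
    · exact not_subsingleton_iff_nontrivial.2 hc (H.ext_AB X Y i hi)
  · refine fun X => ⟨fun hX => ⟨hfin X hX, fun X' hX' =>
      subsingleton_of_extDegreesIn hdeg hX' hX⟩, fun ⟨hX, h⟩ => ?_⟩
    refine (hM.eq_rightPerp _).2 ⟨(H.finite_A X).2 hX, fun N hN i hi hid => ?_⟩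
    by_contra hc
    rw [not_subsingleton_iff_nontrivial] at hc
    obtain ⟨X', Y, ⟨e⟩⟩ := H.decomp N
    rcases nontrivial_ext_biprod_left
      (nontrivial_ext_of_retract_left (Retract.ofIso e) hc) with hc | hc
    · exact not_subsingleton_iff_nontrivial.2 ((H.ext_A _ _ _).1 hc)
        (h X' (mem_fst (M := M) hM hN e) i hi hid)
    · have hY := mem_snd (M := M) hM hN e
      -- Here S ∈ M is essential: p is a degree inside `M`, so it is 0 or at least d, while q is 0
      -- or at least d because X is orthogonal to the bridge as an object of M ∩ mod A. Then p + q
      -- cannot lie strictly between 0 and d.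
      obtain ⟨p, q, rfl, hp, hq⟩ := H.ext_BA X Y i (hM.finite hY) hc
      have hp' := hM.extDegreesIn _ _ hY hS p hp
      have hq' : ¬ (0 < q ∧ q < d) := fun hq' => not_subsingleton_iff_nontrivial.2
        ((H.ext_A _ _ _).1 (nontrivial_ext_of_retract_left (Retract.ofIso eA.symm) hq))
        (h SA hSA q hq'.1 hq'.2)
      simp only [Set.mem_ofPred_eq] at hp'
      omega

lemma isClusterTilting_inverseImage_B [FB.Additive] [FB.Full] [FB.Faithful]
    (hB : AddFunctoriallyFinite B)
    (hM : IsClusterTilting d M) (hM' : HasAdditiveGenerator M) (hS : M S) :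
    IsClusterTilting d (M.inverseImage FB) := by
  obtain ⟨SB, ⟨eB⟩⟩ := H.bridge_B
  have hSB : M (FB.obj SB) := hM.of_iso eB hS
  have hfin : ∀ X, M.inverseImage FB X → Module.Finite Bᵐᵒᵖ X :=
    fun X hX => (H.finite_B X).1 (hM.finite hX)
  obtain ⟨h1, h2⟩ := (H.hasAdditiveGenerator_inverseImage_B hM hM'
    hS).contravariantlyFinite_and_covariantlyFinite hfin hB
  have hdeg := H.extDegreesIn_inverseImage_B hM.extDegreesIn
  refine ⟨h1, h2, ?_, ?_, ?_, ?_⟩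
  · intro Y hY
    obtain ⟨N, f, hN, hf⟩ := hM.generating _ ((H.finite_B Y).2 hY)
    obtain ⟨X, Y', ⟨e⟩⟩ := H.decomp N
    exact exists_epi_of_epi (addClosure_inverseImage_le hM) (e ≪≫ biprod.braiding _ _)
      (mem_snd (M := M) hM hN e) eB hSB f
      fun f => H.factor_AB X Y f (hM.finite (mem_fst (M := M) hM hN e))
  · intro Y hY
    obtain ⟨N, f, hN, hf⟩ := hM.cogenerating _ ((H.finite_B Y).2 hY)
    obtain ⟨X, Y', ⟨e⟩⟩ := H.decomp N
    exact exists_mono_of_mono (addClosure_inverseImage_le hM) (e ≪≫ biprod.braiding _ _)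
      (mem_snd (M := M) hM hN e) eB hSB f
      fun f => H.factor_BA Y X f ((H.finite_B Y).2 hY)
  · refine fun Y => ⟨fun hY => ⟨hfin Y hY, fun Y' hY' =>
      subsingleton_of_extDegreesIn hdeg hY hY'⟩, fun ⟨hY, h⟩ => ?_⟩
    have hYfin := (H.finite_B Y).2 hY
    refine (hM.eq_leftPerp _).2 ⟨hYfin, fun N hN i hi hid => ?_⟩
    by_contra hc
    rw [not_subsingleton_iff_nontrivial] at hc
    obtain ⟨X, Y', ⟨e⟩⟩ := H.decomp N
    rcases nontrivial_ext_biprod_right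
      (nontrivial_ext_of_retract_right (Retract.ofIso e) hc) with hc | hc
    · have hX := mem_fst (M := M) hM hN e
      -- The roles are exchanged: q is a degree inside `M`, and p is controlled by the orthogonality
      -- of Y to the bridge.
      obtain ⟨p, q, rfl, hp, hq⟩ := H.ext_BA X Y i hYfin hc
      have hq' := hM.extDegreesIn _ _ hS hX q hq
      have hp' : ¬ (0 < p ∧ p < d) := fun hp' => not_subsingleton_iff_nontrivial.2
        ((H.ext_B _ _ _).1 (nontrivial_ext_of_retract_right (Retract.ofIso eB.symm) hp))
        (h SB hSB p hp'.1 hp'.2)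
      simp only [Set.mem_ofPred_eq] at hq'
      omega
    · exact not_subsingleton_iff_nontrivial.2 ((H.ext_B _ _ _).1 hc)
        (h Y' (mem_snd (M := M) hM hN e) i hi hid)
  · refine fun Y => ⟨fun hY => ⟨hfin Y hY, fun Y' hY' =>
      subsingleton_of_extDegreesIn hdeg hY' hY⟩, fun ⟨hY, h⟩ => ?_⟩
    refine (hM.eq_rightPerp _).2 ⟨(H.finite_B Y).2 hY, fun N hN i hi hid => ?_⟩
    by_contra hc
    rw [not_subsingleton_iff_nontrivial] at hc
    obtain ⟨X, Y', ⟨e⟩⟩ := H.decomp N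
    rcases nontrivial_ext_biprod_left
      (nontrivial_ext_of_retract_left (Retract.ofIso e) hc) with hc | hc
    · exact not_subsingleton_iff_nontrivial.2 hc (H.ext_AB X Y i hi)
    · exact not_subsingleton_iff_nontrivial.2 ((H.ext_B _ _ _).1 hc)
        (h Y' (mem_snd (M := M) hM hN e) i hi hid)

/-- The correspondence of cluster tilting subcategories, from the homological properties of the
gluing. -/
theorem correspondence [FA.Additive] [FA.Full] [FA.Faithful] [FB.Additive] [FB.Full] [FB.Faithful]
    [FA.PreservesMonomorphisms] [FB.PreservesMonomorphisms]
    [FA.PreservesEpimorphisms] [FB.PreservesEpimorphisms] (hR : AddFunctoriallyFinite R)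
    (hA : AddFunctoriallyFinite A) (hB : AddFunctoriallyFinite B)
    (glue : ObjectProperty (RightMod A) × ObjectProperty (RightMod B) →
      ObjectProperty (RightMod R))
    (inter : ObjectProperty (RightMod R) →
      ObjectProperty (RightMod A) × ObjectProperty (RightMod B))
    (hglue : ∀ P, glue P = addClosure (P.1.map FA ⊔ P.2.map FB))
    (hinter : ∀ M, inter M = (M.inverseImage FA, M.inverseImage FB)) :
    (Set.BijOn glue (CT d A ×ˢ CT d B) {M | M ∈ CT d R ∧ M S} ∧
      Set.BijOn inter {M | M ∈ CT d R ∧ M S} (CT d A ×ˢ CT d B) ∧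
      Set.InvOn inter glue (CT d A ×ˢ CT d B) {M | M ∈ CT d R ∧ M S}) ∧
    (Set.BijOn glue (ZCT d A ×ˢ ZCT d B) {M | M ∈ ZCT d R ∧ M S} ∧
      Set.BijOn inter {M | M ∈ ZCT d R ∧ M S} (ZCT d A ×ˢ ZCT d B)) := by
  obtain rfl : glue = fun P => addClosure (P.1.map FA ⊔ P.2.map FB) := funext hglue
  obtain rfl : inter = fun M => (M.inverseImage FA, M.inverseImage FB) := funext hinter
  have hZA : ∀ {R : Type u} [Ring R] {P : ObjectProperty (RightMod R)}, P ∈ ZCT d R → P ∈ CT d R :=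
    fun h => ⟨h.1.toIsClusterTilting, h.2⟩
  have hinv : Set.InvOn (fun M : ObjectProperty (RightMod R) =>
      (M.inverseImage FA, M.inverseImage FB)) (fun P => addClosure (P.1.map FA ⊔ P.2.map FB))
      (CT d A ×ˢ CT d B) {M | M ∈ CT d R ∧ M S} :=
    ⟨fun P hP => Prod.ext (H.inverseImage_glue_A hP.1.1 hP.2.1)
      (H.inverseImage_glue_B hP.1.1 hP.2.1), fun M hM => H.glue_inverseImage hM.1.1⟩
  -- The two maps remain mutually inverse on the smaller sets; for the dℤ-version it only remains to
  -- see that each map preserves the condition on degrees.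
  have hinvZ := hinv.mono (s₁ := ZCT d A ×ˢ ZCT d B) (t₁ := {M | M ∈ ZCT d R ∧ M S})
    (Set.prod_mono (fun _ h => hZA h) fun _ h => hZA h) fun M hM => ⟨hZA hM.1, hM.2⟩
  have hg : Set.MapsTo (fun P => addClosure (P.1.map FA ⊔ P.2.map FB)) (CT d A ×ˢ CT d B)
      {M | M ∈ CT d R ∧ M S} := by
    rintro ⟨PA, PB⟩ ⟨⟨hPA, hPA'⟩, hPB, hPB'⟩
    obtain ⟨SA, ⟨eA⟩⟩ := H.bridge_A
    exact ⟨⟨H.isClusterTilting_glue hR hPA hPB hPA' hPB', hasAdditiveGenerator_glue hPA' hPB'⟩,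
      addClosure_of_iso eA.symm (le_addClosure _
        (Or.inl (PA.prop_map_obj FA (H.bridge_mem_A hPA eA))))⟩
  have hi : Set.MapsTo (fun M : ObjectProperty (RightMod R) =>
      (M.inverseImage FA, M.inverseImage FB)) {M | M ∈ CT d R ∧ M S} (CT d A ×ˢ CT d B) := by
    rintro M ⟨⟨hM, hM'⟩, hS⟩
    exact ⟨⟨H.isClusterTilting_inverseImage_A hA hM hM' hS,
      H.hasAdditiveGenerator_inverseImage_A hM hM' hS⟩,
      H.isClusterTilting_inverseImage_B hB hM hM' hS,
      H.hasAdditiveGenerator_inverseImage_B hM hM' hS⟩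
  have hgZ : Set.MapsTo (fun P => addClosure (P.1.map FA ⊔ P.2.map FB)) (ZCT d A ×ˢ ZCT d B)
      {M | M ∈ ZCT d R ∧ M S} := by
    rintro ⟨PA, PB⟩ ⟨hPA, hPB⟩
    obtain ⟨⟨h1, h2⟩, h3⟩ := hg (x := (PA, PB)) ⟨hZA hPA, hZA hPB⟩
    refine ⟨⟨⟨h1, ?_⟩, h2⟩, h3⟩
    exact H.extDegreesIn_glue_of_isClusterTilting (D := {i | d ∣ i}) hPA.1.toIsClusterTilting
      hPB.1.toIsClusterTilting (dvd_zero d) (fun p hp q hq => dvd_add hp hq)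
      hPA.1.dvd_of_nontrivial hPB.1.dvd_of_nontrivial
  have hiZ : Set.MapsTo (fun M : ObjectProperty (RightMod R) =>
      (M.inverseImage FA, M.inverseImage FB)) {M | M ∈ ZCT d R ∧ M S} (ZCT d A ×ˢ ZCT d B) := by
    rintro M ⟨hM, hS⟩
    obtain ⟨⟨h1, h2⟩, h3, h4⟩ := hi (x := M) ⟨hZA hM, hS⟩
    exact ⟨⟨⟨h1, H.extDegreesIn_inverseImage_A (D := {i | d ∣ i}) hM.1.dvd_of_nontrivial⟩, h2⟩,
      ⟨h3, H.extDegreesIn_inverseImage_B (D := {i | d ∣ i}) hM.1.dvd_of_nontrivial⟩, h4⟩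
  exact ⟨⟨hinv.bijOn hg hi, hinv.symm.bijOn hi hg, hinv⟩, hinvZ.bijOn hgZ hiZ,
    hinvZ.symm.bijOn hiZ hgZ⟩

end IsBridgeGluing

/-! ### Restriction of scalars along a surjective ring homomorphism. -/

section RestrictScalars

variable {L A : Type u} [Ring L] [Ring A] (p : L →+* A)

lemma restrictScalars_map_shortComplex_exact (S : ShortComplex (ModuleCat.{u} A)) (h : S.Exact) :
    (S.map (ModuleCat.restrictScalars.{u} p)).Exact := by
  rw [ShortComplex.ShortExact.moduleCat_exact_iff_function_exact] at h ⊢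
  exact h

instance preservesFiniteLimits_restrictScalars :
    PreservesFiniteLimits (ModuleCat.restrictScalars.{u} p) := by
  have := ((ModuleCat.restrictScalars.{u} p).exact_tfae.out 1 3).mp
    (restrictScalars_map_shortComplex_exact p)
  exact this.1

instance preservesFiniteColimits_restrictScalars :
    PreservesFiniteColimits (ModuleCat.restrictScalars.{u} p) := by
  have := ((ModuleCat.restrictScalars.{u} p).exact_tfae.out 1 3).mp
    (restrictScalars_map_shortComplex_exact p)
  exact this.2

variable {p} (hp : Function.Surjective p)
include hp

lemma full_restrictScalars : (ModuleCat.restrictScalars.{u} p).Full where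
  map_surjective {X Y} f := by
    refine ⟨ModuleCat.ofHom (X := X) (Y := Y)
      { toFun := fun x => f.hom x
        map_add' := fun x y => f.hom.map_add x y
        map_smul' := fun a x => ?_ }, rfl⟩
    obtain ⟨l, rfl⟩ := hp a
    exact f.hom.map_smul l x

lemma finite_restrictScalars_iff (X : ModuleCat.{u} A) :
    Module.Finite L ((ModuleCat.restrictScalars.{u} p).obj X) ↔ Module.Finite A X := by
  let φ : (ModuleCat.restrictScalars.{u} p).obj X →ₛₗ[p] X :=
    { toFun := fun x => x
      map_add' := fun _ _ => rfl
      map_smul' := fun _ _ => rfl }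
  constructor
  · intro h
    have : RingHomSurjective p := ⟨hp⟩
    exact Module.Finite.of_surjective φ fun x => ⟨x, rfl⟩
  · rintro ⟨⟨s, hs⟩⟩
    let t : Set ((ModuleCat.restrictScalars.{u} p).obj X) := {x | φ x ∈ s}
    refine Module.Finite.of_fg_top ((Submodule.fg_def).2 ⟨t, s.finite_toSet, eq_top_iff.2 ?_⟩)
    intro x _
    have hx : φ x ∈ Submodule.span A (s : Set X) := hs ▸ Submodule.mem_top
    have key : ∀ y ∈ Submodule.span A (s : Set X),
        ∀ x, φ x = y → x ∈ Submodule.span L t := by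
      intro y hy
      induction hy using Submodule.span_induction with
      | mem y h => rintro x rfl; exact Submodule.subset_span h
      | zero => rintro x rfl; exact Submodule.zero_mem _
      | add y z _ _ hy hz => rintro x rfl; exact Submodule.add_mem _ (hy _ rfl) (hz _ rfl)
      | smul a y _ hy =>
        rintro x rfl
        obtain ⟨l, rfl⟩ := hp a
        exact Submodule.smul_mem _ l (hy _ rfl)
    exact key _ hx x rfl

lemma exists_restrictScalars_iso (M : ModuleCat.{u} L) (h : ∀ x, p x = 0 → ∀ m : M, x • m = 0) :
    ∃ X, Nonempty ((ModuleCat.restrictScalars.{u} p).obj X ≅ M) := by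
  let φ : A →+* AddMonoid.End M := p.liftOfSurjective hp
    ⟨Module.toAddMonoidEnd L M, fun x hx => AddMonoidHom.ext fun m => h x hx m⟩
  have hφ : ∀ (x : L) (m : M), φ (p x) m = x • m := fun x m =>
    DFunLike.congr_fun (RingHom.liftOfRightInverse_comp_apply p _ _
      ⟨Module.toAddMonoidEnd L M, fun x hx => AddMonoidHom.ext fun m => h x hx m⟩ x) m
  let : Module A M := Module.compHom M φ
  let e : (ModuleCat.restrictScalars.{u} p).obj (ModuleCat.of A M) ≃ₗ[L] M :=
    { toFun := fun m => m
      invFun := fun m => m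
      left_inv := fun _ => rfl
      right_inv := fun _ => rfl
      map_add' := fun _ _ => rfl
      map_smul' := fun x m => hφ x m }
  exact ⟨ModuleCat.of A M, ⟨e.toModuleIso⟩⟩

/-- The coordinatewise multiplication by `p g` of a free module factors over the restriction along
`p` through a free module, if the kernel of `p` annihilates `g`. -/
lemma exists_factor_free (g : L) (hg : ∀ x, p x = 0 → x * g = 0) (X : Type u) :
    ∃ (i : (ModuleCat.restrictScalars.{u} p).obj (ModuleCat.of A (X →₀ A)) ⟶
        ModuleCat.of L (X →₀ L))
      (r : ModuleCat.of L (X →₀ L) ⟶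
        (ModuleCat.restrictScalars.{u} p).obj (ModuleCat.of A (X →₀ A))),
      ∀ f : X →₀ A, @Eq (X →₀ A) ((i ≫ r).hom f) (f.mapRange (· * p g) (zero_mul _)) := by
  -- The map p x ↦ x g is well defined because ker p annihilates g. It is `L`-linear, and following
  -- it by p gives right multiplication by p g.
  let σ : A →+ L := p.toAddMonoidHom.liftOfSurjective hp ⟨AddMonoidHom.mulRight g, fun x hx => hg x hx⟩
  have hσ : ∀ x, σ (p x) = x * g := fun x =>
    AddMonoidHom.liftOfRightInverse_comp_apply p.toAddMonoidHom _ _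
      ⟨AddMonoidHom.mulRight g, fun x hx => hg x hx⟩ x
  have hσ' : ∀ l a, σ (p l * a) = l * σ a := by
    intro l a
    obtain ⟨x, rfl⟩ := hp a
    rw [← map_mul, hσ, hσ, mul_assoc]
  refine ⟨ModuleCat.ofHom (X := (ModuleCat.restrictScalars.{u} p).obj (ModuleCat.of A (X →₀ A)))
      { toFun := fun f => Finsupp.mapRange.addMonoidHom σ f
        map_add' := fun f f' => map_add _ f f'
        map_smul' := fun l f => Finsupp.ext fun x => hσ' l _ },
    ModuleCat.ofHom (Y := (ModuleCat.restrictScalars.{u} p).obj (ModuleCat.of A (X →₀ A)))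
      { toFun := fun f => Finsupp.mapRange.addMonoidHom p.toAddMonoidHom f
        map_add' := fun f f' => map_add _ f f'
        map_smul' := fun l f => Finsupp.ext fun x => map_mul p l _ }, ?_⟩
  intro f
  refine Finsupp.ext fun x => ?_
  obtain ⟨l, hl⟩ := hp (f x)
  rw [Finsupp.mapRange_apply]
  change p (σ (f x)) = _
  rw [← hl, hσ, map_mul]

end RestrictScalars

/-! ### Gluing rings and the splitting of their modules. -/

/-- The ring-theoretic properties of the opposite ring of a sink-source gluing. -/
structure IsGluingRing (k : Type u) {L A B : Type u} [Field k] [Ring L] [Algebra k L] [Ring A]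
    [Ring B] (pA : L →+* A) (pB : L →+* B) (fA fB e : L) : Prop where
  sum_eq : fA + fB + e = 1
  fA_mul_fB : ∀ x, fA * x * fB = 0
  fB_mul_fA : ∀ x, fB * x * fA = 0
  e_mul_fA : ∀ x, e * x * fA = 0
  fB_mul_e : ∀ x, fB * x * e = 0
  corner : ∀ x, ∃ c : k, e * x * e = c • e
  surjective_A : Function.Surjective pA
  surjective_B : Function.Surjective pB
  map_A : pA fB = 0
  map_B : pB fA = 0
  eq_of_map_A : ∀ x, pA x = 0 → x * fB = x
  eq_of_map_B : ∀ x, pB x = 0 → fA * x = x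

namespace IsGluingRing

variable {k L A B : Type u} [Field k] [Ring L] [Algebra k L] [Ring A] [Ring B]
  {pA : L →+* A} {pB : L →+* B} {fA fB e : L} (H : IsGluingRing k pA pB fA fB e)

include H

section Modules

variable {M N P : Type u} [AddCommGroup M] [Module L M] [Module k M] [IsScalarTower k L M]
  [AddCommGroup N] [Module L N] [Module k N] [IsScalarTower k L N]
  [AddCommGroup P] [Module L P] [Module k P] [IsScalarTower k L P]

omit [Module k M] [IsScalarTower k L M] in
lemma smul_sum_eq (m : M) : fA • m + fB • m + e • m = m := by
  rw [← add_smul, ← add_smul, H.sum_eq, one_smul]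

lemma e_mul_e : e * e = e := by
  have h1 := H.fA_mul_fB 1
  have h2 := H.fB_mul_fA 1
  have h3 := H.e_mul_fA 1
  have h4 := H.fB_mul_e 1
  rw [mul_one] at h1 h2 h3 h4
  have hs := H.sum_eq
  have a1 : fB * fB = fB := by
    have := congrArg (fB * ·) hs
    simpa [mul_add, h2, h4] using this
  have a2 : e * fB = 0 := by
    have := congrArg (· * fB) hs
    simpa [add_mul, h1, a1] using this
  have := congrArg (e * ·) hs
  simpa [mul_add, h3, a2] using this

lemma fB_mul_fB : fB * fB = fB := by
  have h2 := H.fB_mul_fA 1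
  have h4 := H.fB_mul_e 1
  rw [mul_one] at h2 h4
  have := congrArg (fB * ·) H.sum_eq
  simpa [mul_add, h2, h4] using this

omit [Module k M] [IsScalarTower k L M] in
lemma e_smul_of_killed {m : M} (hA : fA • m = 0) (hB : fB • m = 0) : e • m = m := by
  simpa [hA, hB] using H.smul_sum_eq m

/-- On a module killed by fA and fB the element e acts as the identity, so x acts as e x e, a scalar
multiple of e. The scalar depends on x alone, so k-linear maps between such modules are
automatically `L`-linear. -/
lemma exists_smul_eq (x : L) : ∃ c : k, ∀ {M : Type u} [AddCommGroup M] [Module L M] [Module k M]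
    [IsScalarTower k L M], (∀ m : M, fA • m = 0) → (∀ m : M, fB • m = 0) →
      ∀ m : M, x • m = c • m := by
  obtain ⟨c, hc⟩ := H.corner x
  refine ⟨c, fun hA hB m => ?_⟩
  have h1 := H.e_smul_of_killed (hA m) (hB m)
  have h2 := H.e_smul_of_killed (hA (x • m)) (hB (x • m))
  rw [← h2]
  nth_rewrite 1 [← h1]
  rw [smul_smul, smul_smul, hc, smul_assoc, h1]

/-- A `k`-linear map between modules annihilated by `fA` and `fB` is linear. -/
def linearOfKilled (hA : ∀ m : M, fA • m = 0) (hB : ∀ m : M, fB • m = 0)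
    (hA' : ∀ m : N, fA • m = 0) (hB' : ∀ m : N, fB • m = 0) (f : M →ₗ[k] N) : M →ₗ[L] N where
  toFun := f
  map_add' := map_add f
  map_smul' x m := by
    obtain ⟨c, hc⟩ := H.exists_smul_eq x
    rw [RingHom.id_apply, hc hA hB, hc hA' hB', map_smul]

/-- A homomorphism from an `A`-module to a `B`-module extends to every `A`-module. -/
lemma exists_extension (i : M →ₗ[L] P) (hi : Function.Injective i) (φ : M →ₗ[L] N)
    (hM : ∀ m : M, fB • m = 0) (hP : ∀ m : P, fB • m = 0) (hN : ∀ m : N, fA • m = 0) :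
    ∃ ψ : P →ₗ[L] N, ψ ∘ₗ i = φ := by
  obtain ⟨s, hs⟩ := (i.restrictScalars k).exists_leftInverse_of_injective
    (LinearMap.ker_eq_bot.2 hi)
  let h : P →ₗ[k] N := φ.restrictScalars k ∘ₗ s
  have hh : ∀ m, h (i m) = φ m := fun m => congrArg φ (DFunLike.congr_fun hs m)
  -- The k-linear extension h need not be `L`-linear; compressing it by e on both sides makes it so.
  -- In P, e x q = c e q because e L fA = 0 and P has no fB-part; in N, x e n = c e n because fB L e
  -- = 0 and N has no fA-part. Here e x e = c e in both cases.
  refine ⟨{ toFun := fun q => e • h (e • q)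
            map_add' := fun q q' => by simp only [smul_add, map_add]
            map_smul' := fun x q => ?_ }, LinearMap.ext fun m => ?_⟩
  · obtain ⟨c, hc⟩ := H.corner x
    have h1 : e • x • q = c • e • q := by
      conv_lhs => rw [← H.smul_sum_eq q]
      rw [smul_add, smul_add, smul_add, smul_add, hP, smul_zero, smul_zero, add_zero,
        smul_smul, smul_smul, H.e_mul_fA, zero_smul, zero_add, smul_smul, smul_smul, hc,
        smul_assoc]
    have h2 : ∀ n : N, x • e • n = c • e • n := by
      intro n
      rw [← H.smul_sum_eq (x • e • n), hN, zero_add, smul_smul, smul_smul, H.fB_mul_e, zero_smul,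
        zero_add, smul_smul, smul_smul, hc, smul_assoc]
    rw [h1, map_smul, RingHom.id_apply, h2, smul_algebra_smul_comm]
  · change e • h (e • i m) = φ m
    rw [← LinearMap.map_smul i, hh, LinearMap.map_smul, smul_smul, H.e_mul_e]
    exact H.e_smul_of_killed (hN _) (by rw [← map_smul, hM, map_zero])

/-- Every module is the direct sum of an `A`-module and a `B`-module. -/
lemma exists_isCompl : ∃ X Y : Submodule L M, IsCompl X Y ∧ (∀ m ∈ X, fB • m = 0) ∧
    ∀ m ∈ Y, fA • m = 0 := by
  -- The largest submodule killed by fA. It contains fB M because fA L fB = 0.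
  let Y : Submodule L M :=
    { carrier := {m | ∀ x : L, fA • x • m = 0}
      add_mem' := fun {m n} hm hn x => by rw [smul_add, smul_add, hm, hn, add_zero]
      zero_mem' := fun x => by simp
      smul_mem' := fun y m hm x => by rw [smul_smul x y]; exact hm _ }
  let E : Submodule k M :=
    { carrier := {m | e • m = m}
      add_mem' := fun {m n} hm hn => by
        simp only [Set.mem_ofPred_eq] at *; rw [smul_add, hm, hn]
      zero_mem' := by simp
      smul_mem' := fun c m hm => by
        simp only [Set.mem_ofPred_eq] at *; rw [smul_algebra_smul_comm, hm] }
  -- By the modular law, intersecting this complement with E = e M gives a complement C of Y ∩ E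
  -- inside E.
  obtain ⟨D, hD⟩ := Submodule.exists_isCompl (Y.restrictScalars k ⊓ E)
  let C : Submodule k M := D ⊓ E
  have hC1 : ∀ m ∈ C, m ∈ Y → m = 0 := fun m hm hmY =>
    (Submodule.disjoint_def.1 hD.disjoint) m ⟨hmY, hm.2⟩ hm.1
  have hC2 : Y.restrictScalars k ⊓ E ⊔ C = E := by
    rw [← sup_inf_assoc_of_le _ inf_le_right, hD.sup_eq_top, top_inf_eq]
  have hfBE : ∀ m ∈ E, fB • m = 0 := by
    intro m hm
    have hm : e • m = m := hm
    have := H.fB_mul_e 1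
    rw [← hm, smul_smul, ← mul_one fB, this, zero_smul]
  -- This is fA M ⊕ C. Stability uses that e L e acts by scalars, so that any k-subspace C of e M
  -- will do.
  let X : Submodule L M :=
    { carrier := {m | fB • m = 0 ∧ e • m ∈ C}
      add_mem' := fun {m n} hm hn =>
        ⟨by rw [smul_add, hm.1, hn.1, add_zero], by rw [smul_add]; exact C.add_mem hm.2 hn.2⟩
      zero_mem' := ⟨smul_zero _, by rw [smul_zero]; exact C.zero_mem⟩
      smul_mem' := fun x m hm => by
        obtain ⟨c, hc⟩ := H.corner x
        have hm' := H.smul_sum_eq m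
        rw [hm.1, add_zero] at hm'
        constructor
        · rw [← hm', smul_add, smul_add, smul_smul, smul_smul, smul_smul, smul_smul,
            H.fB_mul_fA, H.fB_mul_e, zero_smul, add_zero]
        · rw [← hm', smul_add, smul_add, smul_smul, smul_smul, smul_smul, smul_smul,
            H.e_mul_fA, zero_smul, zero_add, hc, smul_assoc]
          exact C.smul_mem c hm.2 }
  refine ⟨X, Y, ⟨Submodule.disjoint_def.2 fun m hX hY => ?_, codisjoint_iff.2 (eq_top_iff.2
    fun m _ => ?_)⟩, fun m hm => hm.1, fun m hm => by simpa using hm 1⟩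
  · have h1 : e • m = m := H.e_smul_of_killed (by simpa using hY 1) hX.1
    exact hC1 m (h1 ▸ hX.2) hY
  · have hE : e • m ∈ E := show e • e • m = e • m by rw [smul_smul, H.e_mul_e]
    rw [← hC2] at hE
    obtain ⟨n, hn, c, hc, hnc⟩ := Submodule.mem_sup.1 hE
    rw [← H.smul_sum_eq m, ← hnc]
    have h2 := H.fB_mul_fA 1
    have h3 := H.e_mul_fA 1
    rw [mul_one] at h2 h3
    have m1 : fA • m ∈ X := ⟨by rw [smul_smul, h2, zero_smul], by
      rw [smul_smul, h3, zero_smul]; exact C.zero_mem⟩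
    have m2 : fB • m ∈ Y := fun x => by rw [smul_smul, smul_smul, H.fA_mul_fB, zero_smul]
    have m3 : c ∈ X := ⟨hfBE c hc.2, by
      have : e • c = c := hc.2
      rw [this]; exact hc⟩
    have : fA • m + fB • m + (n + c) = (fA • m + c) + (fB • m + n) := by abel
    rw [this]
    exact Submodule.add_mem_sup (X.add_mem m1 m3) (Y.add_mem m2 hn.1)

end Modules

end IsGluingRing

/-! ### Extension groups over a gluing ring. -/

/-- The presentation of a module as a quotient of the free module on its elements. -/
def freeCover {A : Type u} [Ring A] (X : ModuleCat.{u} A) : ShortComplex (ModuleCat.{u} A) :=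
  (Finsupp.linearCombination A (id : X → X)).shortComplexKer

lemma freeCover_shortExact {A : Type u} [Ring A] (X : ModuleCat.{u} A) :
    (freeCover X).ShortExact :=
  LinearMap.shortExact_shortComplexKer fun x => ⟨Finsupp.single x 1, by simp⟩

lemma extClass_comp_mk₀_eq_zero {C : Type*} [Category C] [Abelian C] [HasExt.{u} C]
    {S : ShortComplex C} (hS : S.ShortExact) {N : C} (φ : S.X₁ ⟶ N) (ψ : S.X₂ ⟶ N)
    (h : S.f ≫ ψ = φ) {n : ℕ} (hn : 1 + 0 = n) :
    hS.extClass.comp (Ext.mk₀ φ) hn = (0 : Ext.{u} S.X₃ N n) := by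
  rw [← h, ← Ext.mk₀_comp_mk₀, hS.extClass_comp_assoc]

namespace IsGluingRing

variable {k L A B : Type u} [Field k] [Ring L] [Algebra k L] [Ring A] [Ring B]
  {pA : L →+* A} {pB : L →+* B} {fA fB e : L} (H : IsGluingRing k pA pB fA fB e)

open scoped ModuleCat

include H

lemma killed_A (X : ModuleCat.{u} A) (m : (ModuleCat.restrictScalars.{u} pA).obj X) :
    fB • m = 0 := by
  change pA fB • (show X from m) = 0
  rw [H.map_A, zero_smul]

lemma killed_B (X : ModuleCat.{u} B) (m : (ModuleCat.restrictScalars.{u} pB).obj X) :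
    fA • m = 0 := by
  change pB fA • (show X from m) = 0
  rw [H.map_B, zero_smul]

/-- Converse of `killed_A`: every x in ker pA satisfies x = x fB, so a module killed by fB is killed
by the whole kernel. -/
lemma exists_iso_A {M : ModuleCat.{u} L} (hM : ∀ m : M, fB • m = 0) :
    ∃ X, Nonempty ((ModuleCat.restrictScalars.{u} pA).obj X ≅ M) :=
  exists_restrictScalars_iso H.surjective_A M fun x hx m => by
    rw [← H.eq_of_map_A x hx, mul_smul, hM, smul_zero]

lemma exists_iso_B {M : ModuleCat.{u} L} (hM : ∀ m : M, fA • m = 0) :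
    ∃ X, Nonempty ((ModuleCat.restrictScalars.{u} pB).obj X ≅ M) :=
  exists_restrictScalars_iso H.surjective_B M fun x hx m => by
    rw [← H.eq_of_map_B x hx, mul_smul, hM]

lemma exists_biprod_iso (M : ModuleCat.{u} L) :
    ∃ X Y, Nonempty (M ≅ (ModuleCat.restrictScalars.{u} pA).obj X ⊞
      (ModuleCat.restrictScalars.{u} pB).obj Y) := by
  obtain ⟨X, Y, hXY, hX, hY⟩ := H.exists_isCompl (M := M)
  obtain ⟨X', ⟨eX⟩⟩ := H.exists_iso_A (M := ModuleCat.of L X)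
    fun m => Subtype.ext (hX m m.2)
  obtain ⟨Y', ⟨eY⟩⟩ := H.exists_iso_B (M := ModuleCat.of L Y)
    fun m => Subtype.ext (hY m m.2)
  exact ⟨X', Y', ⟨(Submodule.prodEquivOfIsCompl X Y hXY).symm.toModuleIso ≪≫
    (ModuleCat.biprodIsoProd (ModuleCat.of L X) (ModuleCat.of L Y)).symm ≪≫
    biprod.mapIso eX.symm eY.symm⟩⟩

/-- The restriction of a free module along the first projection is projective. -/
lemma projective_free_A (X : Type u) :
    Projective ((ModuleCat.restrictScalars.{u} pA).obj (ModuleCat.of A (X →₀ A))) := by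
  -- The element 1 - fB is annihilated by ker pA and maps to 1 in A, so the free A-module is a
  -- retract of a free `L`-module.
  obtain ⟨i, r, hir⟩ := exists_factor_free H.surjective_A (1 - fB) (fun x hx => by
    rw [mul_sub, mul_one, H.eq_of_map_A x hx, sub_self]) X
  refine Retract.projective (Y := ModuleCat.of L (X →₀ L)) ⟨i, r, ?_⟩
  ext f
  refine (hir f).trans (Finsupp.ext fun x => ?_)
  change (show X →₀ A from f) x * pA (1 - fB) = (show X →₀ A from f) x
  rw [map_sub, map_one, H.map_A, sub_zero, mul_one]

lemma exists_extension_hom {M P N : ModuleCat.{u} L} (i : M ⟶ P) [Mono i] (φ : M ⟶ N)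
    (hM : ∀ m : M, fB • m = 0) (hP : ∀ m : P, fB • m = 0) (hN : ∀ m : N, fA • m = 0) :
    ∃ ψ : P ⟶ N, i ≫ ψ = φ := by
  obtain ⟨ψ, hψ⟩ := H.exists_extension i.hom ((ModuleCat.mono_iff_injective i).1 inferInstance)
    φ.hom hM hP hN
  exact ⟨ModuleCat.ofHom ψ, ModuleCat.hom_ext hψ⟩

/-- There are no extensions of `A`-modules by `B`-modules. -/
lemma subsingleton_ext_AB (X : ModuleCat.{u} A) (N : ModuleCat.{u} L) (hN : ∀ n : N, fA • n = 0)
    (i : ℕ) : Subsingleton (Ext.{u} ((ModuleCat.restrictScalars.{u} pA).obj X) N (i + 1)) := by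
  induction i generalizing X with
  | zero =>
    have hS := (freeCover_shortExact X).map_of_exact (ModuleCat.restrictScalars.{u} pA)
    have : Projective ((freeCover X).map (ModuleCat.restrictScalars.{u} pA)).X₂ :=
      H.projective_free_A X
    refine subsingleton_of_forall_eq 0 fun x => ?_
    obtain ⟨y, rfl⟩ := Ext.contravariant_sequence_exact₃ hS N x
      (Ext.eq_zero_of_projective _) (add_comm 1 0)
    obtain ⟨φ, rfl⟩ := (Ext.mk₀_bijective _ _).2 y
    have := hS.mono_f
    -- A class of degree one comes from a map from the kernel of the free cover to N. It extends to
    -- the free module, so the class is zero; higher degrees follow by dimension shifting.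
    obtain ⟨ψ, hψ⟩ := H.exists_extension_hom ((freeCover X).map
      (ModuleCat.restrictScalars.{u} pA)).f φ (H.killed_A _) (H.killed_A _) hN
    exact extClass_comp_mk₀_eq_zero hS φ ψ hψ (add_comm 1 0)
  | succ i ih =>
    have hS := (freeCover_shortExact X).map_of_exact (ModuleCat.restrictScalars.{u} pA)
    have : Projective ((freeCover X).map (ModuleCat.restrictScalars.{u} pA)).X₂ :=
      H.projective_free_A X
    refine subsingleton_of_forall_eq 0 fun x => ?_
    obtain ⟨y, rfl⟩ := Ext.contravariant_sequence_exact₃ hS N x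
      (Ext.eq_zero_of_projective _) (add_comm 1 (i + 1))
    have : y = 0 := (ih (freeCover X).X₁).elim _ _
    rw [this, Ext.comp_zero]
    rfl

lemma subsingleton_ext (M N : ModuleCat.{u} L) (hM : ∀ m : M, fB • m = 0)
    (hN : ∀ n : N, fA • n = 0) (i : ℕ) : Subsingleton (Ext.{u} M N (i + 1)) := by
  obtain ⟨X, ⟨eX⟩⟩ := H.exists_iso_A hM
  by_contra hc
  rw [not_subsingleton_iff_nontrivial] at hc
  exact not_subsingleton_iff_nontrivial.2
    (nontrivial_ext_of_retract_left (Retract.ofIso eX.symm) hc) (H.subsingleton_ext_AB X N hN i)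

/-- The restrictions of free modules along the second projection are acyclic for the restrictions
of all modules. -/
lemma subsingleton_ext_free_B (X : Type u) (N : ModuleCat.{u} L) (hN : ∀ n : N, fA • n = 0)
    (n : ℕ) : Subsingleton (Ext.{u}
      ((ModuleCat.restrictScalars.{u} pB).obj (ModuleCat.of B (X →₀ B))) N (n + 1)) := by
  -- Unlike for A, the composite `i ≫ r` is right multiplication by pB fB rather than the identity.
  -- The image T of the complementary endomorphism s is killed by fB, since fB L (1 - fB) = 0. So
  -- the free B-module is a summand of a free `L`-module plus an A-module T, and T has no higher
  -- extensions to B-modules.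
  obtain ⟨i, r, hir⟩ := exists_factor_free H.surjective_B fB (fun x hx => by
    rw [← H.eq_of_map_B x hx, H.fA_mul_fB]) X
  let Q := (ModuleCat.restrictScalars.{u} pB).obj (ModuleCat.of B (X →₀ B))
  let s : Q ⟶ Q := 𝟙 Q - i ≫ r
  let T := ModuleCat.of L (LinearMap.range s.hom)
  have hT : ∀ m : T, fB • m = 0 := by
    have key : ∀ f : X →₀ B, @Eq (X →₀ B) (fB • s.hom f) 0 := by
      intro f
      have h : @Eq (X →₀ B) (s.hom f) (f - f.mapRange (· * pB fB) (zero_mul _)) :=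
        congrArg (fun t : X →₀ B => f - t) (hir f)
      refine (congrArg (fun t : X →₀ B => pB fB • t) h).trans (Finsupp.ext fun x => ?_)
      rw [Finsupp.smul_apply, Finsupp.sub_apply, Finsupp.mapRange_apply, smul_eq_mul,
        Finsupp.zero_apply]
      obtain ⟨l, hl⟩ := H.surjective_B (f x)
      have h1 := H.fB_mul_fA l
      have h2 := H.fB_mul_e l
      have h3 : fB * l * (1 - fB) = 0 := by
        rw [← H.sum_eq, show fA + fB + e - fB = fA + e by abel, mul_add, h1, h2, add_zero]
      rw [← hl, ← map_mul, ← map_sub, ← map_mul, ← map_zero pB, ← h3]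
      congr 1
      noncomm_ring
    rintro ⟨_, ⟨f, rfl⟩⟩
    exact Subtype.ext (key f)
  let a : Q ⟶ T := ModuleCat.ofHom (X := Q) s.hom.rangeRestrict
  let b : T ⟶ Q := ModuleCat.ofHom (Y := Q) (LinearMap.range s.hom).subtype
  have hab : a ≫ b = s := rfl
  by_contra hc
  rw [not_subsingleton_iff_nontrivial] at hc
  obtain ⟨j, hj⟩ := exists_nontrivial_ext_of_sum_eq_id_left (ι := Bool)
    (Y := Bool.rec T (ModuleCat.of L (X →₀ L))) (Bool.rec a i) (Bool.rec b r)
    (by rw [Fintype.sum_bool]; change i ≫ r + a ≫ b = 𝟙 Q; rw [hab]; simp [s]) hc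
  rcases j with _ | _
  · exact not_subsingleton_iff_nontrivial.2 hj (H.subsingleton_ext T N hT hN n)
  · exact not_subsingleton_iff_nontrivial.2 hj
      (Ext.subsingleton_of_projective (ModuleCat.of L (X →₀ L)) N n)

lemma nontrivial_ext_A_iff (X X' : ModuleCat.{u} A) (n : ℕ) :
    Nontrivial (Ext.{u} ((ModuleCat.restrictScalars.{u} pA).obj X)
      ((ModuleCat.restrictScalars.{u} pA).obj X') n) ↔ Nontrivial (Ext.{u} X X' n) := by
  have := full_restrictScalars H.surjective_A
  refine (Equiv.ofBijective _ (mapExt_bijective_of_acyclic (ModuleCat.restrictScalars.{u} pA)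
    (fun X => ?_) X X' n)).nontrivial_congr.symm
  refine ⟨_, (freeCover X).g, ?_, (freeCover_shortExact X).epi_g, fun Y n => ?_⟩
  · exact inferInstanceAs (Projective (ModuleCat.of A (X →₀ A)))
  · have := H.projective_free_A X
    exact Ext.subsingleton_of_projective
      ((ModuleCat.restrictScalars.{u} pA).obj (ModuleCat.of A (X →₀ A))) _ n

lemma nontrivial_ext_B_iff (X X' : ModuleCat.{u} B) (n : ℕ) :
    Nontrivial (Ext.{u} ((ModuleCat.restrictScalars.{u} pB).obj X)
      ((ModuleCat.restrictScalars.{u} pB).obj X') n) ↔ Nontrivial (Ext.{u} X X' n) := by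
  have := full_restrictScalars H.surjective_B
  refine (Equiv.ofBijective _ (mapExt_bijective_of_acyclic (ModuleCat.restrictScalars.{u} pB)
    (fun X => ?_) X X' n)).nontrivial_congr.symm
  refine ⟨_, (freeCover X).g, ?_, (freeCover_shortExact X).epi_g, fun Y n => ?_⟩
  · exact inferInstanceAs (Projective (ModuleCat.of B (X →₀ B)))
  · exact H.subsingleton_ext_free_B X _ (H.killed_B Y) n

/-- A finitely generated module annihilated by `fA` and `fB` is a direct sum of copies of the
bridge. -/
lemma exists_sum_eq_id [Module.Finite k L] {S T : ModuleCat.{u} L} (hSA : ∀ m : S, fA • m = 0)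
    (hSB : ∀ m : S, fB • m = 0) (φ : S ≃ₗ[k] k) (hTA : ∀ m : T, fA • m = 0)
    (hTB : ∀ m : T, fB • m = 0) [Module.Finite L T] :
    ∃ (n : ℕ) (f : Fin n → (T ⟶ S)) (g : Fin n → (S ⟶ T)), ∑ i, f i ≫ g i = 𝟙 T := by
  have : Module.Finite k T := Module.Finite.trans L T
  let b := Module.finBasis k T
  refine ⟨_, fun i => ModuleCat.ofHom (H.linearOfKilled hTA hTB hSA hSB
      (φ.symm.toLinearMap ∘ₗ b.coord i)),
    fun i => ModuleCat.ofHom (H.linearOfKilled hSA hSB hTA hTB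
      ((LinearMap.toSpanSingleton k T (b i)) ∘ₗ φ.toLinearMap)), ?_⟩
  ext t
  rw [ModuleCat.hom_sum, LinearMap.sum_apply]
  refine Eq.trans (Finset.sum_congr rfl fun i _ => ?_) (b.sum_repr t)
  change φ (φ.symm (b.coord i t)) • b i = _
  rw [LinearEquiv.apply_symm_apply]
  rfl

end IsGluingRing

/-- A homomorphism between a module annihilated by `fA` and one annihilated by `fB` factors
through a module annihilated by both. -/
lemma exists_factor_of_killed {L : Type u} [Ring L] {fA fB : L} {M N : ModuleCat.{u} L} [Module.Finite L M] (f : M ⟶ N)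
    (h : (∀ m : M, fB • m = 0) ∧ (∀ m : N, fA • m = 0) ∨
      (∀ m : M, fA • m = 0) ∧ (∀ m : N, fB • m = 0)) :
    ∃ (T : ModuleCat.{u} L) (g : M ⟶ T) (g' : T ⟶ N), Module.Finite L T ∧
      (∀ m : T, fA • m = 0) ∧ (∀ m : T, fB • m = 0) ∧ g ≫ g' = f := by
  -- The image is a quotient of M and a submodule of N, so it inherits both annihilation conditions.
  refine ⟨ModuleCat.of L (LinearMap.range f.hom), ModuleCat.ofHom (X := M) f.hom.rangeRestrict,
    ModuleCat.ofHom (Y := N) (LinearMap.range f.hom).subtype,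
    inferInstanceAs (Module.Finite L (LinearMap.range f.hom)), ?_, ?_, rfl⟩
  · rintro ⟨_, ⟨m, rfl⟩⟩
    refine Subtype.ext ?_
    change fA • f.hom m = 0
    rcases h with h | h
    · exact h.2 _
    · rw [← map_smul, h.1, map_zero]
  · rintro ⟨_, ⟨m, rfl⟩⟩
    refine Subtype.ext ?_
    change fB • f.hom m = 0
    rcases h with h | h
    · rw [← map_smul, h.1, map_zero]
    · exact h.2 _

/-! ### Extensions of B-modules and A-modules through the bridge. -/

namespace IsGluingRing

variable {k L A B : Type u} [Field k] [Ring L] [Algebra k L] [Ring A] [Ring B]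
  {pA : L →+* A} {pB : L →+* B} {fA fB e : L} (H : IsGluingRing k pA pB fA fB e)

open scoped ModuleCat

include H

omit H in
/-- The projective left module `L fB`. -/
def leftIdealB (_ : IsGluingRing k pA pB fA fB e) : Submodule L L :=
  LinearMap.range (LinearMap.toSpanSingleton L L fB)

lemma mul_fB_of_mem {x : L} (hx : x ∈ H.leftIdealB) : x * fB = x := by
  obtain ⟨y, rfl⟩ := hx
  simp [mul_assoc, H.fB_mul_fB]

lemma projective_leftIdealB : Module.Projective L H.leftIdealB :=
  Module.Projective.of_split H.leftIdealB.subtype (LinearMap.toSpanSingleton L L fB).rangeRestrict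
    (LinearMap.ext fun x => Subtype.ext (H.mul_fB_of_mem x.2))

lemma projective_finsupp_leftIdealB (n : ℕ) :
    Projective (ModuleCat.of L (Fin n →₀ H.leftIdealB)) := by
  have := H.projective_leftIdealB
  have : Module.Projective L (Fin n →₀ H.leftIdealB) :=
    have : Module.Projective L (Π₀ _ : Fin n, H.leftIdealB) := inferInstance
    haveI : DecidableEq H.leftIdealB := Classical.decEq _
    .of_equiv (finsuppLequivDFinsupp L).symm
  exact (IsProjective.iff_projective _).1 this

/-- A homomorphism from L fB to N is determined by the image of fB, which lies in fB N = 0. -/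
lemma eq_zero_of_killed {n : ℕ} {N : ModuleCat.{u} L} (hN : ∀ m : N, fB • m = 0)
    (φ : ModuleCat.of L (Fin n →₀ H.leftIdealB) ⟶ N) : φ = 0 := by
  refine ModuleCat.hom_ext (Finsupp.lhom_ext fun j x => ?_)
  have hfB : fB ∈ H.leftIdealB := ⟨1, by simp⟩
  have h : Finsupp.single j x = (x : L) • fB • Finsupp.single j (⟨fB, hfB⟩ : H.leftIdealB) := by
    rw [Finsupp.smul_single, Finsupp.smul_single]
    congr 1
    refine Subtype.ext ?_
    change (x : L) = x * (fB * fB)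
    rw [H.fB_mul_fB, H.mul_fB_of_mem x.2]
  rw [h, map_smul, map_smul, hN, smul_zero]
  rfl

lemma subsingleton_ext_leftIdealB {n : ℕ} {N : ModuleCat.{u} L} (hN : ∀ m : N, fB • m = 0) (i : ℕ) :
    Subsingleton (Ext.{u} (ModuleCat.of L (Fin n →₀ H.leftIdealB)) N i) := by
  have := H.projective_finsupp_leftIdealB n
  cases i with
  | zero =>
    refine subsingleton_of_forall_eq 0 fun x => ?_
    obtain ⟨φ, rfl⟩ := (Ext.mk₀_bijective _ _).2 x
    rw [H.eq_zero_of_killed hN φ, Ext.mk₀_zero]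
  | succ i => exact Ext.subsingleton_of_projective _ N i

/-- A presentation of a `B`-module: up to a quotient that is a sum of copies of the bridge, it is
a quotient of a projective module without nonzero maps to `A`-modules. -/
lemma exists_presentation [Module.Finite k L] (M : ModuleCat.{u} L) [Module.Finite L M]
    (hM : ∀ m : M, fA • m = 0) :
    ∃ S₁ S₂ : ShortComplex (ModuleCat.{u} L), S₁.ShortExact ∧ S₂.ShortExact ∧ S₁.X₂ = M ∧
      S₂.X₃ = S₁.X₁ ∧ (∃ n : ℕ, S₂.X₂ = ModuleCat.of L (Fin n →₀ H.leftIdealB)) ∧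
      Module.Finite L S₁.X₃ ∧ (∀ m : S₁.X₃, fA • m = 0) ∧ (∀ m : S₁.X₃, fB • m = 0) ∧
      Module.Finite L S₂.X₁ ∧ (∀ m : S₂.X₁, fA • m = 0) := by
  have : IsNoetherianRing L := .of_finite k L
  have : Module.Finite k M := Module.Finite.trans L M
  let b := Module.finBasis k M
  -- The generator fB of the j-th copy goes to fB b_j, so the image contains fB M. The cokernel is
  -- then killed by fB as well as by fA.
  let π : (Fin (Module.finrank k M) →₀ H.leftIdealB) →ₗ[L] M :=
    Finsupp.lsum ℕ fun j => LinearMap.toSpanSingleton L M (b j) ∘ₗ H.leftIdealB.subtype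
  have hπ : ∀ m : M, fB • m ∈ LinearMap.range π := by
    intro m
    rw [← b.sum_repr m, Finset.smul_sum]
    refine Submodule.sum_mem _ fun j _ => ?_
    rw [smul_algebra_smul_comm]
    exact Submodule.smul_of_tower_mem _ _
      ⟨Finsupp.single j ⟨fB, 1, by simp⟩, by simp [π]⟩
  have hfin : Module.Finite L (Fin (Module.finrank k M) →₀ H.leftIdealB) := inferInstance
  refine ⟨{ X₁ := ModuleCat.of L (LinearMap.range π), X₂ := M,
            X₃ := ModuleCat.of L (M ⧸ LinearMap.range π)
            f := ModuleCat.ofHom (Y := M) (LinearMap.range π).subtype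
            g := ModuleCat.ofHom (X := M) (LinearMap.range π).mkQ
            zero := ?_ }, π.rangeRestrict.shortComplexKer, ?_,
    LinearMap.shortExact_shortComplexKer π.surjective_rangeRestrict, rfl, rfl, ⟨_, rfl⟩,
    ?_, ?_, ?_, ?_, ?_⟩
  · ext m
    exact (Submodule.Quotient.mk_eq_zero _).2 m.2
  · refine ModuleCat.shortComplex_shortExact _ ?_ (Submodule.injective_subtype _)
      (Submodule.mkQ_surjective _)
    exact LinearMap.exact_subtype_mkQ _
  · exact inferInstanceAs (Module.Finite L (M ⧸ LinearMap.range π))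
  · intro m
    obtain ⟨m, rfl⟩ := Submodule.mkQ_surjective _ m
    exact (map_smul (LinearMap.range π).mkQ fA m).symm.trans (by rw [hM, map_zero])
  · intro m
    obtain ⟨m, rfl⟩ := Submodule.mkQ_surjective _ m
    exact (map_smul (LinearMap.range π).mkQ fB m).symm.trans
      ((Submodule.Quotient.mk_eq_zero _).2 (hπ m))
  · exact inferInstanceAs (Module.Finite L (LinearMap.ker π.rangeRestrict))
  · rintro ⟨m, hm⟩
    refine Subtype.ext (Finsupp.ext fun j => Subtype.ext ?_)
    change fA * (m j : L) = 0
    rw [← H.mul_fB_of_mem (m j).2, ← mul_assoc, H.fA_mul_fB]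

/-- The extensions of `B`-modules by `A`-modules come from extensions by and of the bridge. -/
lemma exists_nontrivial_ext [Module.Finite k L] {S N : ModuleCat.{u} L}
    (hSA : ∀ m : S, fA • m = 0) (hSB : ∀ m : S, fB • m = 0) (φ : S ≃ₗ[k] k)
    (hN : ∀ m : N, fB • m = 0) (i : ℕ) (M : ModuleCat.{u} L) [Module.Finite L M]
    (hM : ∀ m : M, fA • m = 0) (hi : Nontrivial (Ext.{u} M N i)) :
    ∃ p q, p + q = i ∧ Nontrivial (Ext.{u} M S p) ∧ Nontrivial (Ext.{u} S N q) := by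
  induction i using Nat.strong_induction_on generalizing M with
  | _ i ih =>
  obtain ⟨S₁, S₂, h₁, h₂, rfl, h12, ⟨n, hn⟩, hT, hTA, hTB, hK, hKA⟩ := H.exists_presentation M hM
  have hP : ∀ N' : ModuleCat.{u} L, (∀ m : N', fB • m = 0) → ∀ j,
      Subsingleton (Ext.{u} S₂.X₂ N' j) := fun N' hN' j =>
    hn ▸ H.subsingleton_ext_leftIdealB hN' j
  -- Let T be the quotient `S₁.X₃` of M, a sum of copies of S. If Ext^i(T, N) ≠ 0, then Ext^i(S, N)
  -- ≠ 0, and T ≠ 0 gives a nonzero map M → S; so p = 0 and q = i.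
  by_cases hTi : Nontrivial (Ext.{u} S₁.X₃ N i)
  · obtain ⟨m, f, g, hfg⟩ := H.exists_sum_eq_id hSA hSB φ hTA hTB
    refine ⟨0, i, zero_add i, ?_, (exists_nontrivial_ext_of_sum_eq_id_left f g hfg hTi).choose_spec⟩
    by_contra hc
    rw [not_nontrivial_iff_subsingleton] at hc
    have := h₁.epi_g
    have hf : ∀ j, f j = 0 := fun j => by
      rw [← cancel_epi S₁.g, comp_zero, ← Ext.mk₀_eq_zero_iff]
      exact Subsingleton.elim _ _
    have hid : 𝟙 S₁.X₃ = 0 := by rw [← hfg]; simp [hf]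
    obtain ⟨x, hx⟩ := exists_ne (0 : Ext.{u} S₁.X₃ N i)
    exact hx (by rw [← Ext.mk₀_id_comp x, hid, Ext.mk₀_zero, Ext.zero_comp])
  · rw [not_nontrivial_iff_subsingleton] at hTi
    -- Otherwise Ext^i(M, N) embeds in Ext^i of the image `S₁.X₁`.
    obtain ⟨x, hx⟩ := exists_ne (0 : Ext.{u} S₁.X₂ N i)
    have hx' : (Ext.mk₀ S₁.f).comp x (zero_add i) ≠ 0 := by
      intro h0
      obtain ⟨y, rfl⟩ := Ext.contravariant_sequence_exact₂ h₁ N x h0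
      exact hx (by rw [Subsingleton.elim y 0, Ext.comp_zero])
    obtain ⟨z, hz⟩ : ∃ z : Ext.{u} S₂.X₃ N i, z ≠ 0 := by
      rw [h12]; exact ⟨_, hx'⟩
    have := hP N hN i
    cases i with
    | zero =>
      obtain ⟨ψ, rfl⟩ := (Ext.mk₀_bijective _ _).2 z
      refine (hz ?_).elim
      have := h₂.epi_g
      rw [Ext.mk₀_eq_zero_iff, ← cancel_epi S₂.g, comp_zero, ← Ext.mk₀_eq_zero_iff]
      exact Subsingleton.elim _ _
    | succ j =>
      -- Ext from the projective `S₂.X₂` to any A-module vanishes in all degrees, including 0. This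
      -- lowers the degree by one and replaces M by the kernel `S₂.X₁`, again a B-module.
      obtain ⟨w, rfl⟩ := Ext.contravariant_sequence_exact₃ h₂ N z (Subsingleton.elim _ _)
        (add_comm 1 j)
      have hw : w ≠ 0 := fun hw => hz (by rw [hw, Ext.comp_zero])
      obtain ⟨p, q, rfl, hp, hq⟩ := ih j (Nat.lt_succ_self j) S₂.X₁ hKA ⟨w, 0, hw⟩
      refine ⟨p + 1, q, by omega, ?_, hq⟩
      obtain ⟨v, hv⟩ := exists_ne (0 : Ext.{u} S₂.X₁ S p)
      -- Back up in the first argument: S is itself an A-module, so the connecting map Ext^p(kernel,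
      -- S) → Ext^(p+1)(image, S) is injective.
      have hv' : h₂.extClass.comp v (add_comm 1 p) ≠ 0 := by
        intro h0
        obtain ⟨t, rfl⟩ := Ext.contravariant_sequence_exact₁ h₂ S v (add_comm 1 p) h0
        have := hP S hSB p
        exact hv (by rw [Subsingleton.elim t 0, Ext.comp_zero])
      obtain ⟨r, hr⟩ : ∃ r : Ext.{u} S₁.X₁ S (p + 1), r ≠ 0 := by
        rw [← h12]; exact ⟨_, hv'⟩
      -- Now T is viewed as an A-module and S as a B-module: the obstruction in Ext^(p+2)(T, S) to
      -- lifting the class to M vanishes.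
      have := H.subsingleton_ext S₁.X₃ S hTB hSA (p + 1)
      obtain ⟨t, rfl⟩ := Ext.contravariant_sequence_exact₁ h₁ S r (add_comm 1 (p + 1))
        (Subsingleton.elim _ _)
      exact ⟨t, 0, fun ht => hr (by rw [ht, Ext.comp_zero])⟩

end IsGluingRing

/-! ### Passage to right modules. -/

section Right

variable {k R A B : Type u} [Field k] [Ring R] [Algebra k R] [Ring A] [Ring B]
  {pA : R →+* A} {pB : R →+* B} {fA fB e : Rᵐᵒᵖ}

open scoped ModuleCat

lemma addClosure_singleton_of_killed (H : IsGluingRing k pA.op pB.op fA fB e)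
    [Module.Finite k Rᵐᵒᵖ] {S T : RightMod R} (hSA : ∀ m : S, fA • m = 0)
    (hSB : ∀ m : S, fB • m = 0) (φ : S ≃ₗ[k] k) (hTA : ∀ m : T, fA • m = 0)
    (hTB : ∀ m : T, fB • m = 0) [Module.Finite Rᵐᵒᵖ T] :
    addClosure (ObjectProperty.singleton S) T := by
  obtain ⟨n, f, g, hfg⟩ := H.exists_sum_eq_id hSA hSB φ hTA hTB
  exact addClosure_of_sum_eq_id (fun _ => S) (fun _ => (ObjectProperty.singleton_iff _ _).2 rfl)
    f g hfg

lemma IsGluingRing.isBridgeGluing (H : IsGluingRing k pA.op pB.op fA fB e)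
    [Module.Finite k Rᵐᵒᵖ] {S : RightMod R} (hSA : ∀ m : S, fA • m = 0)
    (hSB : ∀ m : S, fB • m = 0) (φ : S ≃ₗ[k] k) :
    IsBridgeGluing (restrictRight pA) (restrictRight pB) S where
  finite_A := finite_restrictScalars_iff H.surjective_A
  finite_B := finite_restrictScalars_iff H.surjective_B
  ext_A := H.nontrivial_ext_A_iff
  ext_B := H.nontrivial_ext_B_iff
  ext_AB X Y i hi := by
    obtain ⟨i, rfl⟩ := Nat.exists_eq_succ_of_ne_zero hi.ne'
    exact H.subsingleton_ext_AB X _ (H.killed_B Y) i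
  ext_BA X Y i hY hi := H.exists_nontrivial_ext hSA hSB φ (H.killed_A X) i _ (H.killed_B Y) hi
  decomp := H.exists_biprod_iso
  bridge_A := H.exists_iso_A hSB
  bridge_B := H.exists_iso_B hSA
  finite_bridge :=
    have : Module.Finite k S := Module.Finite.equiv φ.symm
    Module.Finite.of_restrictScalars_finite k Rᵐᵒᵖ S
  factor_AB X Y f hX := by
    obtain ⟨T, g, h, hT, hTA, hTB, hgh⟩ := exists_factor_of_killed f (.inl ⟨H.killed_A X, H.killed_B Y⟩)
    exact ⟨T, g, h, addClosure_singleton_of_killed H hSA hSB φ hTA hTB, hgh⟩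
  factor_BA Y X f hY := by
    obtain ⟨T, g, h, hT, hTA, hTB, hgh⟩ := exists_factor_of_killed f (.inr ⟨H.killed_B Y, H.killed_A X⟩)
    exact ⟨T, g, h, addClosure_singleton_of_killed H hSA hSB φ hTA hTB, hgh⟩

end Right

open PathAlgebra

/-! ### Maps of path algebras induced by subquivers. -/

section MapLin

variable {k V W : Type u} [Field k] [Quiver.{u} V] [Fintype V] [Quiver.{u} W] [Fintype W]

lemma arrow_mul_path {i j l : V} (p : Quiver.Path i j) (f : j ⟶ l) :
    (arrow f * path p : PathAlgebra k V) = path (p.cons f) := by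
  rw [arrow, path_mul_path]; rfl

lemma lift_arrow {R : Type u} [Ring R] [Algebra k R] {E : V → R} {F : ∀ ⦃i j : V⦄, (i ⟶ j) → R}
    (h : IsRep E F) {i j : V} (f : i ⟶ j) : lift (k := k) E F h (arrow f) = F f := by
  rw [arrow, lift_path, Quiver.Hom.toPath, pathVal, pathVal, h.src]

/-- Injectivity on vertices ensures that paths which cannot be composed stay so after mapping;
without it products equal to zero could become nonzero. -/
lemma mapLin_mul {φ : V ⥤q W} (hφ : Function.Injective φ.obj) (x y : PathAlgebra k V) :
    mapLin φ (x * y) = mapLin φ x * mapLin φ y := by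
  induction x using PathAlgebra.induction_linear with
  | zero => simp
  | add x x' hx hx' => simp only [add_mul, map_add, hx, hx']
  | smul c x hx => simp only [smul_mul_assoc, map_smul, hx]
  | @path j' l q =>
  induction y using PathAlgebra.induction_linear with
  | zero => simp
  | add y y' hy hy' => simp only [mul_add, map_add, hy, hy']
  | smul c y hy => simp only [mul_smul_comm, map_smul, hy]
  | @path i j p =>
  by_cases h : j = j'
  · subst h
    rw [path_mul_path, mapLin_path, mapLin_path, mapLin_path, path_mul_path,
      Prefunctor.mapPath_comp]
  · rw [path_mul_path_of_ne _ _ h, map_zero, mapLin_path, mapLin_path,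
      path_mul_path_of_ne _ _ (hφ.ne h)]

lemma mapLin_arrow (φ : V ⥤q W) {i j : V} (f : i ⟶ j) :
    mapLin (k := k) φ (arrow f) = arrow (φ.map f) := by
  rw [arrow, mapLin_path, Prefunctor.mapPath_toPath]; rfl

lemma arrow_mul_mapLin_eq_zero (φ : V ⥤q W) {i j : W} (f : i ⟶ j) (h : ∀ v, φ.obj v ≠ i)
    (x : PathAlgebra k V) : arrow f * mapLin φ x = 0 := by
  induction x using PathAlgebra.induction_linear with
  | zero => simp
  | add x y hx hy => rw [map_add, mul_add, hx, hy, add_zero]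
  | smul c x hx => rw [map_smul, mul_smul_comm, hx, smul_zero]
  | path p => rw [mapLin_path, arrow, path_mul_path_of_ne _ _ (h _)]

lemma mapLin_mul_arrow_eq_zero (φ : V ⥤q W) {i j : W} (f : i ⟶ j) (h : ∀ v, φ.obj v ≠ j)
    (x : PathAlgebra k V) : mapLin φ x * arrow f = 0 := by
  induction x using PathAlgebra.induction_linear with
  | zero => simp
  | add x y hx hy => rw [map_add, add_mul, hx, hy, add_zero]
  | smul c x hx => rw [map_smul, smul_mul_assoc, hx, smul_zero]
  | path p => rw [mapLin_path, arrow, path_mul_path_of_ne _ _ (h _).symm]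

lemma vertex_mul_mapLin_one (φ : V ⥤q W) (hφ : Function.Injective φ.obj) {ρ : W → Option V}
    (h1 : ∀ i, ρ (φ.obj i) = some i) (h2 : ∀ {w i}, ρ w = some i → φ.obj i = w) (w : W) :
    vertex w * mapLin (k := k) φ 1 = mapLin φ (optVertex (ρ w)) ∧
      mapLin (k := k) φ 1 * vertex w = mapLin φ (optVertex (ρ w)) := by
  cases h : ρ w with
  | some i =>
    have hw : (vertex w : PathAlgebra k W) = mapLin φ (vertex i) := by
      rw [← h2 h, vertex, vertex, mapLin_path]; rfl
    rw [hw, optVertex, ← mapLin_mul hφ, ← mapLin_mul hφ, one_mul, mul_one]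
    exact ⟨rfl, rfl⟩
  | none =>
    have hne : ∀ i, φ.obj i ≠ w := by
      rintro i rfl
      simp [h1] at h
    rw [one_def, map_sum, Finset.mul_sum, Finset.sum_mul, optVertex, map_zero]
    constructor <;> refine Finset.sum_eq_zero fun i _ => ?_ <;>
      rw [vertex, vertex, mapLin_path]
    · exact path_mul_path_of_ne _ _ (hne i)
    · exact path_mul_path_of_ne _ _ (hne i).symm

end MapLin

/-! ### The gluing of bound quivers is a gluing ring. -/

section Glue

variable {k VA VB : Type u} [Field k] [Quiver.{u} VA] [Quiver.{u} VB] [Fintype VA] [Fintype VB]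
  (a : VA) (b : VB)

lemma inclA_obj_injective : Function.Injective (inclA a b).obj := fun _ _ h =>
  Option.some_injective _ (congrArg (GlueVertex.toA a b) h)

lemma inclB_obj_injective : Function.Injective (inclB a b).obj := fun _ _ h =>
  Option.some_injective _ (congrArg (GlueVertex.toB a b) h)

variable {a b}

lemma eq_of_inA_eq_inB {i : VA} {j : VB} (h : GlueVertex.inA a b i = GlueVertex.inB a b j) :
    i = a ∧ j = b := by
  constructor
  · by_contra hi
    have := congrArg (GlueVertex.toB a b) h
    rw [GlueVertex.toB_inA_of_ne _ _ hi, GlueVertex.toB_inB] at this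
    simp at this
  · by_contra hj
    have := congrArg (GlueVertex.toA a b) h
    rw [GlueVertex.toA_inB_of_ne _ _ hj, GlueVertex.toA_inA] at this
    simp at this

/-- Paths that start in the second quiver stay in it. -/
lemma mul_idemB (ha : IsSink a) (x : PathAlgebra k (GlueVertex a b)) :
    x * idemB k a b = mapLin (inclB a b) (pathToB a b x) := by
  rw [← mapLin_inclB_one]
  induction x using PathAlgebra.induction_linear with
  | zero => simp
  | add x y hx hy => rw [add_mul, map_add, map_add, hx, hy]
  | smul c x hx => rw [smul_mul_assoc, map_smul, map_smul, hx]
  | path p =>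
    induction p with
    | nil =>
      rw [pathToB, lift_path, pathVal]
      exact (vertex_mul_mapLin_one (inclB a b) (inclB_obj_injective a b) (GlueVertex.toB_inB a b)
        GlueVertex.inB_of_toB _).1
    | cons p f ih =>
      rw [← arrow_mul_path, mul_assoc, ih, map_mul]
      have hf : pathToB a b (arrow f) = arrowToB (k := k) a b f := lift_arrow _ f
      rw [hf]
      rcases f with f | f
      -- An arrow of the first quiver that starts at a vertex of the second would start at a, which
      -- is a sink.
      · rw [arrowToB, zero_mul, map_zero]
        refine arrow_mul_mapLin_eq_zero _ _ (fun j hj => ?_) _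
        obtain ⟨rfl, -⟩ := eq_of_inA_eq_inB hj.symm
        exact (ha _).false f
      · rw [arrowToB, mapLin_mul (inclB_obj_injective a b), mapLin_arrow]
        rfl

/-- Paths that end in the first quiver stay in it. -/
lemma idemA_mul (hb : IsSource b) (x : PathAlgebra k (GlueVertex a b)) :
    idemA k a b * x = mapLin (inclA a b) (pathToA a b x) := by
  rw [← mapLin_inclA_one]
  induction x using PathAlgebra.induction_linear with
  | zero => simp
  | add x y hx hy => rw [mul_add, map_add, map_add, hx, hy]
  | smul c x hx => rw [mul_smul_comm, map_smul, map_smul, hx]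
  | path p =>
    induction p with
    | nil =>
      rw [pathToA, lift_path, pathVal]
      exact (vertex_mul_mapLin_one (inclA a b) (inclA_obj_injective a b) (GlueVertex.toA_inA a b)
        GlueVertex.inA_of_toA _).2
    | cons p f ih =>
      rw [← arrow_mul_path, map_mul]
      have hf : pathToA a b (arrow f) = arrowToA (k := k) a b f := lift_arrow _ f
      rw [hf, ← mul_assoc]
      rcases f with f | f
      · have h : arrow (k := k) (GlueHom.ofA f : GlueVertex.inA a b _ ⟶ GlueVertex.inA a b _) =
            mapLin (inclA a b) (arrow f) := (mapLin_arrow (inclA a b) f).symm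
        rw [arrowToA, mapLin_mul (inclA_obj_injective a b), ← ih, ← mul_assoc, h,
          ← mapLin_mul (inclA_obj_injective a b), ← mapLin_mul (inclA_obj_injective a b), one_mul,
          mul_one]
      -- An arrow of the second quiver that ends at a vertex of the first would end at b, which is a
      -- source.
      · rw [arrowToA, zero_mul, map_zero, mapLin_mul_arrow_eq_zero, zero_mul]
        intro j hj
        obtain ⟨-, rfl⟩ := eq_of_inA_eq_inB hj
        exact (hb _).false f

lemma mapLin_inclB_vertex : mapLin (k := k) (inclB a b) (vertex b) =
    vertex (GlueVertex.inA a b a) := by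
  rw [GlueVertex.inA_eq_inB]; exact mapLin_path _ _

lemma idemA_mul_idemB (ha : IsSink a) :
    idemA k a b * idemB k a b = vertex (GlueVertex.inA a b a) := by
  rw [mul_idemB ha, ← mapLin_inclA_one, pathToB_mapLin_inclA, map_one, one_smul,
    mapLin_inclB_vertex]

lemma idemB_mul_mapLin (x : PathAlgebra k VB) :
    idemB k a b * mapLin (inclB a b) x = mapLin (inclB a b) x := by
  rw [← mapLin_inclB_one, ← mapLin_mul (inclB_obj_injective a b), one_mul]

lemma mapLin_mul_idemA (x : PathAlgebra k VA) :
    mapLin (inclA a b) x * idemA k a b = mapLin (inclA a b) x := by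
  rw [← mapLin_inclA_one, ← mapLin_mul (inclA_obj_injective a b), mul_one]

/-- A path from the common vertex to itself stays in the second quiver because a is a sink, and is
trivial there because b is a source. -/
lemma vertex_mul_mul_vertex (ha : IsSink a) (hb : IsSource b)
    (x : PathAlgebra k (GlueVertex a b)) :
    vertex (GlueVertex.inA a b a) * x * vertex (GlueVertex.inA a b a) =
      aug b (pathToB a b x) • vertex (GlueVertex.inA a b a) := by
  rw [← mapLin_inclB_vertex, ← idemB_mul_mapLin (vertex b), idemB_mul_mapLin, mul_assoc,
    ← idemB_mul_mapLin (vertex b), ← mul_assoc x, mul_idemB ha, idemB_mul_mapLin,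
    ← mapLin_mul (inclB_obj_injective a b), ← mapLin_mul (inclB_obj_injective a b), ← mul_assoc,
    vertex_mul_of_isSource hb, smul_mul_assoc, vertex_mul_self, map_smul]

variable {RA : TwoSidedIdeal (PathAlgebra k VA)} {RB : TwoSidedIdeal (PathAlgebra k VB)}

lemma mapLin_inclA_mem {x : PathAlgebra k VA} (hx : x ∈ RA) :
    mapLin (inclA a b) x ∈ glueRelations a b RA RB :=
  TwoSidedIdeal.subset_span (.inl (.inl ⟨x, hx, rfl⟩))

lemma mapLin_inclB_mem {x : PathAlgebra k VB} (hx : x ∈ RB) :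
    mapLin (inclB a b) x ∈ glueRelations a b RA RB :=
  TwoSidedIdeal.subset_span (.inl (.inr ⟨x, hx, rfl⟩))

lemma one_sub_idemA_mul_mem (x : PathAlgebra k (GlueVertex a b)) :
    (1 - idemA k a b) * x * (1 - idemB k a b) ∈ glueRelations a b RA RB :=
  TwoSidedIdeal.subset_span (.inr ⟨x, rfl⟩)

/-- The class of an element of the path algebra in the gluing. -/
abbrev toGluing (a : VA) (b : VB) (RA : TwoSidedIdeal (PathAlgebra k VA))
    (RB : TwoSidedIdeal (PathAlgebra k VB)) :
    PathAlgebra k (GlueVertex a b) →+* Gluing a b RA RB :=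
  Ideal.Quotient.mk (glueRelations a b RA RB).asIdeal

lemma toGluing_surjective : Function.Surjective (toGluing a b RA RB) :=
  Ideal.Quotient.mk_surjective

lemma toGluing_eq_zero {x : PathAlgebra k (GlueVertex a b)} (hx : x ∈ glueRelations a b RA RB) :
    toGluing a b RA RB x = 0 :=
  Ideal.Quotient.eq_zero_iff_mem.2 hx

lemma toGluing_smul (c : k) (x : PathAlgebra k (GlueVertex a b)) :
    toGluing a b RA RB (c • x) = c • toGluing a b RA RB x := rfl

lemma projA_toGluing (hb : IsSource b) (hRB : vertex b ∉ RB)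
    (x : PathAlgebra k (GlueVertex a b)) : projA a b RA RB hb hRB (toGluing a b RA RB x) =
      Ideal.Quotient.mk RA.asIdeal (pathToA a b x) := rfl

lemma projB_toGluing (ha : IsSink a) (hRA : vertex a ∉ RA)
    (x : PathAlgebra k (GlueVertex a b)) : projB a b RA RB ha hRA (toGluing a b RA RB x) =
      Ideal.Quotient.mk RB.asIdeal (pathToB a b x) := rfl

/-- By `idemA_mul`, e_A x is the image of the projection of x to kQ_A; if that projection lies in
`RA`, its image is one of the relations of the gluing. -/
lemma toGluing_idemA_mul_eq_zero (hb : IsSource b) (hRB : vertex b ∉ RB) {x : Gluing a b RA RB}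
    (hx : projA a b RA RB hb hRB x = 0) : toGluing a b RA RB (idemA k a b) * x = 0 := by
  obtain ⟨x, rfl⟩ := toGluing_surjective x
  rw [← map_mul, idemA_mul hb]
  exact toGluing_eq_zero (mapLin_inclA_mem (Ideal.Quotient.eq_zero_iff_mem.1 hx))

lemma mul_toGluing_idemB_eq_zero (ha : IsSink a) (hRA : vertex a ∉ RA) {x : Gluing a b RA RB}
    (hx : projB a b RA RB ha hRA x = 0) : x * toGluing a b RA RB (idemB k a b) = 0 := by
  obtain ⟨x, rfl⟩ := toGluing_surjective x
  rw [← map_mul, mul_idemB ha]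
  exact toGluing_eq_zero (mapLin_inclB_mem (Ideal.Quotient.eq_zero_iff_mem.1 hx))

lemma one_sub_toGluing_mul (x : Gluing a b RA RB) :
    (1 - toGluing a b RA RB (idemA k a b)) * x * (1 - toGluing a b RA RB (idemB k a b)) = 0 := by
  obtain ⟨x, rfl⟩ := toGluing_surjective x
  exact toGluing_eq_zero (one_sub_idemA_mul_mem x)

lemma toGluing_idemB_mul (ha : IsSink a) (x : Gluing a b RA RB) :
    toGluing a b RA RB (idemB k a b) * (x * toGluing a b RA RB (idemB k a b)) =
      x * toGluing a b RA RB (idemB k a b) := by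
  obtain ⟨x, rfl⟩ := toGluing_surjective x
  rw [← map_mul, ← map_mul, mul_idemB ha, idemB_mul_mapLin]

lemma mul_toGluing_idemA (hb : IsSource b) (x : Gluing a b RA RB) :
    toGluing a b RA RB (idemA k a b) * x * toGluing a b RA RB (idemA k a b) =
      toGluing a b RA RB (idemA k a b) * x := by
  obtain ⟨x, rfl⟩ := toGluing_surjective x
  rw [← map_mul, ← map_mul, idemA_mul hb, mapLin_mul_idemA]

/-- The gluing embeds in A × B: if both projections of x vanish, then e_A x = 0 and x e_B = 0, so x
= (1 - e_A) x (1 - e_B), which is a relation. -/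
lemma finite_gluing [Module.Finite k (BoundAlgebra RA)] [Module.Finite k (BoundAlgebra RB)]
    (ha : IsSink a) (hRA : vertex a ∉ RA) (hb : IsSource b) (hRB : vertex b ∉ RB) :
    Module.Finite k (Gluing a b RA RB) := by
  let φ : Gluing a b RA RB →ₗ[k] BoundAlgebra RA × BoundAlgebra RB :=
    { toFun := fun x => (projA a b RA RB hb hRB x, projB a b RA RB ha hRA x)
      map_add' := fun x y => by simp only [map_add, Prod.mk_add_mk]
      map_smul' := fun c x => by
        obtain ⟨x, rfl⟩ := toGluing_surjective x
        rw [← toGluing_smul, projA_toGluing, projB_toGluing, map_smul (pathToA a b),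
          map_smul (pathToB a b)]
        exact Prod.ext rfl rfl }
  refine Module.Finite.of_injective φ ((injective_iff_map_eq_zero φ).2 fun x hx => ?_)
  have h1 := toGluing_idemA_mul_eq_zero hb hRB (congrArg Prod.fst hx)
  have h2 := mul_toGluing_idemB_eq_zero ha hRA (congrArg Prod.snd hx)
  simpa [sub_mul, mul_sub, h1, h2] using one_sub_toGluing_mul x

open MulOpposite in
/-- The sink-source gluing has the structure of a gluing ring, with the idempotents `1 - e_B`,
`1 - e_A` and `e_a`. -/
lemma isGluingRing_gluing (ha : IsSink a) (hRA : vertex a ∉ RA) (hb : IsSource b)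
    (hRB : vertex b ∉ RB) :
    IsGluingRing k (projA a b RA RB hb hRB).op (projB a b RA RB ha hRA).op
      (op (1 - toGluing a b RA RB (idemB k a b))) (op (1 - toGluing a b RA RB (idemA k a b)))
      (op (toGluing a b RA RB (vertex (GlueVertex.inA a b a)))) := by
  set eA := toGluing a b RA RB (idemA k a b) with heA
  set eB := toGluing a b RA RB (idemB k a b) with heB
  set e := toGluing a b RA RB (vertex (GlueVertex.inA a b a)) with he
  have hee : e = eA * eB := by rw [he, ← idemA_mul_idemB ha, map_mul]
  have hR : ∀ x, (1 - eA) * x * (1 - eB) = 0 := one_sub_toGluing_mul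
  have hB : ∀ x, (1 - eB) * (x * eB) = 0 := fun x => by
    rw [sub_mul, one_mul, toGluing_idemB_mul ha, sub_self]
  have hA : ∀ x, eA * x * (1 - eA) = 0 := fun x => by
    rw [mul_sub, mul_one, mul_toGluing_idemA hb, sub_self]
  have hBe : ∀ x, (1 - eB) * x * e = 0 := fun x => by
    rw [hee, mul_assoc, ← mul_assoc x, hB]
  have hAe : ∀ x, e * x * (1 - eA) = 0 := fun x => by
    rw [hee, mul_assoc eA, hA]
  refine ⟨?_, ?_, ?_, ?_, ?_, ?_, ?_, ?_, ?_, ?_, ?_, ?_⟩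
  -- The relation (1 - e_A)(1 - e_B) = 0, expanded.
  · rw [hee]
    refine congrArg op ?_
    change 1 - eB + (1 - eA) + eA * eB = 1
    have h := hR 1
    rw [mul_one, mul_sub, mul_one, sub_mul, one_mul] at h
    rw [← sub_eq_zero, ← h]
    abel
  · rintro ⟨x⟩
    exact congrArg op ((mul_assoc _ _ _).symm.trans (hR x))
  · rintro ⟨x⟩
    refine congrArg op ?_
    change (1 - eB) * (x * (1 - eA)) = 0
    -- Vertices outside the first quiver belong to the second.
    have h : (1 - eA) = (1 - eA) * eB := by
      have := hR 1
      rwa [mul_one, mul_sub, mul_one, sub_eq_zero] at this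
    rw [h, ← mul_assoc x, hB]
  · rintro ⟨x⟩
    exact congrArg op ((mul_assoc _ _ _).symm.trans (hBe x))
  · rintro ⟨x⟩
    exact congrArg op ((mul_assoc _ _ _).symm.trans (hAe x))
  · intro x
    obtain ⟨y, hy⟩ := toGluing_surjective (unop x)
    refine ⟨aug b (pathToB a b y), unop_injective ?_⟩
    change e * (unop x * e) = aug b (pathToB a b y) • e
    rw [← hy, he, ← map_mul, ← map_mul, ← mul_assoc, vertex_mul_mul_vertex ha hb, toGluing_smul]
  · rintro ⟨x⟩
    obtain ⟨x, rfl⟩ := Ideal.Quotient.mk_surjective x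
    refine ⟨op (toGluing a b RA RB (mapLin (inclA a b) x)), congrArg op ?_⟩
    exact congrArg _ (pathToA_mapLin a b x)
  · rintro ⟨x⟩
    obtain ⟨x, rfl⟩ := Ideal.Quotient.mk_surjective x
    refine ⟨op (toGluing a b RA RB (mapLin (inclB a b) x)), congrArg op ?_⟩
    exact congrArg _ (pathToB_mapLin a b x)
  · refine congrArg op ?_
    change projA a b RA RB hb hRB (1 - eA) = 0
    rw [map_sub, map_one, heA, projA_toGluing, ← mapLin_inclA_one, pathToA_mapLin, map_one,
      sub_self]
  · refine congrArg op ?_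
    change projB a b RA RB ha hRA (1 - eB) = 0
    rw [map_sub, map_one, heB, projB_toGluing, ← mapLin_inclB_one, pathToB_mapLin, map_one,
      sub_self]
  · rintro ⟨x⟩ hx
    refine congrArg op ?_
    have h : eA * x = 0 := toGluing_idemA_mul_eq_zero hb hRB (op_injective hx)
    change (1 - eA) * x = x
    rw [sub_mul, h, sub_zero, one_mul]
  · rintro ⟨x⟩ hx
    refine congrArg op ?_
    have h : x * eB = 0 := mul_toGluing_idemB_eq_zero ha hRA (op_injective hx)
    change x * (1 - eB) = x
    rw [mul_sub, h, sub_zero, mul_one]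

open scoped ModuleCat in
/-- The bridge is one-dimensional. -/
def bridgeEquiv (ha : IsSink a) (hRA : vertex a ∉ RA) (hb : IsSource b) (hRB : vertex b ∉ RB) :
    bridge ha hRA hb hRB ≃ₗ[k] k where
  toFun x := x
  invFun x := x
  map_add' _ _ := rfl
  left_inv _ := rfl
  right_inv _ := rfl
  map_smul' c x := by
    change (show k from x) * projBridge a b RA RB ha hRA hb hRB (algebraMap k _ c) = c * (show k from x)
    have : projBridge a b RA RB ha hRA hb hRB (algebraMap k _ c) =
      aug (GlueVertex.inA a b a) (algebraMap k _ c) := rfl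
    rw [this, AlgHom.commutes, mul_comm]
    rfl

lemma smul_bridge_eq_zero (ha : IsSink a) (hRA : vertex a ∉ RA) (hb : IsSource b)
    (hRB : vertex b ∉ RB) {x : Gluing a b RA RB}
    (hx : projBridge a b RA RB ha hRA hb hRB x = 0) (m : bridge ha hRA hb hRB) :
    MulOpposite.op x • m = 0 := by
  change (show k from m) * projBridge a b RA RB ha hRA hb hRB x = 0
  rw [hx, mul_zero]

lemma projBridge_idemA (ha : IsSink a) (hRA : vertex a ∉ RA) (hb : IsSource b)
    (hRB : vertex b ∉ RB) :
    projBridge a b RA RB ha hRA hb hRB (toGluing a b RA RB (idemA k a b)) = 1 := by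
  rw [← mapLin_inclA_one]
  exact (aug_mapLin_inclA a b 1).trans (map_one _)

lemma projBridge_idemB (ha : IsSink a) (hRA : vertex a ∉ RA) (hb : IsSource b)
    (hRB : vertex b ∉ RB) :
    projBridge a b RA RB ha hRA hb hRB (toGluing a b RA RB (idemB k a b)) = 1 := by
  rw [← mapLin_inclB_one]
  exact (aug_mapLin_inclB a b 1).trans (map_one _)

end Glue

end SinkSource

end

/-! ### The correspondence for the sink-source gluing. -/

theorem mainTheorem9 {k VA VB : Type u} [Field k] [Quiver.{u} VA] [Quiver.{u} VB]
    [Fintype VA] [Fintype VB]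
    (RA : TwoSidedIdeal (SinkSource.PathAlgebra k VA))
    (RB : TwoSidedIdeal (SinkSource.PathAlgebra k VB))
    [Module.Finite k (SinkSource.BoundAlgebra RA)] [Module.Finite k (SinkSource.BoundAlgebra RB)]
    (a : VA) (b : VB) (ha : SinkSource.IsSink a) (hb : SinkSource.IsSource b)
    (hRA : SinkSource.PathAlgebra.vertex a ∉ RA) (hRB : SinkSource.PathAlgebra.vertex b ∉ RB)
    (d : ℕ) (hd : 0 < d) :
    (Set.BijOn (SinkSource.glueSub ha hRA hb hRB)
        (SinkSource.CT d (SinkSource.BoundAlgebra RA) ×ˢ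
          SinkSource.CT d (SinkSource.BoundAlgebra RB))
        {M | M ∈ SinkSource.CT d (SinkSource.Gluing a b RA RB) ∧
          M (SinkSource.bridge ha hRA hb hRB)} ∧
      Set.BijOn (SinkSource.interSub ha hRA hb hRB)
        {M | M ∈ SinkSource.CT d (SinkSource.Gluing a b RA RB) ∧
          M (SinkSource.bridge ha hRA hb hRB)}
        (SinkSource.CT d (SinkSource.BoundAlgebra RA) ×ˢ
          SinkSource.CT d (SinkSource.BoundAlgebra RB)) ∧
      Set.InvOn (SinkSource.interSub ha hRA hb hRB) (SinkSource.glueSub ha hRA hb hRB)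
        (SinkSource.CT d (SinkSource.BoundAlgebra RA) ×ˢ
          SinkSource.CT d (SinkSource.BoundAlgebra RB))
        {M | M ∈ SinkSource.CT d (SinkSource.Gluing a b RA RB) ∧
          M (SinkSource.bridge ha hRA hb hRB)}) ∧
    (Set.BijOn (SinkSource.glueSub ha hRA hb hRB)
        (SinkSource.ZCT d (SinkSource.BoundAlgebra RA) ×ˢ
          SinkSource.ZCT d (SinkSource.BoundAlgebra RB))
        {M | M ∈ SinkSource.ZCT d (SinkSource.Gluing a b RA RB) ∧
          M (SinkSource.bridge ha hRA hb hRB)} ∧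
      Set.BijOn (SinkSource.interSub ha hRA hb hRB)
        {M | M ∈ SinkSource.ZCT d (SinkSource.Gluing a b RA RB) ∧
          M (SinkSource.bridge ha hRA hb hRB)}
        (SinkSource.ZCT d (SinkSource.BoundAlgebra RA) ×ˢ
          SinkSource.ZCT d (SinkSource.BoundAlgebra RB))) := by
  have hgl : Module.Finite k (SinkSource.Gluing a b RA RB) :=
    SinkSource.finite_gluing ha hRA hb hRB
  have hop : Module.Finite k (SinkSource.Gluing a b RA RB)ᵐᵒᵖ :=
    Module.Finite.equiv (MulOpposite.opLinearEquiv k)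
  have H := SinkSource.isGluingRing_gluing (RA := RA) (RB := RB) ha hRA hb hRB
  have := SinkSource.full_restrictScalars H.surjective_A
  have := SinkSource.full_restrictScalars H.surjective_B
  -- Both e_A and e_B act as 1 on the bridge, so it is killed by the idempotents complementary to
  -- each.
  have hS := H.isBridgeGluing
    (SinkSource.smul_bridge_eq_zero ha hRA hb hRB
      (by rw [map_sub, map_one, SinkSource.projBridge_idemB, sub_self]))
    (SinkSource.smul_bridge_eq_zero ha hRA hb hRB
      (by rw [map_sub, map_one, SinkSource.projBridge_idemA, sub_self]))
    (SinkSource.bridgeEquiv ha hRA hb hRB)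
  exact hS.correspondence (SinkSource.addFunctoriallyFinite_of_finite (k := k))
    (SinkSource.addFunctoriallyFinite_of_finite (k := k))
    (SinkSource.addFunctoriallyFinite_of_finite (k := k))
    (SinkSource.glueSub ha hRA hb hRB) (SinkSource.interSub ha hRA hb hRB)
    (fun _ => rfl) (fun _ => rfl)
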